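/- Let $\Sigma=\{0,1\}$. Write $a\prec_{\rm lex}b$ if $b$ is the immediate successor of $a$ in the lexicographical order of $\Sigma^*$ in which shorter strings come first and strings of equal length are compared bit by bit, and write $\le_{\rm lex}$ for the corresponding reflexive order. Polynomials are real polynomials taking values in $\mathbb N$ at every $n\in\mathbb N$. A nondeterministic polynomial-time Turing machine (NPTM) $M$ makes binary nondeterministic guesses (not necessarily at every step), and each computation path is named by its sequence of guesses. $M$ is $p$-balanced if, for every input $x$, the set of guess sequences along the computation paths of $M$ on $x$ is exactly $\Sigma^{p(|x|)}$. Let ${\rm acc}_M(x)\subseteq\Sigma^{p(|x|)}$ denote the set of accepting paths of $M$ on $x$, and $\#{\rm acc}_M(x)$ its cardinality. ${\rm FP}_{\rm t}$ denotes the total polynomial-time computable functions $\Sigma^*\to\Sigma^*$. **The class ${\rm CLU\#P}$.** A total function $f:\Sigma^*\to\mathbb N$ belongs to ${\rm CLU\#P}$ if there exist a polynomial $p$, a $p$-balanced NPTM $M$, functions $b,\top\in{\rm FP}_{\rm t}$ and a 3-argument polynomial-time computable predicate $\prec$ such that for every $x\in\Sigma^*$ there is a bijection $h_x:\Sigma^{p(|x|)}\to\Sigma^{p(|x|)}$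 with: 1. $|b(x)|=|\top(x)|=p(|x|)$; 2. $h_x(b(x))=0^{p(|x|)}$ and $h_x(\top(x))=1^{p(|x|)}$; 3. for all $y,z\in\Sigma^{p(|x|)}$: ${\prec}(x,y,z)\iff h_x(y)\prec_{\rm lex}h_x(z)$; 4. if $f(x)\ne0$, then there are $\ell,u\in\Sigma^{p(|x|)}$ with ${\rm acc}_M(x)=\{w\in\Sigma^{p(|x|)} : h_x(\ell)\le_{\rm lex}h_x(w)\le_{\rm lex}h_x(u)\}$; 5. $f(x)=\#{\rm acc}_M(x)$. **The class ${\rm CL\#P}$.** Let $A$ be a total order on $\Sigma^*$ (reflexive, antisymmetric, transitive, total), with strict part $<_A$. Write $y\prec_A z$ if $y<_Az$ and there is no $v$ with $y<_Av<_Az$. The order $A$ is length-respecting if $|y|<|z|$ implies $y<_Az$, and it has efficient adjacency checks if the binary relation $\prec_A$ is decidable in polynomial time. For computation paths $y,z$ of $M$ on $x$, let $y\sim_{A,M,x}z$ mean that ($y\prec_Az$ or $z\prec_Ay$) and that $M$ on $x$ accepts on $y$ if and only if it accepts on $z$. An $A$-cluster (of $M$ on $x$) is either $\emptyset$ or an equivalence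 class, consisting of accepting paths, of the reflexive-symmetric-transitive closure of $\sim_{A,M,x}$ on the computation paths of $M$ on $x$. A total function $f:\Sigma^*\to\mathbb N$ belongs to ${\rm CL\#P}$ if there exist a polynomial $p$, a $p$-balanced NPTM $M$, and a length-respecting total order $A$ on $\Sigma^*$ with efficient adjacency checks such that, for all $x$, the set ${\rm acc}_M(x)$ is an $A$-cluster and $f(x)=\#{\rm acc}_M(x)$. **Theorem.** ${\rm CLU\#P}={\rm CL\#P}$. -/

import Mathlib

open Turing

namespace ClusterComputing

/-! ### Strings over `Σ = {0,1}`

A string is a `List Bool`, with `0 = false` and `1 = true`. -/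

/-- The (strict) lexicographical order on `Σ*`: shorter strings come first, and strings of equal
length are compared bit by bit. -/
def LexLT (a b : List Bool) : Prop := List.Shortlex (· < ·) a b

/-- `a ≤_lex b`. -/
def LexLE (a b : List Bool) : Prop := LexLT a b ∨ a = b

/-- `a ≺_lex b`: the string `b` is the lexicographical successor of `a`. -/
def LexSucc (a b : List Bool) : Prop := LexLT a b ∧ ∀ c, ¬ (LexLT a c ∧ LexLT c b)

/-- The set `Σⁿ` of all strings of length `n`. -/
def strings (n : ℕ) : Set (List Bool) := {w | w.length = n}

/-- `p` is a polynomial taking natural-number values on `ℕ`.  No restriction is put on the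
coefficients. -/
def IsNatPoly (p : ℕ → ℕ) : Prop := ∃ q : Polynomial ℝ, ∀ n : ℕ, (p n : ℝ) = q.eval (n : ℝ)

/-! ### Deterministic polynomial time, on multi-stack Turing machines -/

/-- Total polynomial-time computable functions from `Σ*` to `Σ*`. -/
def FPt (f : List Bool → List Bool) : Prop :=
  Nonempty (TM2ComputableInPolyTime (id : List Bool → List Bool) (id : List Bool → List Bool) f)

/-- A string followed by an end marker `none`. -/
def encodeArg (s : List Bool) : List (Option Bool) := s.map some ++ [none]

/-- Two arguments are presented to a machine as `x#y#`. -/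
def encodePair (a : List Bool × List Bool) : List (Option Bool) :=
  encodeArg a.1 ++ encodeArg a.2

/-- Three arguments are presented to a machine as `x#y#z#`. -/
def encodeTriple (a : List Bool × List Bool × List Bool) : List (Option Bool) :=
  encodeArg a.1 ++ encodePair a.2

/-- A predicate `R` on `α` is decidable in polynomial time, with respect to the encoding `enc`. -/
def PolyTimePred {α : Type} (enc : α → List (Option Bool)) (R : α → Prop) : Prop :=
  ∃ g : α → Bool, (∀ a, g a = true ↔ R a) ∧
    Nonempty (TM2ComputableInPolyTime enc Computability.encodeBool g)

/-- A two-argument predicate on strings is computable in polynomial time. -/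
def PolyTimePred₂ (R : List Bool → List Bool → Prop) : Prop :=
  PolyTimePred encodePair fun a => R a.1 a.2

/-- A three-argument predicate on strings is computable in polynomial time. -/
def PolyTimePred₃ (R : List Bool → List Bool → List Bool → Prop) : Prop :=
  PolyTimePred encodeTriple fun a => R a.1 a.2.1 a.2.2

/-! ### Nondeterministic Turing machines -/

/-- A nondeterministic Turing machine with input alphabet `{0,1}`.  It is a multi-stack machine
`tm` (whose output stack is not used) in which some labels carry a second statement: at a label `l`
with `alt l = none` the machine executes `tm.m l`; at a label with `alt l = some s` it makes a
binary nondeterministic guess, and executes `tm.m l` on guess `0` and `s` on guess `1`.  Whether a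
halted computation accepts is read off from the internal state. -/
structure NTM where
  tm : FinTM2
  inputAlphabet : tm.Γ tm.k₀ ≃ Bool
  alt : tm.Λ → Option (TM2.Stmt tm.Γ tm.Λ tm.σ)
  accepts : tm.σ → Bool

namespace NTM

/-- The initial configuration on input `x`. -/
def init (M : NTM) (x : List Bool) : M.tm.Cfg :=
  initList M.tm (x.map M.inputAlphabet.symm)

/-- `M.Run c w t c'`: there is a computation of `M` from `c` to `c'` that takes exactly `t` steps,
and `w` is the sequence of nondeterministic guesses made along it. -/
inductive Run (M : NTM) : M.tm.Cfg → List Bool → ℕ → M.tm.Cfg → Prop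
  | refl (c : M.tm.Cfg) : Run M c [] 0 c
  | det {l : M.tm.Λ} {v : M.tm.σ} {S : ∀ k, List (M.tm.Γ k)} {w : List Bool} {t : ℕ}
      {c : M.tm.Cfg} (hl : M.alt l = none) (h : Run M (TM2.stepAux (M.tm.m l) v S) w t c) :
      Run M (TM2.Cfg.mk (some l) v S) w (t + 1) c
  | guessZero {l : M.tm.Λ} {s : TM2.Stmt M.tm.Γ M.tm.Λ M.tm.σ} {v : M.tm.σ}
      {S : ∀ k, List (M.tm.Γ k)} {w : List Bool} {t : ℕ} {c : M.tm.Cfg}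
      (hl : M.alt l = some s) (h : Run M (TM2.stepAux (M.tm.m l) v S) w t c) :
      Run M (TM2.Cfg.mk (some l) v S) (false :: w) (t + 1) c
  | guessOne {l : M.tm.Λ} {s : TM2.Stmt M.tm.Γ M.tm.Λ M.tm.σ} {v : M.tm.σ}
      {S : ∀ k, List (M.tm.Γ k)} {w : List Bool} {t : ℕ} {c : M.tm.Cfg}
      (hl : M.alt l = some s) (h : Run M (TM2.stepAux s v S) w t c) :
      Run M (TM2.Cfg.mk (some l) v S) (true :: w) (t + 1) c

/-- The computation paths of `M` on input `x`, each named by its sequence of guesses, which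
determines it. -/
def paths (M : NTM) (x : List Bool) : Set (List Bool) :=
  {w | ∃ (t : ℕ) (c : M.tm.Cfg), M.Run (M.init x) w t c ∧ TM2.Cfg.l c = none}

/-- The accepting computation paths of `M` on input `x`. -/
def acc (M : NTM) (x : List Bool) : Set (List Bool) :=
  {w | ∃ (t : ℕ) (c : M.tm.Cfg), M.Run (M.init x) w t c ∧ TM2.Cfg.l c = none ∧
    M.accepts (TM2.Cfg.var c) = true}

/-- The number of accepting computation paths of `M` on input `x`. -/
noncomputable def numAcc (M : NTM) (x : List Bool) : ℕ := (M.acc x).ncard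

/-- `M` is a nondeterministic *polynomial-time* machine: some polynomial in the input length bounds
the number of steps of every computation, whatever the guesses. -/
def IsPolyTime (M : NTM) : Prop :=
  ∃ q : Polynomial ℕ, ∀ (x w : List Bool) (t : ℕ) (c : M.tm.Cfg),
    M.Run (M.init x) w t c → t ≤ q.eval x.length

/-- `M` is `p`-balanced: the guess sequences of its computation paths on `x` are exactly the
strings of length `p(|x|)`. -/
def IsBalanced (M : NTM) (p : ℕ → ℕ) : Prop :=
  ∀ x, M.paths x = strings (p x.length)

end NTM

/-! ### The class `CLU#P` -/

/-- The class `CLU#P`, based on input-specific orderings of the computation paths. -/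
def CLUSharpP : Set (List Bool → ℕ) :=
  {f | ∃ p : ℕ → ℕ, IsNatPoly p ∧
    ∃ M : NTM, M.IsPolyTime ∧ M.IsBalanced p ∧
    ∃ b top : List Bool → List Bool, FPt b ∧ FPt top ∧
    ∃ prec : List Bool → List Bool → List Bool → Prop, PolyTimePred₃ prec ∧
    ∀ x : List Bool, ∃ h : List Bool → List Bool,
      Set.BijOn h (strings (p x.length)) (strings (p x.length)) ∧
      ((b x).length = p x.length ∧ (top x).length = p x.length) ∧
      (h (b x) = List.replicate (p x.length) false ∧
        h (top x) = List.replicate (p x.length) true) ∧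
      (∀ y ∈ strings (p x.length), ∀ z ∈ strings (p x.length),
        prec x y z ↔ LexSucc (h y) (h z)) ∧
      (f x ≠ 0 → ∃ l ∈ strings (p x.length), ∃ u ∈ strings (p x.length),
        M.acc x = {w | w ∈ strings (p x.length) ∧ LexLE (h l) (h w) ∧ LexLE (h w) (h u)}) ∧
      f x = M.numAcc x}

/-! ### The class `CL#P` -/

/-- The strict part `x <_A y` of an order `A`. -/
def StrictPart (A : List Bool → List Bool → Prop) (x y : List Bool) : Prop := A x y ∧ x ≠ y

/-- `x ≺_A y`: the string `x` is left-adjacent to `y` in the order `A`. -/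
def Adj (A : List Bool → List Bool → Prop) (x y : List Bool) : Prop :=
  StrictPart A x y ∧ ¬ ∃ z, StrictPart A x z ∧ StrictPart A z y

/-- Shorter strings are strictly smaller than longer strings. -/
def LengthRespecting (A : List Bool → List Bool → Prop) : Prop :=
  ∀ x y : List Bool, x.length < y.length → StrictPart A x y

/-- The relation `∼_{A,M,x}` on the computation paths of `M` on `x`: the two paths are adjacent in
the order `A`, and both accept or both reject. -/
def PathSim (A : List Bool → List Bool → Prop) (M : NTM) (x : List Bool)
    (y z : M.paths x) : Prop :=
  (Adj A y z ∨ Adj A z y) ∧ ((y : List Bool) ∈ M.acc x ↔ (z : List Bool) ∈ M.acc x)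

/-- `C` is an `A`-cluster (for `M` on `x`): it is empty, or it is an equivalence class, consisting
of accepting paths, of the equivalence closure of `∼_{A,M,x}`. -/
def IsCluster (A : List Bool → List Bool → Prop) (M : NTM) (x : List Bool)
    (C : Set (List Bool)) : Prop :=
  C = ∅ ∨ ∃ y : M.paths x, (y : List Bool) ∈ M.acc x ∧
    C = {w | ∃ z : M.paths x, (z : List Bool) = w ∧ Relation.EqvGen (PathSim A M x) y z}

/-- The class `CL#P`, based on a single order of `Σ*` shared by all inputs. -/
def CLSharpP : Set (List Bool → ℕ) :=
  {f | ∃ p : ℕ → ℕ, IsNatPoly p ∧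
    ∃ M : NTM, M.IsPolyTime ∧ M.IsBalanced p ∧
    ∃ A : List Bool → List Bool → Prop,
      IsLinearOrder (List Bool) A ∧ LengthRespecting A ∧ PolyTimePred₂ (Adj A) ∧
      ∀ x : List Bool, IsCluster A M x (M.acc x) ∧ f x = M.numAcc x}

end ClusterComputing

namespace ClusterComputing

/-! The classes differ in their orders: `CLU#P` has one order per input, with computable endpoints,
and `CL#P` has one order for all inputs, with unknown endpoints on each length. Both inclusions
rename the computation paths. In both, lexicographic order is replaced by arithmetic on `rank`, the
position of a string in shortlex order.

`CLU#P ⊆ CL#P`. A common order can serve all inputs if the name of a path reveals its input. The new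
machine (`exists_ntm_header`) first guesses `2|x| + 1` bits and accepts only if they form a
self-delimiting code of `x` and the old path accepts. Strings with a fixed header and a fixed tail
length form a shortlex interval, so applying `h x` to the tails permutes each such block and moves
nothing else. The order `A` compares the ranks after this permutation `reorder`. Within a block,
adjacency is the given predicate. Between blocks, only the last element of one (`top x`, if there is
a header) and the first of another (`b x'`) can be adjacent, and the positions of the blocks are
explicit (`lexSucc_reorder`). An accepting interval of `M` becomes an interval of `A`, hence a
cluster (`isCluster_of_rank`).

`CL#P ⊆ CLU#P`. A length-respecting order has order type `ℕ`, given by a rank `r` (`exists_rank`),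
and a cluster is convex for `r`, since a chain of adjacent paths skips no rank
(`exists_eqvGen_of_rank`). With `m = p(|x|)`, the first and last strings of length `m` in the order
`A` may be hard to compute. So the new paths, of length `4m + 3`, encode the whole initial segment
of `A`: every string of length at most `m` is padded to length `4m + 3`, and its least element, the
empty string, becomes `0…0`. The segment is continued by the first string `z` of length `m + 1`,
encoded together with its predecessor `y`; adjacency and the lengths certify that the segment ends
there. Then come all remaining strings in lexicographic order, the last being `1…1`. Labelled
strings end in `0`, so no two are lexicographic neighbours and the next unlabelled string is at most
two steps away. The successor relation is therefore decidable (`RankCut.labelSucc_iff`), and both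
endpoints are constant strings.

The polynomial `p` need not be computed. In the first inclusion the length of `b x` supplies its
value; in the second, a balanced machine run with all guesses `0` serves as a clock
(`pt_replicate_of_isBalanced`). Polynomial-time claims rest on three closure properties:
composition, finite transducers, and merging two outputs computed from one input. -/

set_option linter.unusedSectionVars false

/-! ### Timed reachability for multi-stack machines -/

section Reach

variable {K : Type} [DecidableEq K] {Γ : K → Type} {Λ σ : Type}

/-- `Reach m c t c'`: the machine `m` gets from `c` to `c'` in exactly `t` steps. -/
inductive Reach (m : Λ → TM2.Stmt Γ Λ σ) : TM2.Cfg Γ Λ σ → ℕ → TM2.Cfg Γ Λ σ → Prop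
  | refl (c : TM2.Cfg Γ Λ σ) : Reach m c 0 c
  | step {l : Λ} {v : σ} {S : ∀ k, List (Γ k)} {t : ℕ} {c : TM2.Cfg Γ Λ σ}
      (h : Reach m (TM2.stepAux (m l) v S) t c) : Reach m ⟨some l, v, S⟩ (t + 1) c

theorem Reach.trans {m : Λ → TM2.Stmt Γ Λ σ} {c₁ c₂ c₃ : TM2.Cfg Γ Λ σ} {t₁ t₂ : ℕ}
    (h₁ : Reach m c₁ t₁ c₂) (h₂ : Reach m c₂ t₂ c₃) : Reach m c₁ (t₁ + t₂) c₃ := by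
  induction h₁ with
  | refl => simpa using h₂
  | step _ ih => rw [Nat.add_right_comm]; exact .step (ih h₂)

theorem iterate_none {α : Type} (f : α → Option α) (t : ℕ) :
    (flip bind f)^[t] none = (none : Option α) := by
  induction t with
  | zero => rfl
  | succ t ih => rw [Function.iterate_succ_apply]; exact ih

/-- A halted configuration steps to `none`, which is absorbing, so an iterate equal to `some c'`
excludes an earlier halt. -/
theorem reach_iff_iterate {m : Λ → TM2.Stmt Γ Λ σ} {c c' : TM2.Cfg Γ Λ σ} {t : ℕ} :
    Reach m c t c' ↔ (flip bind (TM2.step m))^[t] (some c) = some c' := by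
  constructor
  · intro h
    induction h with
    | refl => rfl
    | step _ ih => rw [Function.iterate_succ_apply]; exact ih
  · intro h
    induction t generalizing c with
    | zero =>
      cases h
      exact .refl _
    | succ t ih =>
      rw [Function.iterate_succ_apply] at h
      obtain ⟨_ | l, v, S⟩ := c
      · exact absurd ((iterate_none _ t).symm.trans h) (by simp)
      · exact .step (ih h)

/-- An upper bound for the number of symbols pushed by a statement. -/
def pushes : TM2.Stmt Γ Λ σ → ℕ
  | .push _ _ q => pushes q + 1
  | .peek _ _ q => pushes q
  | .pop _ _ q => pushes q
  | .load _ q => pushes q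
  | .branch _ q₁ q₂ => pushes q₁ + pushes q₂
  | .goto _ => 0
  | .halt => 0

theorem length_stepAux_le (q : TM2.Stmt Γ Λ σ) (v : σ) (S : ∀ k, List (Γ k)) (k : K) :
    ((TM2.stepAux q v S).stk k).length ≤ (S k).length + pushes q := by
  induction q generalizing v S with
  | push k' f q ih =>
    refine (ih _ _).trans ?_
    by_cases h : k = k'
    · subst h; simp [pushes]; omega
    · simp [pushes, Function.update_of_ne h]
  | peek k' f q ih => exact ih _ _
  | pop k' f q ih =>
    refine (ih _ _).trans ?_
    by_cases h : k = k'
    · subst h; simp [pushes]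
    · simp [pushes, Function.update_of_ne h]
  | load a q ih => exact ih _ _
  | branch f q₁ q₂ ih₁ ih₂ =>
    have h₁ := ih₁ v S
    have h₂ := ih₂ v S
    simp only [TM2.stepAux, pushes]
    cases f v <;> simp only [cond_true, cond_false] <;> omega
  | goto f => simp [pushes]
  | halt => simp [pushes]

/-- Each step pushes a bounded number of symbols; the sum over all labels is a crude common bound.
It makes outputs polynomially long and bounds the cleaning time of the clock machine. -/
theorem Reach.length_le [Fintype Λ] {m : Λ → TM2.Stmt Γ Λ σ} {c c' : TM2.Cfg Γ Λ σ} {t : ℕ}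
    (h : Reach m c t c') (k : K) :
    (c'.stk k).length ≤ (c.stk k).length + t * ∑ l, pushes (m l) := by
  induction h with
  | refl => simp
  | @step l v S t c _ ih =>
    have h₁ := length_stepAux_le (m l) v S k
    have h₂ : pushes (m l) ≤ ∑ l, pushes (m l) :=
      Finset.single_le_sum (f := fun l => pushes (m l)) (fun _ _ => Nat.zero_le _)
        (Finset.mem_univ l)
    rw [Nat.add_mul, one_mul]
    dsimp only
    omega

end Reach

/-! ### Embedding a machine into a larger one -/

section Embed

variable {K K' Λ Λ' σ σ' ρ : Type} {Γ' : K' → Type}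

/-- A statement of a submachine, as a statement of a host machine.  The stacks of the submachine
are a part of those of the host, its state is one component of the state of the host, and halting is
replaced by a jump to `ret` (if there is one). -/
def embed (ι : K → K') (E : σ' ≃ σ × ρ) (j : Λ → Λ') (ret : Option Λ') :
    TM2.Stmt (fun k => Γ' (ι k)) Λ σ → TM2.Stmt Γ' Λ' σ'
  | .push k f q => .push (ι k) (fun v => f (E v).1) (embed ι E j ret q)
  | .peek k f q => .peek (ι k) (fun v o => E.symm (f (E v).1 o, (E v).2)) (embed ι E j ret q)
  | .pop k f q => .pop (ι k) (fun v o => E.symm (f (E v).1 o, (E v).2)) (embed ι E j ret q)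
  | .load a q => .load (fun v => E.symm (a (E v).1, (E v).2)) (embed ι E j ret q)
  | .branch f q₁ q₂ => .branch (fun v => f (E v).1) (embed ι E j ret q₁) (embed ι E j ret q₂)
  | .goto f => .goto (fun v => j (f (E v).1))
  | .halt => match ret with
    | some r => .goto (fun _ => r)
    | none => .halt

/-- The configuration `d` of the host extends the configuration `c` of the submachine; `r` is the
rest of the state of the host, and `F` gives its other stacks. -/
structure Extends (ι : K → K') (E : σ' ≃ σ × ρ) (j : Λ → Λ') (ret : Option Λ') (r : ρ)
    (F : ∀ k, List (Γ' k)) (c : TM2.Cfg (fun k => Γ' (ι k)) Λ σ) (d : TM2.Cfg Γ' Λ' σ') :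
    Prop where
  label : d.l = (c.l.map j).or ret
  var : d.var = E.symm (c.var, r)
  stk : ∀ k, d.stk (ι k) = c.stk k
  frame : ∀ k, k ∉ Set.range ι → d.stk k = F k

variable {ι : K → K'} {E : σ' ≃ σ × ρ} {j : Λ → Λ'}
  {ret : Option Λ'} {r : ρ} {F : ∀ k, List (Γ' k)}

theorem Extends.eq_mk {l : Λ} {v : σ} {S : ∀ k, List (Γ' (ι k))} {d : TM2.Cfg Γ' Λ' σ'}
    (h : Extends ι E j ret r F ⟨some l, v, S⟩ d) :
    d = ⟨some (j l), E.symm (v, r), d.stk⟩ := by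
  obtain ⟨dl, dv, dS⟩ := d
  obtain ⟨h₁, h₂, -, -⟩ := h
  cases h₁
  cases h₂
  rfl

theorem update_frame [DecidableEq K'] {S' : ∀ k, List (Γ' k)}
    (hF : ∀ k, k ∉ Set.range ι → S' k = F k) (k₀ : K) (x : List (Γ' (ι k₀))) (k : K')
    (hk : k ∉ Set.range ι) : Function.update S' (ι k₀) x k = F k := by
  rw [Function.update_of_ne (fun h => hk ⟨k₀, h.symm⟩), hF k hk]

variable [DecidableEq K] [DecidableEq K']

theorem update_embed (hι : ι.Injective) {S : ∀ k, List (Γ' (ι k))} {S' : ∀ k, List (Γ' k)}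
    (hS : ∀ k, S' (ι k) = S k) (k₀ : K) (x : List (Γ' (ι k₀))) (k : K) :
    Function.update S' (ι k₀) x (ι k) = Function.update S k₀ x k := by
  by_cases h : k = k₀
  · subst h; simp
  · rw [Function.update_of_ne h, Function.update_of_ne (fun h' => h (hι h')), hS]

/-- Structural induction on the statement. Injectivity of `ι` keeps distinct stacks of the
submachine distinct in the host, and stacks outside the range of `ι` are never touched. -/
theorem extends_stepAux (hι : ι.Injective) (q : TM2.Stmt (fun k => Γ' (ι k)) Λ σ) (v : σ)
    (S : ∀ k, List (Γ' (ι k))) (S' : ∀ k, List (Γ' k)) (hS : ∀ k, S' (ι k) = S k)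
    (hF : ∀ k, k ∉ Set.range ι → S' k = F k) :
    Extends ι E j ret r F (TM2.stepAux q v S)
      (TM2.stepAux (embed ι E j ret q) (E.symm (v, r)) S') := by
  induction q generalizing v S S' with
  | push k f q ih =>
    simp only [TM2.stepAux, embed, Equiv.apply_symm_apply]
    refine ih _ _ _ (fun k' => ?_) (fun k' hk' => ?_)
    · rw [hS k]; exact update_embed hι hS _ _ _
    · exact update_frame hF _ _ _ hk'
  | peek k f q ih =>
    simp only [TM2.stepAux, embed, Equiv.apply_symm_apply]
    rw [hS k]
    exact ih _ _ _ hS hF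
  | pop k f q ih =>
    simp only [TM2.stepAux, embed, Equiv.apply_symm_apply]
    rw [hS k]
    refine ih _ _ _ (fun k' => ?_) (fun k' hk' => ?_)
    · exact update_embed hι hS _ _ _
    · exact update_frame hF _ _ _ hk'
  | load a q ih =>
    simp only [TM2.stepAux, embed, Equiv.apply_symm_apply]
    exact ih _ _ _ hS hF
  | branch f q₁ q₂ ih₁ ih₂ =>
    simp only [TM2.stepAux, embed, Equiv.apply_symm_apply]
    cases f v
    · exact ih₂ _ _ _ hS hF
    · exact ih₁ _ _ _ hS hF
  | goto f =>
    simp only [TM2.stepAux, embed, Equiv.apply_symm_apply]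
    exact ⟨rfl, rfl, hS, hF⟩
  | halt =>
    cases ret <;> exact ⟨rfl, rfl, hS, hF⟩

/-- A host that contains a submachine simulates it step by step. -/
theorem Reach.embed (hι : ι.Injective) {m : Λ → TM2.Stmt (fun k => Γ' (ι k)) Λ σ}
    {m' : Λ' → TM2.Stmt Γ' Λ' σ'} (hm : ∀ l, m' (j l) = embed ι E j ret (m l))
    {c c' : TM2.Cfg (fun k => Γ' (ι k)) Λ σ} {t : ℕ} (h : Reach m c t c')
    {d : TM2.Cfg Γ' Λ' σ'} (hd : Extends ι E j ret r F c d) :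
    ∃ d', Reach m' d t d' ∧ Extends ι E j ret r F c' d' := by
  induction h generalizing d with
  | refl => exact ⟨d, .refl _, hd⟩
  | @step l v S t c _ ih =>
    obtain ⟨d', h₁, h₂⟩ := ih (extends_stepAux hι (m l) v S d.stk hd.stk hd.frame)
    refine ⟨d', ?_, h₂⟩
    rw [hd.eq_mk]
    refine .step ?_
    rw [hm]
    exact h₁

end Embed

/-! ### Polynomial-time transformations between presentations -/

instance fintypeK (tm : FinTM2) : Fintype tm.K := tm.kFin
instance fintypeLabel (tm : FinTM2) : Fintype tm.Λ := tm.ΛFin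
instance fintypeState (tm : FinTM2) : Fintype tm.σ := tm.σFin
instance fintypeInput (tm : FinTM2) : Fintype (tm.Γ tm.k₀) := tm.Γk₀Fin

/-- The family of stacks in which stack `k` holds `s` and all others are empty. -/
def single {K : Type} [DecidableEq K] {Γ : K → Type} (k : K) (s : List (Γ k)) :
    ∀ k, List (Γ k) :=
  Function.update (fun _ => []) k s

section single
variable {K : Type} [DecidableEq K] {Γ : K → Type}

@[simp] theorem single_same (k : K) (s : List (Γ k)) : single k s k = s := by simp [single]

theorem single_of_ne {k k' : K} (h : k' ≠ k) (s : List (Γ k)) : single k s k' = [] := by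
  simp [single, h]

theorem eq_single {S : ∀ k, List (Γ k)} {k : K} {s : List (Γ k)} (h : S k = s)
    (h' : ∀ k', k' ≠ k → S k' = []) : S = single k s := by
  funext k'
  by_cases hk : k' = k
  · subst hk; rw [single_same, h]
  · rw [h' _ hk, single_of_ne hk]

end single

/-- A host that runs a submachine to completion. -/
theorem Reach.call {K K' Λ Λ' σ σ' ρ : Type} [DecidableEq K] [DecidableEq K'] {Γ' : K' → Type}
    {ι : K → K'} {E : σ' ≃ σ × ρ} {j : Λ → Λ'} {ret : Option Λ'} (hι : ι.Injective)
    {m : Λ → TM2.Stmt (fun k => Γ' (ι k)) Λ σ} {m' : Λ' → TM2.Stmt Γ' Λ' σ'}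
    (hm : ∀ l, m' (j l) = ClusterComputing.embed ι E j ret (m l)) {main : Λ} {v : σ} {k₀ k₁ : K}
    {s : List (Γ' (ι k₀))} {u : List (Γ' (ι k₁))} {t : ℕ}
    (h : Reach m ⟨some main, v, single k₀ s⟩ t ⟨none, v, single k₁ u⟩) (r : ρ)
    {S : ∀ k, List (Γ' k)} (hs : S (ι k₀) = s) (hS : ∀ k, k ≠ k₀ → S (ι k) = []) :
    ∃ S' : ∀ k, List (Γ' k),
      Reach m' ⟨some (j main), E.symm (v, r), S⟩ t ⟨ret, E.symm (v, r), S'⟩ ∧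
      S' (ι k₁) = u ∧ (∀ k, k ≠ k₁ → S' (ι k) = []) ∧ ∀ k, k ∉ Set.range ι → S' k = S k := by
  obtain ⟨⟨l, w, S'⟩, hr, hl, hw, hs', hf⟩ := Reach.embed (r := r) (F := S) hι hm h
    (d := ⟨some (j main), E.symm (v, r), S⟩)
    ⟨rfl, rfl, congrFun (f := fun k => S (ι k)) (eq_single hs hS), fun _ _ => rfl⟩
  dsimp only at hl hw hs' hf
  subst hl hw
  refine ⟨S', hr, (hs' _).trans (single_same _ _), fun k hk => (hs' _).trans (single_of_ne hk _), hf⟩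

theorem initList_eq (tm : FinTM2) (s : List (tm.Γ tm.k₀)) :
    initList tm s = ⟨some tm.main, tm.initialState, single tm.k₀ s⟩ := by
  unfold initList
  congr 1
  refine eq_single ?_ fun k' hk' => ?_
  · simp
  · simp [hk']

theorem haltList_eq (tm : FinTM2) (s : List (tm.Γ tm.k₁)) :
    haltList tm s = ⟨none, tm.initialState, single tm.k₁ s⟩ := by
  unfold haltList
  congr 1
  refine eq_single ?_ fun k' hk' => ?_
  · simp
  · simp [hk']

theorem eval_mono (q : Polynomial ℕ) {a b : ℕ} (h : a ≤ b) : q.eval a ≤ q.eval b := by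
  rw [Polynomial.eval_eq_sum_range, Polynomial.eval_eq_sum_range]
  exact Finset.sum_le_sum fun i _ => Nat.mul_le_mul_left _ (Nat.pow_le_pow_left h i)

/-- From the string `e i`, the string `f i` can be computed in polynomial time. -/
def PT {I α β : Type} (e : I → List α) (f : I → List β) : Prop :=
  Nonempty (TM2ComputableInPolyTime e (id : List β → List β) f)

section PT

variable {I α β γ : Type}

/-- A successful computation ends in the initial internal state with all stacks empty except the
output. This clean ending lets a host call a machine with `Reach.call` and continue from a known
configuration. -/
theorem pt_iff {e : I → List α} {f : I → List β} :
    PT e f ↔ ∃ (tm : FinTM2) (iE : tm.Γ tm.k₀ ≃ α) (oE : tm.Γ tm.k₁ ≃ β) (q : Polynomial ℕ),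
      ∀ i, ∃ t ≤ q.eval (e i).length,
        Reach tm.m ⟨some tm.main, tm.initialState, single tm.k₀ ((e i).map iE.symm)⟩ t
          ⟨none, tm.initialState, single tm.k₁ ((f i).map oE.symm)⟩ := by
  constructor
  · rintro ⟨⟨⟨tm, iE, oE⟩, q, h⟩⟩
    refine ⟨tm, iE, oE, q, fun i => ⟨(h i).steps, (h i).steps_le_m, ?_⟩⟩
    have := (h i).evals_in_steps
    rw [reach_iff_iterate, ← initList_eq, ← haltList_eq]
    exact this
  · rintro ⟨tm, iE, oE, q, h⟩
    choose t ht hr using h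
    refine ⟨⟨⟨tm, iE, oE⟩, q, fun i => ⟨⟨t i, ?_⟩, ht i⟩⟩⟩
    have := reach_iff_iterate.1 (hr i)
    rw [← initList_eq, ← haltList_eq] at this
    exact this

theorem PT.intro {K Λ σ : Type} [DecidableEq K] [Fintype K] [Fintype Λ] [Fintype σ]
    {Γ : K → Type} (k₀ k₁ : K) [Fintype (Γ k₀)] (main : Λ) (v : σ) (m : Λ → TM2.Stmt Γ Λ σ)
    {e : I → List α} {f : I → List β} (iE : Γ k₀ ≃ α) (oE : Γ k₁ ≃ β) (q : Polynomial ℕ)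
    (h : ∀ i, ∃ t ≤ q.eval (e i).length, Reach m ⟨some main, v, single k₀ ((e i).map iE.symm)⟩ t
      ⟨none, v, single k₁ ((f i).map oE.symm)⟩) : PT e f :=
  pt_iff.2 ⟨{ k₀ := k₀, k₁ := k₁, Γ := Γ, Λ := Λ, main := main, σ := σ, initialState := v, m := m },
    iE, oE, q, h⟩

theorem PT.reindex {J : Type} {e : I → List α} {f : I → List β} (h : PT e f) (φ : J → I) :
    PT (fun j => e (φ j)) (fun j => f (φ j)) := by
  obtain ⟨tm, iE, oE, q, h⟩ := pt_iff.1 h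
  exact pt_iff.2 ⟨tm, iE, oE, q, fun j => h (φ j)⟩

theorem PT.congr {e e' : I → List α} {f f' : I → List β} (h : PT e f) (he : ∀ i, e i = e' i)
    (hf : ∀ i, f i = f' i) : PT e' f' := by
  obtain rfl : e = e' := funext he
  obtain rfl : f = f' := funext hf
  exact h

theorem PT.refl [Fintype α] (e : I → List α) : PT e e :=
  ⟨⟨(idComputableInPolyTime e).toTM2ComputableAux, 1, (idComputableInPolyTime e).outputsFun⟩⟩

/-- The output of a polynomial-time computation has polynomial length. -/
theorem PT.exists_length_le {e : I → List α} {f : I → List β} (h : PT e f) :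
    ∃ q : Polynomial ℕ, ∀ i, (f i).length ≤ q.eval (e i).length := by
  obtain ⟨tm, iE, oE, q, h⟩ := pt_iff.1 h
  refine ⟨Polynomial.X + q * Polynomial.C (∑ l, pushes (tm.m l)), fun i => ?_⟩
  obtain ⟨t, ht, hr⟩ := h i
  have h₁ := hr.length_le tm.k₁
  have h₂ : (single (Γ := tm.Γ) tm.k₀ ((e i).map iE.symm) tm.k₁).length ≤ (e i).length := by
    by_cases hk : tm.k₁ = tm.k₀
    -- The type of a stack depends on its index, so the equality of indices is eliminated for a
    -- variable `k`.
    · have : ∀ k, k = tm.k₀ → (single (Γ := tm.Γ) tm.k₀ ((e i).map iE.symm) k).length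
          ≤ (e i).length := by
        rintro k rfl; simp
      exact this _ hk
    · rw [single_of_ne hk]; simp
  simp only [single_same, List.length_map] at h₁
  simp only [Polynomial.eval_add, Polynomial.eval_X, Polynomial.eval_mul, Polynomial.eval_C]
  exact h₁.trans (Nat.add_le_add h₂ (Nat.mul_le_mul_right _ ht))

/-! #### Composition -/

/-- A family indexed by a sum, given by its two parts. -/
abbrev sumFam {K₁ K₂ : Type} (Γ₁ : K₁ → Type) (Γ₂ : K₂ → Type) : K₁ ⊕ K₂ → Type
  | .inl k => Γ₁ k
  | .inr k => Γ₂ k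

section Comp

variable [Inhabited β] (M₁ M₂ : FinTM2) (oE : M₁.Γ M₁.k₁ ≃ β) (iE : M₂.Γ M₂.k₀ ≃ β)

/-- The state of the second submachine as a component of the state of the host. -/
def secondState (σ₁ σ₂ ρ : Type) : σ₁ × σ₂ × ρ ≃ σ₂ × σ₁ × ρ where
  toFun v := (v.2.1, v.1, v.2.2)
  invFun v := (v.2.1, v.1, v.2.2)

/-- Run `M₁`, move its output to the input stack of `M₂`, which reverses it, and run `M₂`. -/
def compProg : M₁.Λ ⊕ M₂.Λ ⊕ Unit →
    TM2.Stmt (sumFam M₁.Γ M₂.Γ) (M₁.Λ ⊕ M₂.Λ ⊕ Unit) (M₁.σ × M₂.σ × Option β)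
  | .inl l => embed (Γ' := sumFam M₁.Γ M₂.Γ) Sum.inl (Equiv.refl _) Sum.inl
      (some (.inr (.inr ()))) (M₁.m l)
  | .inr (.inl l) => embed (Γ' := sumFam M₁.Γ M₂.Γ) Sum.inr (secondState _ _ _)
      (fun l => .inr (.inl l)) none (M₂.m l)
  | .inr (.inr ()) => .pop (.inl M₁.k₁) (fun v o => (v.1, v.2.1, o.map oE)) <|
      .branch (fun v => v.2.2.isSome)
        (.push (.inr M₂.k₀) (fun v => iE.symm (v.2.2.getD default))
          (.goto fun _ => .inr (.inr ())))
        (.goto fun _ => .inr (.inl M₂.main))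

/-- Popping from one stack and pushing on another reverses the string. The buffer `o` is overwritten
by the first pop, so its initial value is arbitrary. -/
theorem compProg_move (v₁ : M₁.σ) (v₂ : M₂.σ) (o : Option β)
    (S : ∀ k, List (sumFam M₁.Γ M₂.Γ k)) (L : List β)
    (hL : S (.inl M₁.k₁) = L.map oE.symm) :
    ∃ S' : ∀ k, List (sumFam M₁.Γ M₂.Γ k),
      Reach (compProg M₁ M₂ oE iE) ⟨some (.inr (.inr ())), (v₁, v₂, o), S⟩ (L.length + 1)
        ⟨some (.inr (.inl M₂.main)), (v₁, v₂, none), S'⟩ ∧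
      S' (.inl M₁.k₁) = [] ∧ S' (.inr M₂.k₀) = L.reverse.map iE.symm ++ S (.inr M₂.k₀) ∧
      ∀ k, k ≠ .inl M₁.k₁ → k ≠ .inr M₂.k₀ → S' k = S k := by
  induction L generalizing S o with
  | nil =>
    refine ⟨Function.update S (.inl M₁.k₁) [], ?_, by simp, by simp, fun k hk _ => by simp [hk]⟩
    refine .step ?_
    simp only [compProg, TM2.stepAux, hL, List.map_nil, List.head?_nil, Option.map_none,
      Option.isSome_none, cond_false, List.tail_nil]
    exact .refl _
  | cons b L ih =>
    obtain ⟨S', h₁, h₂, h₃, h₄⟩ := ih (some b)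
      (Function.update (Function.update S (.inl M₁.k₁) (L.map oE.symm)) (.inr M₂.k₀)
        (iE.symm b :: S (.inr M₂.k₀))) (by simp)
    refine ⟨S', ?_, h₂, ?_, fun k hk hk' => ?_⟩
    · refine .step ?_
      simp only [compProg, TM2.stepAux, hL, List.map_cons, List.head?_cons, Option.map_some,
        Option.isSome_some, cond_true, List.tail_cons, Equiv.apply_symm_apply, Option.getD_some]
      simpa using h₁
    · rw [h₃]; simp
    · rw [h₄ k hk hk']; simp [hk, hk']

variable {M₁ M₂ oE iE}

theorem compProg_reach {s : List (M₁.Γ M₁.k₀)} {L : List β} {u : List (M₂.Γ M₂.k₁)} {t₁ t₂ : ℕ}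
    (h₁ : Reach M₁.m ⟨some M₁.main, M₁.initialState, single M₁.k₀ s⟩ t₁
      ⟨none, M₁.initialState, single M₁.k₁ (L.map oE.symm)⟩)
    (h₂ : Reach M₂.m ⟨some M₂.main, M₂.initialState, single M₂.k₀ (L.reverse.map iE.symm)⟩ t₂
      ⟨none, M₂.initialState, single M₂.k₁ u⟩) :
    Reach (compProg M₁ M₂ oE iE)
      ⟨some (.inl M₁.main), (M₁.initialState, M₂.initialState, none),
        single (.inl M₁.k₀) s⟩ (t₁ + (L.length + 1 + t₂))
      ⟨none, (M₁.initialState, M₂.initialState, none), single (.inr M₂.k₁) u⟩ := by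
  obtain ⟨S₁, hr₁, ha₁, hb₁, hc₁⟩ := Reach.call (Γ' := sumFam M₁.Γ M₂.Γ) (ι := Sum.inl)
    (E := Equiv.refl _) (j := Sum.inl) (ret := some (.inr (.inr ()))) (m' := compProg M₁ M₂ oE iE)
    Sum.inl_injective (fun _ => rfl) h₁
    (M₂.initialState, none) (S := single (.inl M₁.k₀) s) (by simp)
    (fun k hk => single_of_ne (by simpa using hk) _)
  obtain ⟨S₂, hr₂, ha₂, hb₂, hc₂⟩ := compProg_move M₁ M₂ oE iE M₁.initialState M₂.initialState
    none S₁ L ha₁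
  have hc₁' : ∀ k, S₁ (.inr k) = [] := fun k => by
    rw [hc₁ _ (by simp), single_of_ne (by simp)]
  obtain ⟨S₃, hr₃, ha₃, hb₃, hc₃⟩ := Reach.call (Γ' := sumFam M₁.Γ M₂.Γ) (ι := Sum.inr)
    (E := secondState _ _ _) (j := fun l => .inr (.inl l)) (ret := none)
    (m' := compProg M₁ M₂ oE iE) Sum.inr_injective (fun _ => rfl) h₂
    (M₁.initialState, none) (S := S₂) (by rw [hb₂, hc₁', List.append_nil])
    (fun k hk => by rw [hc₂ _ (by simp) (by simpa using hk), hc₁'])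
  obtain rfl : S₃ = single (.inr M₂.k₁) u := by
    refine eq_single ha₃ fun k hk => ?_
    rcases k with k | k
    · rw [hc₃ _ (by simp)]
      by_cases h : k = M₁.k₁
      · subst h; exact ha₂
      · rw [hc₂ _ (by simpa using h) (by simp), hb₁ _ h]
    · exact hb₃ _ (by simpa using hk)
  exact hr₁.trans (hr₂.trans hr₃)

end Comp

/-- The intermediate string arrives reversed at the second machine. Its length is polynomial in that
of the input, so the time of the second machine is bounded by `q₂.comp q`. -/
theorem PT.comp_reverse [Fintype β] [Inhabited β] {e : I → List α} {f : I → List β}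
    {g : I → List γ} (h₁ : PT e f) (h₂ : PT (fun i => (f i).reverse) g) : PT e g := by
  obtain ⟨q, hq⟩ := h₁.exists_length_le
  obtain ⟨M₁, iE₁, oE₁, q₁, h₁⟩ := pt_iff.1 h₁
  obtain ⟨M₂, iE₂, oE₂, q₂, h₂⟩ := pt_iff.1 h₂
  refine PT.intro (.inl M₁.k₀) (.inr M₂.k₁) (.inl M₁.main)
    (M₁.initialState, M₂.initialState, none) (compProg M₁ M₂ oE₁ iE₂) iE₁ oE₂ (q₁ + (q + 1 + q₂.comp q)) fun i => ?_
  obtain ⟨t₁, ht₁, hr₁⟩ := h₁ i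
  obtain ⟨t₂, ht₂, hr₂⟩ := h₂ i
  refine ⟨_, ?_, compProg_reach hr₁ hr₂⟩
  have h₃ := eval_mono q₂ (hq i)
  rw [List.length_reverse] at ht₂
  simp only [Polynomial.eval_add, Polynomial.eval_one, Polynomial.eval_comp]
  have := hq i
  omega

/-- An identity machine placed in between causes a second reversal, which undoes the first. -/
theorem PT.trans [Fintype β] [Inhabited β] {e : I → List α} {f : I → List β}
    {g : I → List γ} (h₁ : PT e f) (h₂ : PT f g) : PT e g :=
  h₁.comp_reverse ((PT.refl _).comp_reverse (h₂.congr (fun _ => by simp) fun _ => rfl))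

end PT

/-! ### Finite-state transducers and merging -/

section Transducer

variable {I α β Q : Type}

/-- The output of a finite-state transducer with transition function `δ`, output function `out` and
final output `fin`, started in a given state. -/
def transduce (δ : Q → α → Q) (out : Q → α → List β) (fin : Q → List β) : Q → List α → List β
  | q, [] => fin q
  | q, a :: w => out q a ++ transduce δ out fin (δ q a) w

/-- Push the list `f v` to stack `k`, provided that its length is at most `n`. -/
def pushAll {K Λ σ β : Type} {Γ : K → Type} [Inhabited β] (k : K) (E : β → Γ k) :
    ℕ → (σ → List β) → TM2.Stmt Γ Λ σ → TM2.Stmt Γ Λ σ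
  | 0, _, q => q
  | n + 1, f, q => .branch (fun v => (f v).isEmpty) q
      (.push k (fun v => E ((f v).headD default)) (pushAll k E n (fun v => (f v).tail) q))

theorem stepAux_pushAll {K Λ σ β : Type} [DecidableEq K] {Γ : K → Type} [Inhabited β] (k : K)
    (E : β → Γ k) (n : ℕ) (f : σ → List β) (q : TM2.Stmt Γ Λ σ) (v : σ) (S : ∀ k, List (Γ k))
    (h : (f v).length ≤ n) :
    TM2.stepAux (pushAll k E n f q) v S =
      TM2.stepAux q v (Function.update S k (((f v).map E).reverse ++ S k)) := by
  induction n generalizing f S with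
  | zero => simp [pushAll, List.length_eq_zero_iff.1 (Nat.le_zero.1 h)]
  | succ n ih =>
    rcases hf : f v with _ | ⟨b, l⟩
    · simp [pushAll, hf]
    · have hl : l.length ≤ n := by simpa [hf] using h
      simp only [pushAll, TM2.stepAux, hf, List.isEmpty_cons, cond_false, List.headD_cons]
      rw [ih _ _ (by simpa [hf] using hl)]
      simp [hf]

variable [Inhabited β] (δ : Q → α → Q) (out : Q → α → List β) (fin : Q → List β) (q₀ : Q)

/-- The program of a transducer: read the input, and push the output to the output stack. -/
def transduceProg (n : ℕ) (_ : Unit) :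
    TM2.Stmt (sumFam (fun _ : Unit => α) (fun _ : Unit => β)) Unit (Q × Option α) :=
  .pop (.inl ()) (fun v o => (v.1, o)) <|
    .branch (fun v => v.2.isSome)
      (pushAll (.inr ()) (fun b => b) n (fun v => v.2.elim [] (out v.1))
        (.load (fun v => (v.2.elim v.1 (δ v.1), none)) (.goto fun _ => ())))
      (pushAll (.inr ()) (fun b => b) n (fun v => fin v.1) (.load (fun _ => (q₀, none)) .halt))

theorem transduceProg_reach (n : ℕ) (h₁ : ∀ q a, (out q a).length ≤ n)
    (h₂ : ∀ q, (fin q).length ≤ n) (q : Q) (w : List α)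
    (S : ∀ k, List (sumFam (fun _ : Unit => α) (fun _ : Unit => β) k)) (hS : S (.inl ()) = w) :
    ∃ S' : ∀ k, List (sumFam (fun _ : Unit => α) (fun _ : Unit => β) k),
      Reach (transduceProg δ out fin q₀ n) ⟨some (), (q, none), S⟩ (w.length + 1)
        ⟨none, (q₀, none), S'⟩ ∧ S' (.inl ()) = [] ∧
        S' (.inr ()) = (transduce δ out fin q w).reverse ++ S (.inr ()) := by
  induction w generalizing q S with
  | nil =>
    refine ⟨Function.update (Function.update S (.inl ()) []) (.inr ())
        ((fin q).reverse ++ S (.inr ())), .step ?_, ?_, ?_⟩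
    · simp only [transduceProg, TM2.stepAux, hS, List.head?_nil, Option.isSome_none, cond_false]
      rw [stepAux_pushAll _ _ _ _ _ _ _ (by simpa using h₂ _)]
      simp only [TM2.stepAux, List.tail_nil, List.map_id']
      simpa using Reach.refl _
    · simp
    · simp [transduce]
  | cons a w ih =>
    obtain ⟨S', hr, ha, hb⟩ := ih (δ q a) (Function.update (Function.update S (.inl ()) w) (.inr ())
        ((out q a).reverse ++ S (.inr ()))) (by simp)
    refine ⟨S', .step ?_, ha, by rw [hb]; simp [transduce]⟩
    simp only [transduceProg, TM2.stepAux, hS, List.head?_cons, Option.isSome_some, cond_true]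
    rw [stepAux_pushAll _ _ _ _ _ _ _ (by simpa using h₁ _ _)]
    simp only [TM2.stepAux, List.tail_cons, List.map_id', Option.elim_some]
    simpa using hr

theorem PT.transduce_reverse [Fintype α] [Fintype Q] (e : I → List α) :
    PT e (fun i => (transduce δ out fin q₀ (e i)).reverse) := by
  -- Finitely many states and symbols give a common bound on the output per symbol, so that
  -- `pushAll` is a statement of fixed size.
  obtain ⟨n₁, h₁⟩ := Set.finite_range (fun p : Q × α => (out p.1 p.2).length) |>.bddAbove
  obtain ⟨n₂, h₂⟩ := Set.finite_range (fun q : Q => (fin q).length) |>.bddAbove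
  refine PT.intro (.inl ()) (.inr ()) () (q₀, none) (transduceProg δ out fin q₀ (max n₁ n₂))
    (Equiv.refl α) (Equiv.refl β) (Polynomial.X + 1) fun i => ⟨(e i).length + 1, by simp, ?_⟩
  obtain ⟨S', hr, ha, hb⟩ := transduceProg_reach δ out fin q₀ (max n₁ n₂)
    (fun q a => le_max_of_le_left (h₁ ⟨(q, a), rfl⟩)) (fun q => le_max_of_le_right (h₂ ⟨q, rfl⟩))
    q₀ (e i) (single (.inl ()) (e i)) (by simp)
  obtain rfl : S' = single (.inr ()) (transduce δ out fin q₀ (e i)).reverse := by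
    refine eq_single (by rw [hb, single_of_ne (by simp)]; simp) ?_
    rintro (_ | _) hk
    · exact ha
    · exact absurd rfl hk
  simpa using hr

variable {δ out fin q₀}

theorem transduce_copy (w : List α) :
    transduce (fun _ _ => ()) (fun _ a => [a]) (fun _ => []) () w = w := by
  induction w with
  | nil => rfl
  | cons a w ih => rw [transduce, ih]; rfl

theorem PT.reverse [Fintype α] [Inhabited α] (e : I → List α) : PT e fun i => (e i).reverse :=
  (PT.transduce_reverse (fun _ _ => ()) (fun _ a => [a]) (fun _ => []) () e).congr
    (fun _ => rfl) fun _ => by rw [transduce_copy]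

theorem PT.transduce {γ : Type} [Fintype α] [Inhabited α] [Fintype β] [Fintype Q]
    {e : I → List γ} {f : I → List α} (h : PT e f) (δ : Q → α → Q) (out : Q → α → List β)
    (fin : Q → List β) (q₀ : Q) : PT e fun i => ClusterComputing.transduce δ out fin q₀ (f i) :=
  (h.trans (PT.transduce_reverse δ out fin q₀ f)).trans
    ((PT.reverse _).congr (fun _ => rfl) fun _ => by rw [List.reverse_reverse])

end Transducer

/-! ### Merging the outputs of two computations on the same input -/

section Merge

variable {I α β γ : Type}

/-- Merge two lists into a list of pairs: side by side if `m` is `true`, and otherwise one after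
the other. -/
def merge (m : Bool) : List β → List γ → List (Option β × Option γ)
  | [], [] => []
  | [], c :: l => (none, some c) :: merge m [] l
  | b :: k, [] => (some b, none) :: merge m k []
  | b :: k, c :: l =>
    if m then (some b, some c) :: merge m k l else (some b, none) :: merge m k (c :: l)

theorem length_merge_le (m : Bool) (k : List β) (l : List γ) :
    (merge m k l).length ≤ k.length + l.length := by
  fun_induction merge m k l <;> simp_all <;> omega

variable [Inhabited α] (m : Bool) (M₁ M₂ : FinTM2)
  (iE₁ : M₁.Γ M₁.k₀ ≃ α) (iE₂ : M₂.Γ M₂.k₀ ≃ α) (oE₁ : M₁.Γ M₁.k₁ ≃ β) (oE₂ : M₂.Γ M₂.k₁ ≃ γ)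

/-- The stacks of a machine that merges the outputs of two others. -/
abbrev MergeFam (α β γ : Type) (M₁ M₂ : FinTM2) : M₁.K ⊕ M₂.K ⊕ Unit ⊕ Unit → Type :=
  sumFam M₁.Γ (sumFam M₂.Γ (sumFam (fun _ => α) (fun _ => Option β × Option γ)))

/-- Copy the input to the input stacks of `M₁` and of `M₂`, run both, and merge their outputs. -/
def mergeProg : M₁.Λ ⊕ M₂.Λ ⊕ Bool →
    TM2.Stmt (MergeFam α β γ M₁ M₂) (M₁.Λ ⊕ M₂.Λ ⊕ Bool)
      (M₁.σ × M₂.σ × Option α × Option β × Option γ)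
  | .inl l => embed (Γ' := MergeFam α β γ M₁ M₂) Sum.inl (Equiv.refl _) Sum.inl
      (some (.inr (.inl M₂.main))) (M₁.m l)
  | .inr (.inl l) => embed (Γ' := MergeFam α β γ M₁ M₂) (fun k => .inr (.inl k))
      (secondState _ _ _) (fun l => .inr (.inl l)) (some (.inr (.inr true))) (M₂.m l)
  | .inr (.inr false) => .pop (.inr (.inr (.inl ()))) (fun v o => (v.1, v.2.1, o, none, none)) <|
      .branch (fun v => v.2.2.1.isSome)
        (.push (.inl M₁.k₀) (fun v => iE₁.symm (v.2.2.1.getD default)) <|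
          .push (.inr (.inl M₂.k₀)) (fun v => iE₂.symm (v.2.2.1.getD default)) <|
          .goto fun _ => .inr (.inr false))
        (.goto fun _ => .inl M₁.main)
  | .inr (.inr true) =>
    let next : TM2.Stmt (MergeFam α β γ M₁ M₂) (M₁.Λ ⊕ M₂.Λ ⊕ Bool)
        (M₁.σ × M₂.σ × Option α × Option β × Option γ) :=
      .branch (fun v => v.2.2.2.1.isSome || v.2.2.2.2.isSome)
        (.push (.inr (.inr (.inr ()))) (fun v => (v.2.2.2.1, v.2.2.2.2)) <|
          .goto fun _ => .inr (.inr true))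
        .halt
    .pop (.inl M₁.k₁) (fun v o => (v.1, v.2.1, none, o.map oE₁, none)) <|
      .branch (fun v => m || v.2.2.2.1.isNone)
        (.pop (.inr (.inl M₂.k₁)) (fun v o => (v.1, v.2.1, none, v.2.2.2.1, o.map oE₂)) next)
        next

theorem mergeProg_load (v₁ : M₁.σ) (v₂ : M₂.σ) (o : Option α)
    (S : ∀ k, List (MergeFam α β γ M₁ M₂ k)) (L : List α)
    (hL : S (.inr (.inr (.inl ()))) = L) :
    ∃ S' : ∀ k, List (MergeFam α β γ M₁ M₂ k),
      Reach (mergeProg m M₁ M₂ iE₁ iE₂ oE₁ oE₂)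
        ⟨some (.inr (.inr false)), (v₁, v₂, o, none, none), S⟩ (L.length + 1)
        ⟨some (.inl M₁.main), (v₁, v₂, none, none, none), S'⟩ ∧
      S' (.inr (.inr (.inl ()))) = [] ∧
      S' (.inl M₁.k₀) = L.reverse.map iE₁.symm ++ S (.inl M₁.k₀) ∧
      S' (.inr (.inl M₂.k₀)) = L.reverse.map iE₂.symm ++ S (.inr (.inl M₂.k₀)) ∧
      ∀ k, k ≠ .inr (.inr (.inl ())) → k ≠ .inl M₁.k₀ → k ≠ .inr (.inl M₂.k₀) → S' k = S k := by
  induction L generalizing S o with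
  | nil =>
    refine ⟨Function.update S (.inr (.inr (.inl ()))) [], .step ?_, by simp, by simp, by simp,
      fun k hk _ _ => by simp [hk]⟩
    simp only [mergeProg, TM2.stepAux, hL, List.head?_nil, Option.isSome_none, cond_false,
      List.tail_nil]
    exact .refl _
  | cons a L ih =>
    obtain ⟨S', h₁, h₂, h₃, h₄, h₅⟩ := ih (some a)
      (Function.update (Function.update (Function.update S (.inr (.inr (.inl ()))) L) (.inl M₁.k₀)
        (iE₁.symm a :: S (.inl M₁.k₀))) (.inr (.inl M₂.k₀))
        (iE₂.symm a :: S (.inr (.inl M₂.k₀)))) (by simp)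
    refine ⟨S', .step ?_, h₂, by rw [h₃]; simp, by rw [h₄]; simp, fun k hk hk' hk'' => ?_⟩
    · simp only [mergeProg, TM2.stepAux, hL, List.head?_cons, Option.isSome_some, cond_true,
        List.tail_cons, Option.getD_some]
      simpa using h₁
    · rw [h₅ k hk hk' hk'']; simp [hk, hk', hk'']

/-- The induction follows the recursion of `merge`, one loop of the machine per column. A loop in
which both buffers remain empty is the signal to halt, which accounts for the extra step. -/
theorem mergeProg_combine (v₁ : M₁.σ) (v₂ : M₂.σ) (o : Option β) (o' : Option γ)
    (S : ∀ k, List (MergeFam α β γ M₁ M₂ k)) (L : List β) (L' : List γ)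
    (hL : S (.inl M₁.k₁) = L.map oE₁.symm) (hL' : S (.inr (.inl M₂.k₁)) = L'.map oE₂.symm) :
    ∃ S' : ∀ k, List (MergeFam α β γ M₁ M₂ k),
      Reach (mergeProg m M₁ M₂ iE₁ iE₂ oE₁ oE₂)
        ⟨some (.inr (.inr true)), (v₁, v₂, none, o, o'), S⟩ ((merge m L L').length + 1)
        ⟨none, (v₁, v₂, none, none, none), S'⟩ ∧
      S' (.inl M₁.k₁) = [] ∧ S' (.inr (.inl M₂.k₁)) = [] ∧
      S' (.inr (.inr (.inr ()))) = (merge m L L').reverse ++ S (.inr (.inr (.inr ()))) ∧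
      ∀ k, k ≠ .inr (.inr (.inr ())) → k ≠ .inl M₁.k₁ → k ≠ .inr (.inl M₂.k₁) → S' k = S k := by
  fun_induction merge m L L' generalizing S o o' with
  | case1 =>
    refine ⟨Function.update (Function.update S (.inl M₁.k₁) []) (.inr (.inl M₂.k₁)) [], .step ?_,
      by simp, by simp, by simp, fun k _ hk hk' => by simp [hk, hk']⟩
    simp only [mergeProg, TM2.stepAux, hL, List.map_nil, List.head?_nil, Option.map_none,
      Option.isNone_none, Bool.or_true, cond_true, Option.isSome_none, Bool.or_self, cond_false,
      List.tail_nil]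
    simpa [hL'] using Reach.refl _
  | case2 c l ih =>
    obtain ⟨S', h₁, h₂, h₃, h₄, h₅⟩ := ih none (some c)
      (Function.update (Function.update (Function.update S (.inl M₁.k₁) []) (.inr (.inl M₂.k₁))
        (l.map oE₂.symm)) (.inr (.inr (.inr ()))) ((none, some c) :: S (.inr (.inr (.inr ())))))
        (by simp) (by simp)
    refine ⟨S', .step ?_, h₂, h₃, by rw [h₄]; simp, fun k hk hk' hk'' => ?_⟩
    · simp only [mergeProg, TM2.stepAux, hL, List.map_nil, List.head?_nil, Option.map_none,
        Option.isNone_none, Bool.or_true, cond_true, List.tail_nil]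
      simpa [hL'] using h₁
    · rw [h₅ k hk hk' hk'']; simp [hk, hk', hk'']
  | case3 b k ih =>
    obtain ⟨S', h₁, h₂, h₃, h₄, h₅⟩ := ih (some b) none
      (Function.update (Function.update S (.inl M₁.k₁) (k.map oE₁.symm))
        (.inr (.inr (.inr ()))) ((some b, none) :: S (.inr (.inr (.inr ())))))
        (by simp) (by simpa using hL')
    refine ⟨S', .step ?_, h₂, h₃, by rw [h₄]; simp, fun k hk hk' hk'' => ?_⟩
    · simp only [mergeProg, TM2.stepAux, hL, List.map_cons, List.head?_cons, Option.map_some,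
        Option.isNone_some, Bool.or_false, List.tail_cons, Equiv.apply_symm_apply]
      cases m
      · simpa using h₁
      -- In side-by-side mode the second stack is popped even when it is empty, which leaves it
      -- unchanged.
      · have hu : Function.update (Function.update S (.inl M₁.k₁) (k.map oE₁.symm))
            (.inr (.inl M₂.k₁)) [] = Function.update S (.inl M₁.k₁) (k.map oE₁.symm) := by
          rw [Function.update_eq_self_iff]; simp [hL']
        simpa [hL', hu] using h₁
    · rw [h₅ k hk hk' hk'']; simp [hk, hk']
  | case4 b k c l hm ih =>
    obtain ⟨S', h₁, h₂, h₃, h₄, h₅⟩ := ih (some b) (some c)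
      (Function.update (Function.update (Function.update S (.inl M₁.k₁) (k.map oE₁.symm))
        (.inr (.inl M₂.k₁)) (l.map oE₂.symm)) (.inr (.inr (.inr ())))
          ((some b, some c) :: S (.inr (.inr (.inr ()))))) (by simp) (by simp)
    refine ⟨S', .step ?_, h₂, h₃, by rw [h₄]; simp, fun k hk hk' hk'' => ?_⟩
    · simp only [mergeProg, TM2.stepAux, hL, List.map_cons, List.head?_cons, Option.map_some,
        hm, Bool.true_or, cond_true, List.tail_cons, Equiv.apply_symm_apply]
      simpa [hL', hm] using h₁
    · rw [h₅ k hk hk' hk'']; simp [hk, hk', hk'']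
  | case5 b k c l hm ih =>
    obtain ⟨S', h₁, h₂, h₃, h₄, h₅⟩ := ih (some b) none
      (Function.update (Function.update S (.inl M₁.k₁) (k.map oE₁.symm))
        (.inr (.inr (.inr ()))) ((some b, none) :: S (.inr (.inr (.inr ())))))
        (by simp) (by simpa using hL')
    refine ⟨S', .step ?_, h₂, h₃, by rw [h₄]; simp, fun k hk hk' hk'' => ?_⟩
    · simp only [mergeProg, TM2.stepAux, hL, List.map_cons, List.head?_cons, Option.map_some,
        Option.isNone_some, Bool.or_false, List.tail_cons, Equiv.apply_symm_apply]
      simpa [hm] using h₁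
    · rw [h₅ k hk hk' hk'']; simp [hk, hk']

variable {m M₁ M₂ iE₁ iE₂ oE₁ oE₂}

theorem mergeProg_reach {w : List α} {L : List β} {L' : List γ} {t₁ t₂ : ℕ}
    (h₁ : Reach M₁.m ⟨some M₁.main, M₁.initialState, single M₁.k₀ (w.reverse.map iE₁.symm)⟩ t₁
      ⟨none, M₁.initialState, single M₁.k₁ (L.map oE₁.symm)⟩)
    (h₂ : Reach M₂.m ⟨some M₂.main, M₂.initialState, single M₂.k₀ (w.reverse.map iE₂.symm)⟩ t₂
      ⟨none, M₂.initialState, single M₂.k₁ (L'.map oE₂.symm)⟩) :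
    Reach (mergeProg m M₁ M₂ iE₁ iE₂ oE₁ oE₂)
      ⟨some (.inr (.inr false)), (M₁.initialState, M₂.initialState, none, none, none),
        single (.inr (.inr (.inl ()))) w⟩
      (w.length + 1 + (t₁ + (t₂ + ((merge m L L').length + 1))))
      ⟨none, (M₁.initialState, M₂.initialState, none, none, none),
        single (.inr (.inr (.inr ()))) (merge m L L').reverse⟩ := by
  obtain ⟨S₁, hr₁, ha₁, hb₁, hc₁, hd₁⟩ := mergeProg_load m M₁ M₂ iE₁ iE₂ oE₁ oE₂
    M₁.initialState M₂.initialState none (single (.inr (.inr (.inl ()))) w) w (by simp)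
  obtain ⟨S₂, hr₂, ha₂, hb₂, hc₂⟩ := Reach.call (Γ' := MergeFam α β γ M₁ M₂) (ι := Sum.inl)
    (E := Equiv.refl _) (j := Sum.inl) (ret := some (.inr (.inl M₂.main)))
    (m' := mergeProg m M₁ M₂ iE₁ iE₂ oE₁ oE₂) Sum.inl_injective (fun _ => rfl) h₁
    (M₂.initialState, none, none, none) (S := S₁)
    (by rw [hb₁, single_of_ne (by simp), List.append_nil])
    (fun k hk => by rw [hd₁ _ (by simp) (by simpa using hk) (by simp), single_of_ne (by simp)])
  obtain ⟨S₃, hr₃, ha₃, hb₃, hc₃⟩ := Reach.call (Γ' := MergeFam α β γ M₁ M₂)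
    (ι := fun k => .inr (.inl k)) (E := secondState _ _ _) (j := fun l => .inr (.inl l))
    (ret := some (.inr (.inr true))) (m' := mergeProg m M₁ M₂ iE₁ iE₂ oE₁ oE₂)
    (fun a b h => by simpa using h) (fun _ => rfl) h₂ (M₁.initialState, none, none, none) (S := S₂)
    (by rw [hc₂ _ (by simp), hc₁, single_of_ne (by simp), List.append_nil])
    (fun k hk => by
      rw [hc₂ _ (by simp), hd₁ _ (by simp) (by simp) (by simpa using hk), single_of_ne (by simp)])
  obtain ⟨S₄, hr₄, ha₄, hb₄, hc₄, hd₄⟩ := mergeProg_combine m M₁ M₂ iE₁ iE₂ oE₁ oE₂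
    M₁.initialState M₂.initialState none none S₃ L L' (by rw [hc₃ _ (by simp), ha₂]) ha₃
  have hout : S₃ (.inr (.inr (.inr ()))) = [] := by
    rw [hc₃ _ (by simp), hc₂ _ (by simp), hd₁ _ (by simp) (by simp) (by simp),
      single_of_ne (by simp)]
  obtain rfl : S₄ = single (.inr (.inr (.inr ()))) (merge m L L').reverse := by
    refine eq_single (by rw [hc₄, hout, List.append_nil]) ?_
    rintro (k | k | _ | _) hk
    · by_cases h : k = M₁.k₁
      · subst h; exact ha₄
      · rw [hd₄ _ (by simp) (by simpa using h) (by simp), hc₃ _ (by simp), hb₂ _ h]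
    · by_cases h : k = M₂.k₁
      · subst h; exact hb₄
      · rw [hd₄ _ (by simp) (by simp) (by simpa using h), hb₃ _ h]
    · rw [hd₄ _ (by simp) (by simp) (by simp), hc₃ _ (by simp), hc₂ _ (by simp), ha₁]
    · exact absurd rfl hk
  exact hr₁.trans (hr₂.trans (hr₃.trans hr₄))

/-- The source of all operations with several arguments: a transducer run on the merged string can
append, compare or select. Distributing the input reverses it and collecting the columns reverses
the result, so the machine is enclosed between two reversals. -/
theorem PT.merge [Fintype α] [Fintype β] [Fintype γ] {e : I → List α} {f : I → List β}
    {g : I → List γ} (h₁ : PT e f) (h₂ : PT e g) (m : Bool) :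
    PT e fun i => ClusterComputing.merge m (f i) (g i) := by
  have key : PT (fun i => (e i).reverse) fun i => (ClusterComputing.merge m (f i) (g i)).reverse := by
    obtain ⟨p₁, hp₁⟩ := h₁.exists_length_le
    obtain ⟨p₂, hp₂⟩ := h₂.exists_length_le
    obtain ⟨M₁, iE₁, oE₁, q₁, h₁⟩ := pt_iff.1 h₁
    obtain ⟨M₂, iE₂, oE₂, q₂, h₂⟩ := pt_iff.1 h₂
    refine PT.intro (.inr (.inr (.inl ()))) (.inr (.inr (.inr ()))) (.inr (.inr false))
      (M₁.initialState, M₂.initialState, none, none, none) (mergeProg m M₁ M₂ iE₁ iE₂ oE₁ oE₂)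
      (Equiv.refl _) (Equiv.refl _) (Polynomial.X + 1 + (q₁ + (q₂ + (p₁ + p₂ + 1)))) fun i => ?_
    obtain ⟨t₁, ht₁, hr₁⟩ := h₁ i
    obtain ⟨t₂, ht₂, hr₂⟩ := h₂ i
    have := mergeProg_reach (m := m) (w := (e i).reverse) (iE₁ := iE₁) (iE₂ := iE₂)
      (by rw [List.reverse_reverse]; exact hr₁) (by rw [List.reverse_reverse]; exact hr₂)
    refine ⟨_, ?_, by simpa using this⟩
    have h₃ := length_merge_le m (f i) (g i)
    have h₄ := hp₁ i
    have h₅ := hp₂ i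
    simp only [Polynomial.eval_add, Polynomial.eval_one, Polynomial.eval_X, List.length_reverse]
    omega
  exact (((PT.reverse e).trans key).trans (PT.reverse _)).congr (fun _ => rfl) fun _ => by simp

end Merge

/-! ### Closure properties of polynomial-time transformations -/

open Classical in
/-- The predicate `P i` can be decided in polynomial time from the string `e i`. -/
def PD {I α : Type} (e : I → List α) (P : I → Prop) : Prop := PT e fun i => [decide (P i)]

section Closure

variable {I α β γ : Type} [Fintype α] [Inhabited α] [Fintype β] [Inhabited β] [Fintype γ]
  [Inhabited γ] {e : I → List α}

theorem PT.const (e : I → List α) (l : List γ) : PT e fun _ => l :=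
  ((PT.refl e).transduce (fun _ _ => ()) (fun _ _ => []) (fun _ => l) ()).congr (fun _ => rfl)
    fun i => by
      induction e i with
      | nil => rfl
      | cons a w ih => exact ih

theorem PT.flatMap {f : I → List β} (h : PT e f) (g : β → List γ) :
    PT e fun i => (f i).flatMap g :=
  (h.transduce (fun _ _ => ()) (fun _ b => g b) (fun _ => []) ()).congr (fun _ => rfl) fun i => by
    induction f i with
    | nil => rfl
    | cons a w ih => rw [ClusterComputing.transduce, ih, List.flatMap_cons]

theorem PT.map {f : I → List β} (h : PT e f) (g : β → γ) : PT e fun i => (f i).map g :=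
  (h.flatMap fun b => [g b]).congr (fun _ => rfl) fun i => by
    rw [List.map_eq_flatMap]

theorem merge_false (k : List β) (l : List γ) :
    merge false k l = k.map (fun b => (some b, none)) ++ l.map (fun c => (none, some c)) := by
  fun_induction merge false k l <;> simp_all

theorem PT.append {f g : I → List β} (hf : PT e f) (hg : PT e g) :
    PT e fun i => f i ++ g i :=
  ((hf.merge hg false).flatMap fun p => p.1.toList ++ p.2.toList).congr (fun _ => rfl) fun i => by
    simp [merge_false, List.flatMap_map]

/-- The condition bit is read first and kept in the state. Every later letter is tagged by its list
of origin and is kept or dropped accordingly. -/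
theorem transduce_select (c : Bool) (k l : List β) :
    transduce (fun (q : Bool) (p : Option Bool × Option (Option β × Option β)) => p.1.getD q)
      (fun q p => p.2.elim [] fun r => if q then r.1.toList else r.2.toList) (fun _ => []) false
      (merge false [c] (merge false k l)) = if c then k else l := by
  have h₂ : ∀ l : List β, transduce
      (fun (q : Bool) (p : Option Bool × Option (Option β × Option β)) => p.1.getD q)
      (fun q p => p.2.elim [] fun r => if q then r.1.toList else r.2.toList) (fun _ => []) c
      (l.map fun b => (none, some (none, some b))) = if c then [] else l := by
    intro l
    induction l with
    | nil => cases c <;> rfl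
    | cons a l ih => cases c <;> simp_all [transduce]
  have h₁ : ∀ k l : List β, transduce
      (fun (q : Bool) (p : Option Bool × Option (Option β × Option β)) => p.1.getD q)
      (fun q p => p.2.elim [] fun r => if q then r.1.toList else r.2.toList) (fun _ => []) c
      (k.map (fun b => (none, some (some b, none))) ++
        l.map fun b => (none, some (none, some b))) = if c then k else l := by
    intro k l
    induction k with
    | nil => rw [List.map_nil, List.nil_append, h₂]
    | cons a k ih => cases c <;> simp_all [transduce]
  have := h₁ k l
  simpa [merge_false, transduce, Function.comp_def] using this

open Classical in
theorem PT.ite {c : I → Prop} {f g : I → List β} (hc : PD e c) (hf : PT e f) (hg : PT e g) :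
    PT e fun i => if c i then f i else g i :=
  ((PT.merge hc (hf.merge hg false) false).transduce _ _ _ _).congr (fun _ => rfl) fun i =>
    (transduce_select (decide (c i)) (f i) (g i)).trans (by simp)

theorem PD.congr {P Q : I → Prop} (h : PD e P) (hPQ : ∀ i, P i ↔ Q i) : PD e Q := by
  obtain rfl : P = Q := funext fun i => propext (hPQ i)
  exact h

theorem PD.const (e : I → List α) (p : Prop) : PD e fun _ => p := by
  classical exact PT.const e [decide p]

theorem PD.and {P Q : I → Prop} (hP : PD e P) (hQ : PD e Q) : PD e fun i => P i ∧ Q i :=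
  (PT.ite hP hQ (PD.const e False)).congr (fun _ => rfl) fun i => by
    by_cases h : P i <;> simp [h]

theorem PD.not {P : I → Prop} (hP : PD e P) : PD e fun i => ¬ P i :=
  (PT.ite hP (PD.const e False) (PD.const e True)).congr (fun _ => rfl) fun i => by
    by_cases h : P i <;> simp [h]

theorem PD.or {P Q : I → Prop} (hP : PD e P) (hQ : PD e Q) : PD e fun i => P i ∨ Q i :=
  (hP.not.and hQ.not).not.congr fun i => by tauto

theorem PD.imp {P Q : I → Prop} (hP : PD e P) (hQ : PD e Q) : PD e fun i => P i → Q i :=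
  (hP.and hQ.not).not.congr fun i => by tauto

open Classical in
theorem PT.all {f : I → List β} (h : PT e f) (φ : β → Prop) : PD e fun i => ∀ b ∈ f i, φ b :=
  (h.transduce (fun q b => q && decide (φ b)) (fun _ _ => []) (fun q => [q]) true).congr
    (fun _ => rfl) fun i => by
    have : ∀ (q : Bool) (l : List β), ClusterComputing.transduce
        (fun q b => q && decide (φ b)) (fun _ _ => ([] : List Bool)) (fun q => [q]) q l =
        [q && decide (∀ b ∈ l, φ b)] := by
      intro q l
      induction l generalizing q with
      | nil => simp [ClusterComputing.transduce]
      | cons a l ih => simp [ClusterComputing.transduce, ih, Bool.and_assoc]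
    simp [this]

theorem merge_true_all_eq (k l : List β) : (∀ p ∈ merge true k l, p.1 = p.2) ↔ k = l := by
  fun_induction merge true k l <;> simp_all

theorem PT.eq {f g : I → List β} (hf : PT e f) (hg : PT e g) : PD e fun i => f i = g i :=
  ((hf.merge hg true).all fun p => p.1 = p.2).congr fun _ => merge_true_all_eq _ _

/-- Being an extension by copies of `c` is a condition on single columns: equal entries, or `c`
facing a blank. -/
theorem merge_true_all_padded (c : β) (k l : List β) :
    (∀ p ∈ merge true k l, p.1 = p.2 ∨ p = (some c, none)) ↔
      ∃ j, k = l ++ List.replicate j c := by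
  fun_induction merge true k l with
  | case1 => simp
  | case2 => simp
  | case3 b k ih =>
    simp only [List.mem_cons, forall_eq_or_imp, ih, List.nil_append, reduceCtorEq, Prod.mk.injEq,
      Option.some.injEq, and_true, false_or]
    constructor
    · rintro ⟨rfl, j, rfl⟩
      exact ⟨j + 1, rfl⟩
    · rintro ⟨_ | j, h⟩
      · simp at h
      · rw [List.replicate_succ, List.cons.injEq] at h
        exact ⟨h.1, j, h.2⟩
  | case4 b k c l _ ih => simp_all
  | case5 => simp_all

theorem PT.padded {f g : I → List β} (hf : PT e f) (hg : PT e g) (c : β) :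
    PD e fun i => ∃ j, f i = g i ++ List.replicate j c :=
  ((hf.merge hg true).all fun p => p.1 = p.2 ∨ p = (some c, none)).congr fun _ =>
    merge_true_all_padded _ _ _

end Closure

/-! #### Arguments and subroutines -/

section Arguments

variable {I α : Type} [Fintype α] [Inhabited α] {e : I → List α}

theorem transduce_take (s : List Bool) (w : List (Option Bool)) :
    transduce (fun q a => q || a.isNone) (fun q a => if q then [] else a.toList) (fun _ => []) false
      (encodeArg s ++ w) = s := by
  have h : ∀ w : List (Option Bool), transduce (fun q a => q || a.isNone)
      (fun q a => if q then [] else a.toList) (fun _ => ([] : List Bool)) true w = [] := by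
    intro w
    induction w with
    | nil => rfl
    | cons a w ih => simpa [transduce] using ih
  induction s with
  | nil => simp [encodeArg, transduce, h]
  | cons a s ih => simpa [encodeArg, transduce] using ih

theorem transduce_drop (s : List Bool) (w : List (Option Bool)) :
    transduce (fun q a => q || a.isNone) (fun q a => if q then [a] else []) (fun _ => []) false
      (encodeArg s ++ w) = w := by
  have h : ∀ w : List (Option Bool), transduce (fun q a => q || a.isNone)
      (fun q a => if q then [a] else []) (fun _ => ([] : List (Option Bool))) true w = w := by
    intro w
    induction w with
    | nil => rfl
    | cons a w ih => simpa [transduce] using ih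
  induction s with
  | nil => simp [encodeArg, transduce, h]
  | cons a s ih => simpa [encodeArg, transduce] using ih

theorem PT.take {f : I → List (Option Bool)} {s : I → List Bool} {w : I → List (Option Bool)}
    (h : PT e f) (hf : ∀ i, f i = encodeArg (s i) ++ w i) : PT e s :=
  (h.transduce _ _ _ _).congr (fun _ => rfl) fun i => by rw [hf i, transduce_take]

theorem PT.drop {f : I → List (Option Bool)} {s : I → List Bool} {w : I → List (Option Bool)}
    (h : PT e f) (hf : ∀ i, f i = encodeArg (s i) ++ w i) : PT e w :=
  (h.transduce _ _ _ _).congr (fun _ => rfl) fun i => by rw [hf i, transduce_drop]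

theorem pt_pair_fst : PT encodePair fun a => a.1 :=
  (PT.refl encodePair).take fun _ => rfl

theorem pt_pair_snd : PT encodePair fun a => a.2 :=
  ((PT.refl encodePair).drop fun _ => rfl).take fun _ => (List.append_nil _).symm

theorem pt_triple_snd : PT encodeTriple fun a => a.2.1 :=
  ((PT.refl encodeTriple).drop fun _ => rfl).take fun _ => rfl

theorem pt_triple_thd : PT encodeTriple fun a => a.2.2 :=
  (((PT.refl encodeTriple).drop fun _ => rfl).drop fun _ => rfl).take
    fun _ => (List.append_nil _).symm

theorem PT.encodeArg {f : I → List Bool} (h : PT e f) :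
    PT e fun i => ClusterComputing.encodeArg (f i) :=
  (h.map some).append (PT.const e [none])

theorem PolyTimePred.pd {J : Type} {enc : J → List (Option Bool)} {R : J → Prop}
    (h : PolyTimePred enc R) : PD enc R := by
  obtain ⟨g, hg, ⟨⟨aux, q, h⟩⟩⟩ := h
  have : PT enc fun a => [g a] := ⟨⟨aux, q, h⟩⟩
  refine this.congr (fun _ => rfl) fun a => ?_
  rw [List.singleton_inj, Bool.eq_iff_iff, hg]
  exact (@decide_eq_true_iff _ (Classical.propDecidable _)).symm

open Classical in
theorem PD.polyTimePred {J : Type} {enc : J → List (Option Bool)} {R : J → Prop}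
    (h : PD enc R) : PolyTimePred enc R := by
  obtain ⟨⟨aux, q, h⟩⟩ := h
  exact ⟨fun a => decide (R a), fun a => decide_eq_true_iff, ⟨⟨aux, q, h⟩⟩⟩

/-- A decision procedure used as a subroutine: the arguments are computed and encoded, and the
procedure is reindexed along the resulting pairs. -/
theorem PolyTimePred₂.pd {R : List Bool → List Bool → Prop} (h : PolyTimePred₂ R)
    {f g : I → List Bool} (hf : PT e f) (hg : PT e g) : PD e fun i => R (f i) (g i) :=
  (hf.encodeArg.append hg.encodeArg).trans ((PolyTimePred.pd h).reindex fun i => (f i, g i))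

theorem PolyTimePred₃.pd {R : List Bool → List Bool → List Bool → Prop} (h : PolyTimePred₃ R)
    {f g k : I → List Bool} (hf : PT e f) (hg : PT e g) (hk : PT e k) :
    PD e fun i => R (f i) (g i) (k i) :=
  (hf.encodeArg.append (hg.encodeArg.append hk.encodeArg)).trans
    ((PolyTimePred.pd h).reindex fun i => (f i, g i, k i))

theorem FPt.pt {b : List Bool → List Bool} (h : FPt b) {f : I → List Bool} (hf : PT e f) :
    PT e fun i => b (f i) := by
  obtain ⟨⟨aux, q, h⟩⟩ := h
  have : PT (fun s : List Bool => s) b := ⟨⟨aux, q, h⟩⟩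
  exact hf.trans (this.reindex f)

theorem fpt_of_pt {b : List Bool → List Bool} (h : PT (fun s : List Bool => s) b) : FPt b := by
  obtain ⟨⟨aux, q, h⟩⟩ := h
  exact ⟨⟨aux, q, h⟩⟩

end Arguments

/-! ### The rank of a string -/

/-- The position of a string in the lexicographical order, for the reversed string. -/
def revRank : List Bool → ℕ
  | [] => 0
  | b :: l => 2 * revRank l + (if b then 2 else 1)

/-- The position of a string in the lexicographical order. -/
def rank (a : List Bool) : ℕ := revRank a.reverse

/-- The successor of a string in the lexicographical order. -/
def lexNext (a : List Bool) : List Bool :=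
  (transduce (fun q b => q && b) (fun q b => [xor q b]) (fun q => if q then [false] else []) true
    a.reverse).reverse

theorem PT.lexNext {I α : Type} [Fintype α] [Inhabited α] {e : I → List α} {f : I → List Bool}
    (h : PT e f) : PT e fun i => ClusterComputing.lexNext (f i) :=
  ((h.trans (PT.reverse f)).transduce _ _ _ _).trans (PT.reverse _)

/-- `rank` is bijective base two with digits 1 and 2, read from the right. Adding one sends the
digit 2 to 1 with a carry and 1 to 2 without; the state of the transducer is the carry, and a final
carry becomes a new leading digit 1, that is `false`. -/
theorem rank_lexNext (a : List Bool) : rank (lexNext a) = rank a + 1 := by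
  unfold rank lexNext
  rw [List.reverse_reverse]
  have h₀ : ∀ l : List Bool, transduce (fun q b => q && b) (fun q b => [xor q b])
      (fun q => if q then [false] else []) false l = l := by
    intro l
    induction l with
    | nil => rfl
    | cons b l ih => simpa [transduce] using ih
  induction a.reverse with
  | nil => rfl
  | cons b l ih => cases b <;> simp_all [transduce, revRank]; omega

theorem rank_append_singleton (a : List Bool) (b : Bool) :
    rank (a ++ [b]) = 2 * rank a + (if b then 2 else 1) := by
  simp [rank, revRank]

/-- The ranks of the strings of length `n` lie between `2 ^ n - 1` and `2 ^ (n + 1) - 2`. These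
ranges are disjoint, so ranks can be used to compare lengths. -/
theorem two_pow_le_rank (a : List Bool) :
    2 ^ a.length ≤ rank a + 1 ∧ rank a + 2 ≤ 2 ^ (a.length + 1) := by
  induction a using List.reverseRecOn with
  | nil => simp [rank, revRank]
  | append_singleton a b ih =>
    rw [rank_append_singleton, List.length_append, List.length_singleton]
    have h : 2 ^ (a.length + 1 + 1) = 2 * 2 ^ (a.length + 1) := by ring
    have h' : 2 ^ (a.length + 1) = 2 * 2 ^ a.length := by ring
    cases b <;> simp <;> omega

theorem length_le_of_rank_le {a b : List Bool} (h : rank a ≤ rank b) : a.length ≤ b.length := by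
  by_contra hlt
  have h₁ := (two_pow_le_rank a).1
  have h₂ := (two_pow_le_rank b).2
  have h₃ : 2 ^ (b.length + 1) ≤ 2 ^ a.length := Nat.pow_le_pow_right two_pos (by omega)
  omega

theorem rank_append_lt {a b c d : List Bool} (h : rank a < rank b) (hl : c.length = d.length) :
    rank (a ++ c) < rank (b ++ d) := by
  induction c using List.reverseRecOn generalizing d with
  | nil =>
    obtain rfl : d = [] := List.length_eq_zero_iff.1 hl.symm
    simpa using h
  | append_singleton c x ih =>
    obtain rfl | ⟨d, y, rfl⟩ := List.eq_nil_or_concat' d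
    · simp at hl
    · have := ih (d := d) (by simpa using hl)
      rw [← List.append_assoc, ← List.append_assoc, rank_append_singleton, rank_append_singleton]
      cases x <;> cases y <;> simp <;> omega

/-- The lexicographic comparison proceeds from the left while `rank` is computed from the right, so
the induction carries the common prefix `c` already passed. -/
theorem rank_lt_of_lex {a b : List Bool} (h : List.Lex (· < ·) a b) (hl : a.length = b.length)
    (c : List Bool) : rank (c ++ a) < rank (c ++ b) := by
  induction h generalizing c with
  | nil => simp at hl
  | @rel x a y b hxy =>
    obtain ⟨rfl, rfl⟩ : x = false ∧ y = true := by
      revert hxy; cases x <;> cases y <;> decide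
    have := rank_append_lt (a := c ++ [false]) (b := c ++ [true])
      (by simp [rank_append_singleton]) (c := a) (d := b) (by simpa using hl)
    simpa using this
  | @cons x a b _ ih => simpa using ih (by simpa using hl) (c ++ [x])

theorem rank_lt_of_lexLT {a b : List Bool} (h : LexLT a b) : rank a < rank b := by
  rcases List.shortlex_def.1 h with h | ⟨hl, h⟩
  · by_contra hlt
    exact absurd (length_le_of_rank_le (not_lt.1 hlt)) (by omega)
  · simpa using rank_lt_of_lex h hl []

theorem lexLT_or_eq_or_lexLT (a b : List Bool) : LexLT a b ∨ a = b ∨ LexLT b a := by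
  by_contra h
  push Not at h
  exact h.2.1 (Std.Trichotomous.trichotomous (r := List.Shortlex ((· < ·) : Bool → Bool → Prop))
    a b h.1 h.2.2)

/-- Monotonicity in one direction suffices, because both orders are total. From here on
lexicographic questions are arithmetic. -/
theorem lexLT_iff {a b : List Bool} : LexLT a b ↔ rank a < rank b := by
  refine ⟨rank_lt_of_lexLT, fun h => ?_⟩
  rcases lexLT_or_eq_or_lexLT a b with h' | rfl | h'
  · exact h'
  · exact absurd h (lt_irrefl _)
  · exact absurd h (rank_lt_of_lexLT h').le.not_gt

theorem rank_injective : Function.Injective rank := fun a b h => by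
  rcases lexLT_or_eq_or_lexLT a b with h' | h' | h'
  · exact absurd h (rank_lt_of_lexLT h').ne
  · exact h'
  · exact absurd h (rank_lt_of_lexLT h').ne'

theorem rank_surjective : Function.Surjective rank := fun n => by
  induction n with
  | zero => exact ⟨[], rfl⟩
  | succ n ih => obtain ⟨a, rfl⟩ := ih; exact ⟨lexNext a, rank_lexNext a⟩

theorem lexLE_iff {a b : List Bool} : LexLE a b ↔ rank a ≤ rank b := by
  rw [LexLE, lexLT_iff, ← rank_injective.eq_iff, le_iff_lt_or_eq]

theorem lexSucc_iff {a b : List Bool} : LexSucc a b ↔ rank b = rank a + 1 := by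
  simp only [LexSucc, lexLT_iff]
  constructor
  · rintro ⟨h, h'⟩
    by_contra hne
    have := h' (lexNext a)
    rw [rank_lexNext] at this
    omega
  · intro h
    exact ⟨by omega, fun c => by omega⟩

theorem lexSucc_iff_eq {a b : List Bool} : LexSucc a b ↔ b = lexNext a := by
  rw [lexSucc_iff, ← rank_lexNext, rank_injective.eq_iff]

theorem PT.lexSucc {I α : Type} [Fintype α] [Inhabited α] {e : I → List α} {f g : I → List Bool}
    (hf : PT e f) (hg : PT e g) : PD e fun i => LexSucc (f i) (g i) :=
  (hg.eq hf.lexNext).congr fun _ => lexSucc_iff_eq.symm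

/-! ### Self-delimiting headers -/

/-- A self-delimiting code of the string `x`. -/
def header (x : List Bool) : List Bool := x.flatMap (fun b => [true, b]) ++ [false]

@[simp] theorem length_header (x : List Bool) : (header x).length = 2 * x.length + 1 := by
  simp [header, mul_comm]

/-- The states of the header parser: `none` expects a tag, `some true` expects a bit, and
`some false` has passed the header. -/
def headerStep : Option Bool → Bool → Option Bool
  | none, b => some b
  | some true, _ => none
  | some false, _ => some false

/-- The string whose header starts a given string. -/
def headerPart (s : List Bool) : List Bool :=
  transduce headerStep (fun q b => if q = some true then [b] else []) (fun _ => []) none s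

/-- The rest of a string behind its header. -/
def tailPart (s : List Bool) : List Bool :=
  transduce headerStep (fun q b => if q = some false then [b] else []) (fun _ => []) none s

@[simp] theorem headerPart_header (x y : List Bool) : headerPart (header x ++ y) = x := by
  have h : ∀ y, transduce headerStep (fun q b => if q = some true then [b] else [])
      (fun _ => ([] : List Bool)) (some false) y = [] := by
    intro y
    induction y with
    | nil => rfl
    | cons b y ih => simpa [transduce, headerStep] using ih
  induction x with
  | nil => simp [header, headerPart, transduce, headerStep, h]
  | cons b x ih => simpa [header, headerPart, transduce, headerStep] using ih

@[simp] theorem tailPart_header (x y : List Bool) : tailPart (header x ++ y) = y := by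
  have h : ∀ y, transduce headerStep (fun q b => if q = some false then [b] else [])
      (fun _ => ([] : List Bool)) (some false) y = y := by
    intro y
    induction y with
    | nil => rfl
    | cons b y ih => simpa [transduce, headerStep] using ih
  induction x with
  | nil => simp [header, tailPart, transduce, headerStep, h]
  | cons b x ih => simpa [header, tailPart, transduce, headerStep] using ih

theorem header_append_inj {x y x' y' : List Bool} (h : header x ++ y = header x' ++ y') :
    x = x' ∧ y = y' :=
  ⟨by simpa using congrArg headerPart h, by simpa using congrArg tailPart h⟩

/-! ### Polynomial-time operations on headers -/

section

variable {I α : Type} [Fintype α] [Inhabited α] {e : I → List α} {f : I → List Bool}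

theorem PT.header (h : PT e f) : PT e fun i => ClusterComputing.header (f i) :=
  (h.flatMap _).append (PT.const e _)

theorem PT.headerPart (h : PT e f) : PT e fun i => ClusterComputing.headerPart (f i) :=
  h.transduce _ _ _ _

theorem PT.tailPart (h : PT e f) : PT e fun i => ClusterComputing.tailPart (f i) :=
  h.transduce _ _ _ _

theorem PT.length_eq {g : I → List Bool} (hf : PT e f) (hg : PT e g) :
    PD e fun i => (f i).length = (g i).length :=
  ((hf.map fun _ => false).eq (hg.map fun _ => false)).congr fun i => by
    simp [List.map_const']

end

/-! ### Ranks of strings with a common prefix -/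

/-- For a fixed prefix and a fixed tail length, the rank is the rank of the tail shifted by a
constant. -/
theorem rank_append (a b : List Bool) : rank (a ++ b) = 2 ^ b.length * rank a + rank b := by
  induction b using List.reverseRecOn with
  | nil => simp [rank, revRank]
  | append_singleton b x ih =>
    rw [← List.append_assoc, rank_append_singleton, rank_append_singleton, ih, List.length_append,
      List.length_singleton]
    ring

theorem rank_replicate_false (n : ℕ) : rank (List.replicate n false) + 1 = 2 ^ n := by
  induction n with
  | zero => rfl
  | succ n ih =>
    rw [List.replicate_succ', rank_append_singleton, pow_succ]; simp; omega

theorem rank_replicate_true (n : ℕ) : rank (List.replicate n true) + 2 = 2 ^ (n + 1) := by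
  induction n with
  | zero => rfl
  | succ n ih =>
    rw [List.replicate_succ', rank_append_singleton, pow_succ]; simp; omega

theorem rank_replicate_false_le {a : List Bool} {n : ℕ} (h : a.length = n) :
    rank (List.replicate n false) ≤ rank a := by
  have h₁ := rank_replicate_false n
  have h₂ := (two_pow_le_rank a).1
  rw [h] at h₂
  omega

theorem rank_le_replicate_true {a : List Bool} {n : ℕ} (h : a.length = n) :
    rank a ≤ rank (List.replicate n true) := by
  have h₁ := rank_replicate_true n
  have h₂ := (two_pow_le_rank a).2
  rw [h] at h₂
  omega

/-- The strings of length `|c| + n` with prefix `c` form a shortlex interval: the bounds force the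
length, and at equal lengths a different prefix of length `|c|` would decide the comparison the
wrong way. -/
theorem exists_append_of_rank {c t : List Bool} {n : ℕ}
    (h₁ : rank (c ++ List.replicate n false) ≤ rank t)
    (h₂ : rank t ≤ rank (c ++ List.replicate n true)) : ∃ y, y.length = n ∧ t = c ++ y := by
  have hl₁ := length_le_of_rank_le h₁
  have hl₂ := length_le_of_rank_le h₂
  simp only [List.length_append, List.length_replicate] at hl₁ hl₂
  have hd : (t.drop c.length).length = n := by rw [List.length_drop]; omega
  refine ⟨t.drop c.length, hd, ?_⟩
  have ht := List.take_append_drop c.length t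
  suffices h : t.take c.length = c by rw [h] at ht; exact ht.symm
  rw [← ht] at h₁ h₂
  rcases lt_trichotomy (rank (t.take c.length)) (rank c) with h | h | h
  · exact absurd (rank_append_lt h (c := t.drop c.length) (d := List.replicate n false)
      (by simpa using hd)) h₁.not_gt
  · exact rank_injective h
  · exact absurd (rank_append_lt h (c := List.replicate n true) (d := t.drop c.length)
      (by simpa using hd.symm)) h₂.not_gt

/-! ### Reordering strings behind their headers -/

section Reorder

/-- The string consists of the header of some `x` and a tail of length `p(|x|)`. -/
def Valid (p : ℕ → ℕ) (s : List Bool) : Prop :=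
  s = header (headerPart s) ++ tailPart s ∧ (tailPart s).length = p (headerPart s).length

theorem valid_header {p : ℕ → ℕ} {x y : List Bool} (h : y.length = p x.length) :
    Valid p (header x ++ y) := by
  simp [Valid, h]

theorem valid_iff {p : ℕ → ℕ} {s : List Bool} :
    Valid p s ↔ ∃ x y, y.length = p x.length ∧ s = header x ++ y :=
  ⟨fun h => ⟨_, _, h.2, h.1⟩, by rintro ⟨x, y, h, rfl⟩; exact valid_header h⟩

open Classical in
/-- Apply the bijection `h x` to the tail of a string that starts with the header of `x`. -/
noncomputable def reorder (p : ℕ → ℕ) (h : List Bool → List Bool → List Bool) (s : List Bool) :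
    List Bool :=
  if Valid p s then header (headerPart s) ++ h (headerPart s) (tailPart s) else s

open Classical in
/-- The first string with the same header. -/
noncomputable def blockMin (p : ℕ → ℕ) (s : List Bool) : List Bool :=
  if Valid p s then header (headerPart s) ++ (tailPart s).map (fun _ => false) else s

open Classical in
/-- The last string with the same header. -/
noncomputable def blockMax (p : ℕ → ℕ) (s : List Bool) : List Bool :=
  if Valid p s then header (headerPart s) ++ (tailPart s).map (fun _ => true) else s

variable {p : ℕ → ℕ} {h : List Bool → List Bool → List Bool}

theorem reorder_header {x y : List Bool} (hy : y.length = p x.length) :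
    reorder p h (header x ++ y) = header x ++ h x y := by
  rw [reorder, if_pos (valid_header hy), headerPart_header, tailPart_header]

theorem blockMin_header {x y : List Bool} (hy : y.length = p x.length) :
    blockMin p (header x ++ y) = header x ++ List.replicate (p x.length) false := by
  rw [blockMin, if_pos (valid_header hy), headerPart_header, tailPart_header, List.map_const', hy]

theorem blockMax_header {x y : List Bool} (hy : y.length = p x.length) :
    blockMax p (header x ++ y) = header x ++ List.replicate (p x.length) true := by
  rw [blockMax, if_pos (valid_header hy), headerPart_header, tailPart_header, List.map_const', hy]

theorem length_apply
    (hh : ∀ x : List Bool, Set.BijOn (h x) (strings (p x.length)) (strings (p x.length)))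
    {x y : List Bool} (hy : y.length = p x.length) :
    (h x y).length = p x.length :=
  (hh x).mapsTo hy

theorem length_reorder
    (hh : ∀ x : List Bool, Set.BijOn (h x) (strings (p x.length)) (strings (p x.length)))
    (s : List Bool) : (reorder p h s).length = s.length := by
  by_cases hs : Valid p s
  · obtain ⟨x, y, hy, rfl⟩ := valid_iff.1 hs
    rw [reorder_header hy, List.length_append, List.length_append, length_apply hh hy, hy]
  · rw [reorder, if_neg hs]

theorem valid_reorder
    (hh : ∀ x : List Bool, Set.BijOn (h x) (strings (p x.length)) (strings (p x.length)))
    (s : List Bool) : Valid p (reorder p h s) ↔ Valid p s := by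
  by_cases hs : Valid p s
  · obtain ⟨x, y, hy, rfl⟩ := valid_iff.1 hs
    rw [reorder_header hy]
    exact ⟨fun _ => hs, fun _ => valid_header (length_apply hh hy)⟩
  · rw [reorder, if_neg hs]

theorem reorder_injective
    (hh : ∀ x : List Bool, Set.BijOn (h x) (strings (p x.length)) (strings (p x.length)))
    : Function.Injective (reorder p h) := by
  intro s s' heq
  by_cases hs : Valid p s
  · have hs' : Valid p s' := by rwa [← valid_reorder hh, ← heq, valid_reorder hh]
    obtain ⟨x, y, hy, rfl⟩ := valid_iff.1 hs
    obtain ⟨x', y', hy', rfl⟩ := valid_iff.1 hs'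
    rw [reorder_header hy, reorder_header hy'] at heq
    obtain ⟨rfl, heq⟩ := header_append_inj heq
    rw [(hh x).injOn hy hy' heq]
  · have hs' : ¬ Valid p s' := by rwa [← valid_reorder hh, ← heq, valid_reorder hh]
    rwa [reorder, if_neg hs, reorder, if_neg hs'] at heq

theorem reorder_surjective
    (hh : ∀ x : List Bool, Set.BijOn (h x) (strings (p x.length)) (strings (p x.length)))
    : Function.Surjective (reorder p h) := by
  intro t
  by_cases ht : Valid p t
  · obtain ⟨x, y, hy, rfl⟩ := valid_iff.1 ht
    obtain ⟨y', hy', rfl⟩ := (hh x).surjOn hy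
    exact ⟨header x ++ y', reorder_header hy'⟩
  · exact ⟨t, by rw [reorder, if_neg ht]⟩

/-- Immediate succession of reordered strings with different headers. -/
theorem lexSucc_reorder
    (hh : ∀ x : List Bool, Set.BijOn (h x) (strings (p x.length)) (strings (p x.length)))
    {s s' : List Bool}
    (hne : ¬ (Valid p s ∧ Valid p s' ∧ headerPart s = headerPart s')) :
    LexSucc (reorder p h s) (reorder p h s') ↔ reorder p h s = blockMax p s ∧
      reorder p h s' = blockMin p s' ∧ LexSucc (blockMax p s) (blockMin p s') := by
  refine ⟨fun hsucc => ?_, fun ⟨h₁, h₂, h₃⟩ => by rwa [h₁, h₂]⟩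
  have hmax : reorder p h s = blockMax p s := by
    by_cases hs : Valid p s
    · obtain ⟨x, y, hy, rfl⟩ := valid_iff.1 hs
      rw [reorder_header hy, lexSucc_iff] at hsucc
      rw [reorder_header hy, blockMax_header hy]
      by_contra hlt
      have hle := rank_le_replicate_true (length_apply hh hy)
      have hge := rank_replicate_false_le (length_apply hh hy)
      have hlt' : rank (h x y) ≠ rank (List.replicate (p x.length) true) :=
        fun h' => hlt (by rw [rank_injective h'])
      -- If `h x y` were not all ones, the next rank would still lie in the block of `x`, so that
      -- `s'` would be valid with the same header.
      obtain ⟨z, hz, heq⟩ := exists_append_of_rank (c := header x) (n := p x.length)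
        (t := reorder p h s')
        (by rw [hsucc, rank_append, rank_append, length_apply hh hy, List.length_replicate]; omega)
        (by rw [hsucc, rank_append, rank_append, length_apply hh hy, List.length_replicate]; omega)
      have hs' : Valid p s' := by rw [← valid_reorder hh, heq]; exact valid_header hz
      obtain ⟨x', y', hy', rfl⟩ := valid_iff.1 hs'
      rw [reorder_header hy'] at heq
      obtain ⟨rfl, -⟩ := header_append_inj heq
      exact hne ⟨hs, hs', by simp⟩
    · rw [reorder, if_neg hs, blockMax, if_neg hs]
  have hmin : reorder p h s' = blockMin p s' := by
    by_cases hs' : Valid p s'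
    · obtain ⟨x, y, hy, rfl⟩ := valid_iff.1 hs'
      rw [reorder_header hy, lexSucc_iff] at hsucc
      rw [reorder_header hy, blockMin_header hy]
      by_contra hlt
      have hle := rank_le_replicate_true (length_apply hh hy)
      have hge := rank_replicate_false_le (length_apply hh hy)
      have hlt' : rank (h x y) ≠ rank (List.replicate (p x.length) false) :=
        fun h' => hlt (by rw [rank_injective h'])
      rw [rank_append, length_apply hh hy] at hsucc
      -- Symmetrically, if `h x y` were not all zeros, the preceding rank would lie in the same
      -- block.
      obtain ⟨z, hz, heq⟩ := exists_append_of_rank (c := header x) (n := p x.length)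
        (t := reorder p h s)
        (by rw [rank_append, List.length_replicate]; omega)
        (by rw [rank_append, List.length_replicate]; omega)
      have hs : Valid p s := by rw [← valid_reorder hh, heq]; exact valid_header hz
      obtain ⟨x', y', hy', rfl⟩ := valid_iff.1 hs
      rw [reorder_header hy'] at heq
      obtain ⟨rfl, -⟩ := header_append_inj heq
      exact hne ⟨hs, hs', by simp⟩
    · rw [reorder, if_neg hs', blockMin, if_neg hs']
  exact ⟨hmax, hmin, by rwa [hmax, hmin] at hsucc⟩

variable {b top : List Bool → List Bool}

theorem reorder_eq_blockMin
    (hh : ∀ x : List Bool, Set.BijOn (h x) (strings (p x.length)) (strings (p x.length)))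
    (hb : ∀ x, (b x).length = p x.length)
    (hb' : ∀ x, h x (b x) = List.replicate (p x.length) false) (s : List Bool) :
    reorder p h s = blockMin p s ↔ (Valid p s → tailPart s = b (headerPart s)) := by
  by_cases hs : Valid p s
  · obtain ⟨x, y, hy, rfl⟩ := valid_iff.1 hs
    rw [reorder_header hy, blockMin_header hy, List.append_cancel_left_eq, ← hb',
      (hh x).injOn.eq_iff hy (hb x)]
    simp [hs]
  · simp [reorder, blockMin, hs]

theorem reorder_eq_blockMax
    (hh : ∀ x : List Bool, Set.BijOn (h x) (strings (p x.length)) (strings (p x.length)))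
    (htop : ∀ x, (top x).length = p x.length)
    (htop' : ∀ x, h x (top x) = List.replicate (p x.length) true) (s : List Bool) :
    reorder p h s = blockMax p s ↔ (Valid p s → tailPart s = top (headerPart s)) := by
  by_cases hs : Valid p s
  · obtain ⟨x, y, hy, rfl⟩ := valid_iff.1 hs
    rw [reorder_header hy, blockMax_header hy, List.append_cancel_left_eq, ← htop',
      (hh x).injOn.eq_iff hy (htop x)]
    simp [hs]
  · simp [reorder, blockMax, hs]

/-- Immediate succession of reordered strings is decidable in polynomial time. -/
theorem polyTimePred_lexSucc_reorder
    (hh : ∀ x : List Bool, Set.BijOn (h x) (strings (p x.length)) (strings (p x.length)))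
    (hb : ∀ x, (b x).length = p x.length)
    (htop : ∀ x, (top x).length = p x.length)
    (hb' : ∀ x, h x (b x) = List.replicate (p x.length) false)
    (htop' : ∀ x, h x (top x) = List.replicate (p x.length) true)
    (hfb : FPt b) (hft : FPt top)
    {prec : List Bool → List Bool → List Bool → Prop} (hprec : PolyTimePred₃ prec)
    (hprec' : ∀ x, ∀ y ∈ strings (p x.length), ∀ z ∈ strings (p x.length),
      prec x y z ↔ LexSucc (h x y) (h x z)) :
    PolyTimePred₂ fun s s' => LexSucc (reorder p h s) (reorder p h s') := by
  -- No algorithm for `p` is needed: the tail is compared in length with `b` of the header part,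
  -- which has length `p` of the length of that part.
  have hvalid : ∀ {f : List Bool × List Bool → List Bool}, PT encodePair f →
      PD encodePair fun i => Valid p (f i) := fun hf =>
    ((hf.eq (hf.headerPart.header.append hf.tailPart)).and
      (hf.tailPart.length_eq (hfb.pt hf.headerPart))).congr fun i => by rw [hb]; rfl
  have h₁ := pt_pair_fst
  have h₂ := pt_pair_snd
  have hmax : PT encodePair fun i => blockMax p i.1 :=
    PT.ite (hvalid h₁) (h₁.headerPart.header.append (h₁.tailPart.map fun _ => true)) h₁
  have hmin : PT encodePair fun i => blockMin p i.2 :=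
    PT.ite (hvalid h₂) (h₂.headerPart.header.append (h₂.tailPart.map fun _ => false)) h₂
  have hsame := (hvalid h₁).and ((hvalid h₂).and (h₁.headerPart.eq h₂.headerPart))
  -- Two cases: a common block, where `prec` decides, and otherwise the passage from a last element
  -- to a first element, where `blockMax` and `blockMin` are explicit.
  refine PD.polyTimePred (((hsame.and
    (hprec.pd h₁.headerPart h₁.tailPart h₂.tailPart)).or (hsame.not.and
      (((hvalid h₁).imp (h₁.tailPart.eq (hft.pt h₁.headerPart))).and
        (((hvalid h₂).imp (h₂.tailPart.eq (hfb.pt h₂.headerPart))).and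
          (hmax.lexSucc hmin))))).congr ?_)
  rintro ⟨s, s'⟩
  dsimp only
  by_cases hs : Valid p s ∧ Valid p s' ∧ headerPart s = headerPart s'
  · rw [or_iff_left (fun h => h.1 hs), and_iff_right hs]
    obtain ⟨hs₁, hs₂, heq⟩ := hs
    obtain ⟨x, y, hy, rfl⟩ := valid_iff.1 hs₁
    obtain ⟨x', y', hy', rfl⟩ := valid_iff.1 hs₂
    simp only [headerPart_header] at heq
    subst heq
    -- Both ranks contain the same contribution of the header, which cancels.
    rw [headerPart_header, tailPart_header, tailPart_header, hprec' x y hy y' hy',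
      reorder_header hy, reorder_header hy', lexSucc_iff, lexSucc_iff, rank_append, rank_append,
      length_apply hh hy, length_apply hh hy']
    omega
  · rw [or_iff_right (fun h => hs h.1), and_iff_right hs, lexSucc_reorder hh hs,
      reorder_eq_blockMax hh htop htop', reorder_eq_blockMin hh hb hb']

end Reorder

/-! ### Nondeterministic computations -/

section Nondeterministic

variable {K : Type} [DecidableEq K] {Γ : K → Type} {Λ σ : Type}

/-- The computations of a nondeterministic machine given by its two programs: `NRun m alt c w t c'`
if there is a computation from `c` to `c'` with `t` steps and the guesses `w`. -/
inductive NRun (m : Λ → TM2.Stmt Γ Λ σ) (alt : Λ → Option (TM2.Stmt Γ Λ σ)) :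
    TM2.Cfg Γ Λ σ → List Bool → ℕ → TM2.Cfg Γ Λ σ → Prop
  | refl (c : TM2.Cfg Γ Λ σ) : NRun m alt c [] 0 c
  | det {l : Λ} {v : σ} {S : ∀ k, List (Γ k)} {w : List Bool} {t : ℕ} {c : TM2.Cfg Γ Λ σ}
      (hl : alt l = none) (h : NRun m alt (TM2.stepAux (m l) v S) w t c) :
      NRun m alt ⟨some l, v, S⟩ w (t + 1) c
  | guess {l : Λ} {s : TM2.Stmt Γ Λ σ} {v : σ} {S : ∀ k, List (Γ k)} {b : Bool} {w : List Bool}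
      {t : ℕ} {c : TM2.Cfg Γ Λ σ} (hl : alt l = some s)
      (h : NRun m alt (TM2.stepAux (if b then s else m l) v S) w t c) :
      NRun m alt ⟨some l, v, S⟩ (b :: w) (t + 1) c

/-- There is a halting computation from `c` with the guesses `w` and the verdict `a`. -/
def Outcome (m : Λ → TM2.Stmt Γ Λ σ) (alt : Λ → Option (TM2.Stmt Γ Λ σ)) (accepts : σ → Bool)
    (c : TM2.Cfg Γ Λ σ) (w : List Bool) (a : Bool) : Prop :=
  ∃ t c', NRun m alt c w t c' ∧ c'.l = none ∧ accepts c'.var = a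

/-- All computations from `c` have at most `B` steps. -/
def Bounded (m : Λ → TM2.Stmt Γ Λ σ) (alt : Λ → Option (TM2.Stmt Γ Λ σ)) (c : TM2.Cfg Γ Λ σ)
    (B : ℕ) : Prop :=
  ∀ w t c', NRun m alt c w t c' → t ≤ B

variable {m : Λ → TM2.Stmt Γ Λ σ} {alt : Λ → Option (TM2.Stmt Γ Λ σ)} {accepts : σ → Bool}
  {l : Λ} {s : TM2.Stmt Γ Λ σ} {v : σ} {S : ∀ k, List (Γ k)} {w : List Bool} {a : Bool} {B : ℕ}

theorem outcome_halt :
    Outcome m alt accepts ⟨none, v, S⟩ w a ↔ w = [] ∧ accepts v = a := by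
  constructor
  · rintro ⟨t, c', h, -, rfl⟩
    cases h
    exact ⟨rfl, rfl⟩
  · rintro ⟨rfl, h⟩
    exact ⟨0, _, .refl _, rfl, h⟩

theorem outcome_det (hl : alt l = none) : Outcome m alt accepts ⟨some l, v, S⟩ w a ↔
    Outcome m alt accepts (TM2.stepAux (m l) v S) w a := by
  constructor
  · rintro ⟨t, c', h, hc, ha⟩
    cases h with
    | refl => simp at hc
    | det _ h => exact ⟨_, _, h, hc, ha⟩
    | guess hl' _ => rw [hl] at hl'; cases hl'
  · rintro ⟨t, c', h, hc⟩
    exact ⟨_, _, .det hl h, hc⟩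

theorem outcome_guess (hl : alt l = some s) : Outcome m alt accepts ⟨some l, v, S⟩ w a ↔
    ∃ b w', w = b :: w' ∧ Outcome m alt accepts (TM2.stepAux (if b then s else m l) v S) w' a := by
  constructor
  · rintro ⟨t, c', h, hc, ha⟩
    cases h with
    | refl => simp at hc
    | det hl' _ => rw [hl] at hl'; cases hl'
    | guess hl' h =>
      rw [hl] at hl'
      cases hl'
      exact ⟨_, _, rfl, _, _, h, hc, ha⟩
  · rintro ⟨b, w', rfl, t, c', h, hc⟩
    exact ⟨_, _, .guess hl h, hc⟩

theorem bounded_halt : Bounded m alt ⟨none, v, S⟩ B := by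
  intro w t c' h
  cases h
  exact Nat.zero_le _

theorem bounded_det (hl : alt l = none) : Bounded m alt ⟨some l, v, S⟩ (B + 1) ↔
    Bounded m alt (TM2.stepAux (m l) v S) B := by
  constructor
  · intro hB w t c' h
    exact Nat.le_of_succ_le_succ (hB _ _ _ (.det hl h))
  · intro hB w t c' h
    cases h with
    | refl => exact Nat.zero_le _
    | det _ h => exact Nat.succ_le_succ (hB _ _ _ h)
    | guess hl' _ => rw [hl] at hl'; cases hl'

theorem bounded_guess (hl : alt l = some s) : Bounded m alt ⟨some l, v, S⟩ (B + 1) ↔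
    ∀ b : Bool, Bounded m alt (TM2.stepAux (if b then s else m l) v S) B := by
  constructor
  · intro hB b w t c' h
    exact Nat.le_of_succ_le_succ (hB _ _ _ (.guess hl h))
  · intro hB w t c' h
    cases h with
    | refl => exact Nat.zero_le _
    | det hl' _ => rw [hl] at hl'; cases hl'
    | guess hl' h =>
      rw [hl] at hl'
      cases hl'
      exact Nat.succ_le_succ (hB _ _ _ _ h)

/-- A configuration with a label can always make a step. Hence the base case of an induction on the
time bound concerns halted configurations only. -/
theorem not_bounded_zero : ¬ Bounded m alt ⟨some l, v, S⟩ 0 := by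
  intro h
  cases hl : alt l with
  | none => exact absurd (h _ _ _ (.det hl (.refl _))) (by simp)
  | some s => exact absurd (h _ _ _ (.guess (b := false) hl (.refl _))) (by simp)

theorem Bounded.mono {c : TM2.Cfg Γ Λ σ} {B' : ℕ} (h : Bounded m alt c B) (hB : B ≤ B') :
    Bounded m alt c B' :=
  fun w t c' h' => (h w t c' h').trans hB

end Nondeterministic

theorem run_iff_nRun {M : NTM} {c c' : M.tm.Cfg} {w : List Bool} {t : ℕ} :
    M.Run c w t c' ↔ NRun M.tm.m M.alt c w t c' := by
  constructor
  · intro h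
    induction h with
    | refl => exact .refl _
    | det hl _ ih => exact .det hl ih
    | guessZero hl _ ih => exact .guess (b := false) hl ih
    | guessOne hl _ ih => exact .guess (b := true) hl ih
  · intro h
    induction h with
    | refl => exact .refl _
    | det hl _ ih => exact .det hl ih
    | @guess l s v S b w t c hl _ ih =>
      cases b
      · exact .guessZero hl ih
      · exact .guessOne hl ih

namespace NTM

/-- The initial configuration, with its input stack made explicit. -/
def start (M : NTM) (x : List Bool) : TM2.Cfg M.tm.Γ M.tm.Λ M.tm.σ :=
  ⟨some M.tm.main, M.tm.initialState, single M.tm.k₀ (x.map M.inputAlphabet.symm)⟩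

theorem init_eq_start (M : NTM) (x : List Bool) : M.init x = M.start x := initList_eq _ _

theorem run_init_iff {M : NTM} {x w : List Bool} {t : ℕ} {c : M.tm.Cfg} :
    M.Run (M.init x) w t c ↔ NRun M.tm.m M.alt (M.start x) w t c := by
  rw [← init_eq_start]; exact run_iff_nRun

theorem mem_paths {M : NTM} {x w : List Bool} :
    w ∈ M.paths x ↔ ∃ a, Outcome M.tm.m M.alt M.accepts (M.start x) w a :=
  ⟨fun ⟨t, c, h, hc⟩ => ⟨_, t, c, run_init_iff.1 h, hc, rfl⟩,
    fun ⟨_, t, c, h, hc, _⟩ => ⟨t, c, run_init_iff.2 h, hc⟩⟩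

theorem mem_acc {M : NTM} {x w : List Bool} :
    w ∈ M.acc x ↔ Outcome M.tm.m M.alt M.accepts (M.start x) w true :=
  ⟨fun ⟨t, c, h, hc⟩ => ⟨t, c, run_init_iff.1 h, hc⟩,
    fun ⟨t, c, h, hc⟩ => ⟨t, c, run_init_iff.2 h, hc⟩⟩

theorem isPolyTime_iff {M : NTM} :
    M.IsPolyTime ↔ ∃ q : Polynomial ℕ, ∀ x, Bounded M.tm.m M.alt (M.start x) (q.eval x.length) :=
  ⟨fun ⟨q, h⟩ => ⟨q, fun x w t c hr => h x w t c (run_init_iff.2 hr)⟩,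
    fun ⟨q, h⟩ => ⟨q, fun x w t c hr => h x w t c (run_init_iff.1 hr)⟩⟩

theorem acc_subset_paths (M : NTM) (x : List Bool) : M.acc x ⊆ M.paths x :=
  fun _ h => mem_paths.2 ⟨_, mem_acc.1 h⟩

end NTM

theorem exists_ntm {K Λ σ : Type} [DecidableEq K] [Fintype K] [Fintype Λ] [Fintype σ]
    {Γ : K → Type} (k₀ : K) (main : Λ) (v : σ) (m : Λ → TM2.Stmt Γ Λ σ)
    (alt : Λ → Option (TM2.Stmt Γ Λ σ)) (accepts : σ → Bool) (iE : Γ k₀ ≃ Bool) (q : Polynomial ℕ)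
    (hq : ∀ x : List Bool,
      Bounded m alt ⟨some main, v, single k₀ (x.map iE.symm)⟩ (q.eval x.length)) :
    ∃ M : NTM, M.IsPolyTime ∧
      (∀ x w, w ∈ M.paths x ↔
        ∃ a, Outcome m alt accepts ⟨some main, v, single k₀ (x.map iE.symm)⟩ w a) ∧
      ∀ x w, w ∈ M.acc x ↔
        Outcome m alt accepts ⟨some main, v, single k₀ (x.map iE.symm)⟩ w true := by
  have : Fintype (Γ k₀) := Fintype.ofEquiv _ iE.symm
  -- The output stack of a nondeterministic machine is irrelevant, so the input stack takes its
  -- place.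
  exact ⟨⟨{ k₀ := k₀, k₁ := k₀, Γ := Γ, Λ := Λ, main := main, σ := σ, initialState := v, m := m },
    iE, alt, accepts⟩, NTM.isPolyTime_iff.2 ⟨q, hq⟩, fun _ _ => NTM.mem_paths,
    fun _ _ => NTM.mem_acc⟩

/-! ### Guessing the header of the input -/

section HeaderGuess

variable (M : NTM)

/-- A statement of `M` as a statement of the header-guessing machine. -/
def headerEmbed (q : TM2.Stmt M.tm.Γ M.tm.Λ M.tm.σ) :
    TM2.Stmt (sumFam M.tm.Γ (fun _ : Unit => Bool)) (M.tm.Λ ⊕ Fin 5)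
      (M.tm.σ × Option Bool × Bool) :=
  embed (Γ' := sumFam M.tm.Γ (fun _ : Unit => Bool)) Sum.inl (Equiv.refl _) Sum.inl none q

/-- Guess a string of length `2|x| + 1`, compare it with the header of the input `x`, and run `M`
on `x`. -/
def headerProg : M.tm.Λ ⊕ Fin 5 → TM2.Stmt (sumFam M.tm.Γ (fun _ : Unit => Bool)) (M.tm.Λ ⊕ Fin 5)
    (M.tm.σ × Option Bool × Bool)
  | .inl l => headerEmbed M (M.tm.m l)
  | .inr 0 => .pop (.inl M.tm.k₀) (fun v o => (v.1, o.map M.inputAlphabet, v.2.2)) <|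
      .branch (fun v => v.2.1.isSome)
        (.push (.inr ()) (fun v => v.2.1.getD false) (.goto fun _ => .inr 1))
        (.goto fun _ => .inr 3)
  | .inr 1 => .load (fun v => (v.1, v.2.1, false)) (.goto fun _ => .inr 2)
  | .inr 2 => .load (fun v => (v.1, v.2.1, v.2.2 && v.2.1 == some false)) (.goto fun _ => .inr 0)
  | .inr 3 => .goto fun _ => .inr 4
  | .inr 4 => .pop (.inr ()) (fun v o => (v.1, o, v.2.2)) <|
      .branch (fun v => v.2.1.isSome)
        (.push (.inl M.tm.k₀) (fun v => M.inputAlphabet.symm (v.2.1.getD false))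
          (.goto fun _ => .inr 4))
        (.goto fun _ => .inl M.tm.main)

/-- The statements of the header-guessing machine for guess `1`. -/
def headerAlt : M.tm.Λ ⊕ Fin 5 →
    Option (TM2.Stmt (sumFam M.tm.Γ (fun _ : Unit => Bool)) (M.tm.Λ ⊕ Fin 5)
      (M.tm.σ × Option Bool × Bool))
  | .inl l => (M.alt l).map (headerEmbed M)
  | .inr 0 => none
  | .inr 1 => some (.goto fun _ => .inr 2)
  | .inr 2 => some
      (.load (fun v => (v.1, v.2.1, v.2.2 && v.2.1 == some true)) (.goto fun _ => .inr 0))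
  | .inr 3 => some (.load (fun v => (v.1, v.2.1, false)) (.goto fun _ => .inr 4))
  | .inr 4 => none

/-- The verdict of the header-guessing machine. -/
def headerAccepts (v : M.tm.σ × Option Bool × Bool) : Bool := v.2.2 && M.accepts v.1

/-- The stacks of the header-guessing machine before the simulation of `M`. -/
def headerStacks (X : List Bool) (T : List Bool) :
    ∀ k, List (sumFam M.tm.Γ (fun _ : Unit => Bool) k)
  | .inl k => single M.tm.k₀ (X.map M.inputAlphabet.symm) k
  | .inr _ => T

variable {M}

theorem headerStacks_nil (x : List Bool) : headerStacks M x [] =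
    single (.inl M.tm.k₀) (x.map M.inputAlphabet.symm) := by
  refine eq_single (single_same _ _) ?_
  rintro (k | k) hk
  · exact single_of_ne (by simpa using hk) _
  · rfl

theorem update_headerStacks_inl (X T Y : List Bool) :
    Function.update (headerStacks M X T) (.inl M.tm.k₀) (Y.map M.inputAlphabet.symm) =
      headerStacks M Y T := by
  funext k
  rcases k with k | k
  · by_cases h : k = M.tm.k₀
    · subst h; simp [headerStacks]
    · rw [Function.update_of_ne (by simpa using h)]
      simp [headerStacks, single_of_ne h]
  · rw [Function.update_of_ne (by simp)]; rfl

theorem update_headerStacks_inr (X T U : List Bool) :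
    Function.update (headerStacks M X T) (.inr ()) U = headerStacks M X U := by
  funext k
  rcases k with k | k
  · rw [Function.update_of_ne (by simp)]; rfl
  · simp [headerStacks]

/-- Induction on the time bound. The component `r` is not touched during the simulation, so its flag
is conjoined with the verdict of `M` only at the end, and the guesses are unchanged. -/
theorem outcome_embed {c : TM2.Cfg M.tm.Γ M.tm.Λ M.tm.σ} {r : Option Bool × Bool} {B : ℕ}
    {F : ∀ k, List (sumFam M.tm.Γ (fun _ : Unit => Bool) k)}
    {d : TM2.Cfg (sumFam M.tm.Γ (fun _ : Unit => Bool)) (M.tm.Λ ⊕ Fin 5)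
      (M.tm.σ × Option Bool × Bool)}
    (hB : Bounded M.tm.m M.alt c B)
    (hd : Extends (Γ' := sumFam M.tm.Γ (fun _ : Unit => Bool)) Sum.inl (Equiv.refl _) Sum.inl none
      r F c d) :
    Bounded (headerProg M) (headerAlt M) d B ∧ ∀ w a',
      Outcome (headerProg M) (headerAlt M) (headerAccepts M) d w a' ↔
        ∃ a, Outcome M.tm.m M.alt M.accepts c w a ∧ a' = (r.2 && a) := by
  induction B generalizing c d with
  | zero =>
    obtain ⟨_ | l, v, S⟩ := c
    · obtain ⟨dl, dv, dS⟩ := d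
      obtain ⟨hl, hv, -, -⟩ := hd
      dsimp at hl hv
      subst hl hv
      refine ⟨bounded_halt, fun w a' => ?_⟩
      simp only [outcome_halt, headerAccepts]
      constructor
      · rintro ⟨rfl, rfl⟩; exact ⟨_, ⟨rfl, rfl⟩, rfl⟩
      · rintro ⟨_, ⟨rfl, rfl⟩, rfl⟩; exact ⟨rfl, rfl⟩
    · exact absurd hB not_bounded_zero
  | succ B ih =>
    obtain ⟨_ | l, v, S⟩ := c
    · obtain ⟨h₁, h₂⟩ := ih (c := ⟨none, v, S⟩) bounded_halt hd
      exact ⟨h₁.mono (Nat.le_succ B), h₂⟩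
    · rw [hd.eq_mk]
      have hstep : ∀ q : TM2.Stmt M.tm.Γ M.tm.Λ M.tm.σ,
          Extends (Γ' := sumFam M.tm.Γ (fun _ : Unit => Bool)) Sum.inl (Equiv.refl _) Sum.inl none
            r F (TM2.stepAux q v S) (TM2.stepAux (headerEmbed M q) (v, r) d.stk) :=
        fun q => extends_stepAux Sum.inl_injective q v S d.stk hd.stk hd.frame
      cases hl : M.alt l with
      | none =>
        have hl' : headerAlt M (.inl l) = none := by rw [headerAlt, hl]; rfl
        rw [bounded_det hl] at hB
        obtain ⟨h₁, h₂⟩ := ih hB (hstep _)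
        refine ⟨(bounded_det hl').2 h₁, fun w a' => ?_⟩
        rw [outcome_det hl']
        simp only [outcome_det hl]
        exact h₂ w a'
      | some s =>
        have hl' : headerAlt M (.inl l) = some (headerEmbed M s) := by rw [headerAlt, hl]; rfl
        rw [bounded_guess hl] at hB
        have ih' := fun b => ih (hB b) (hstep _)
        refine ⟨(bounded_guess hl').2 fun b => ?_, fun w a' => ?_⟩
        · cases b
          · exact (ih' false).1
          · exact (ih' true).1
        · rw [outcome_guess hl']
          simp only [outcome_guess hl]
          constructor
          · rintro ⟨b, w', rfl, h⟩
            have h' : ∃ a, Outcome M.tm.m M.alt M.accepts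
                (TM2.stepAux (if b then s else M.tm.m l) v S) w' a ∧ a' = (r.2 && a) := by
              refine ((ih' b).2 w' a').1 ?_
              cases b <;> exact h
            obtain ⟨a, ha, ha'⟩ := h'
            exact ⟨a, ⟨b, w', rfl, ha⟩, ha'⟩
          · rintro ⟨a, ⟨b, w', rfl, ha⟩, ha'⟩
            have h := ((ih' b).2 w' a').2 ⟨a, ha, ha'⟩
            exact ⟨b, w', rfl, by cases b <;> exact h⟩

theorem headerStacks_inl (x T : List Bool) :
    headerStacks M x T (.inl M.tm.k₀) = x.map M.inputAlphabet.symm :=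
  single_same _ _

theorem headerStacks_inr (x T : List Bool) : headerStacks M x T (.inr ()) = T := rfl

theorem header_cons (b : Bool) (x : List Bool) :
    header (b :: x) = true :: b :: header x := rfl

/-- While the header is checked, the input moves in reverse to the auxiliary stack `T`; moving it
back restores it, and `M` starts on `T.reverse ++ x`. -/
theorem outcome_restore (x T : List Bool) (o : Option Bool) (f : Bool) {B : ℕ}
    (hB : Bounded M.tm.m M.alt (M.start (T.reverse ++ x)) B) :
    Bounded (headerProg M) (headerAlt M)
      ⟨some (.inr 4), (M.tm.initialState, o, f), headerStacks M x T⟩ (T.length + 1 + B) ∧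
    ∀ w a', Outcome (headerProg M) (headerAlt M) (headerAccepts M)
      ⟨some (.inr 4), (M.tm.initialState, o, f), headerStacks M x T⟩ w a' ↔
        ∃ a, Outcome M.tm.m M.alt M.accepts (M.start (T.reverse ++ x)) w a ∧ a' = (f && a) := by
  induction T generalizing x o with
  | nil =>
    have hstep : TM2.stepAux (headerProg M (.inr 4)) (M.tm.initialState, o, f)
        (headerStacks M x []) =
        ⟨some (.inl M.tm.main), (M.tm.initialState, none, f), headerStacks M x []⟩ := by
      simp [headerProg, headerStacks, update_headerStacks_inr]
    obtain ⟨h₁, h₂⟩ := outcome_embed (r := (none, f)) (F := headerStacks M x []) hB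
      (d := ⟨some (.inl M.tm.main), (M.tm.initialState, none, f), headerStacks M x []⟩)
      ⟨rfl, rfl, fun _ => rfl, fun _ _ => rfl⟩
    refine ⟨?_, fun w a' => ?_⟩
    · rw [List.length_nil, Nat.zero_add, Nat.add_comm, bounded_det rfl, hstep]
      exact h₁
    · rw [outcome_det rfl, hstep]
      exact h₂ w a'
  | cons b T ih =>
    have hstep : TM2.stepAux (headerProg M (.inr 4)) (M.tm.initialState, o, f)
        (headerStacks M x (b :: T)) =
        ⟨some (.inr 4), (M.tm.initialState, some b, f), headerStacks M (b :: x) T⟩ := by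
      have h₁ := update_headerStacks_inr (M := M) x (b :: T) T
      have h₂ := update_headerStacks_inl (M := M) x T (b :: x)
      simp only [List.map_cons] at h₂
      simp [headerProg, headerStacks_inl, headerStacks_inr, h₁, h₂]
    obtain ⟨h₁, h₂⟩ := ih (b :: x) (some b) (by simpa using hB)
    refine ⟨?_, fun w a' => ?_⟩
    · rw [List.length_cons, Nat.add_right_comm _ 1 B, Nat.add_right_comm _ 1 B]
      rw [bounded_det rfl, hstep]
      exact h₁.mono (by omega)
    · rw [outcome_det rfl, hstep, h₂]
      simp

/-- The invariant: `T.reverse ++ x` is the whole input, and `f` records whether the guesses so far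
agree with its header. A wrong guess only clears the flag, so every guess sequence of the right
length remains a path. Each input bit costs three steps: one pop and two guesses, for the tag and
the bit. -/
theorem outcome_read (x T : List Bool) (o : Option Bool) (f : Bool) {B : ℕ}
    (hB : Bounded M.tm.m M.alt (M.start (T.reverse ++ x)) B) :
    Bounded (headerProg M) (headerAlt M)
      ⟨some (.inr 0), (M.tm.initialState, o, f), headerStacks M x T⟩
        (3 * x.length + 2 + (T.length + x.length + 1 + B)) ∧
    ∀ w a', Outcome (headerProg M) (headerAlt M) (headerAccepts M)
      ⟨some (.inr 0), (M.tm.initialState, o, f), headerStacks M x T⟩ w a' ↔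
        ∃ u w' a, u.length = 2 * x.length + 1 ∧ w = u ++ w' ∧
          Outcome M.tm.m M.alt M.accepts (M.start (T.reverse ++ x)) w' a ∧
          a' = (f && decide (u = header x) && a) := by
  induction x generalizing T o f with
  | nil =>
    have hstep : TM2.stepAux (headerProg M (.inr 0)) (M.tm.initialState, o, f)
        (headerStacks M [] T) =
        ⟨some (.inr 3), (M.tm.initialState, none, f), headerStacks M [] T⟩ := by
      have := update_headerStacks_inl (M := M) [] T []
      simp only [List.map_nil] at this
      simp [headerProg, headerStacks, this]
    have hstep' : ∀ b : Bool, TM2.stepAux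
        (if b then .load (fun v => (v.1, v.2.1, false)) (.goto fun _ => .inr 4)
          else headerProg M (.inr 3)) (M.tm.initialState, none, f) (headerStacks M [] T) =
        ⟨some (.inr 4), (M.tm.initialState, none, f && !b), headerStacks M [] T⟩ := by
      intro b; cases b <;> simp [headerProg]
    have hr := fun b => outcome_restore [] T none (f && !b) hB
    refine ⟨?_, fun w a' => ?_⟩
    · rw [show 3 * ([] : List Bool).length + 2 + (T.length + ([] : List Bool).length + 1 + B) =
        T.length + 1 + B + 1 + 1 by simp; omega]
      rw [bounded_det rfl, hstep, bounded_guess rfl]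
      intro b
      rw [hstep']
      exact (hr b).1
    · rw [outcome_det rfl, hstep, outcome_guess rfl]
      simp only [hstep', hr]
      constructor
      · rintro ⟨b, w', rfl, a, ha, rfl⟩
        exact ⟨[b], w', a, rfl, rfl, ha, by cases b <;> simp [header]⟩
      · rintro ⟨u, w', a, hu, rfl, ha, rfl⟩
        obtain ⟨b, rfl⟩ := List.length_eq_one_iff.1 (by simpa using hu)
        exact ⟨b, w', rfl, a, ha, by cases b <;> simp [header]⟩
  | cons b x ih =>
    have hstep : TM2.stepAux (headerProg M (.inr 0)) (M.tm.initialState, o, f)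
        (headerStacks M (b :: x) T) =
        ⟨some (.inr 1), (M.tm.initialState, some b, f), headerStacks M x (b :: T)⟩ := by
      have h₁ := update_headerStacks_inl (M := M) (b :: x) T x
      have h₂ := update_headerStacks_inr (M := M) x T (b :: T)
      simp [headerProg, headerStacks_inl, headerStacks_inr, h₁, h₂]
    have hstep' : ∀ c : Bool, TM2.stepAux
        (if c then (.goto fun _ => .inr 2) else headerProg M (.inr 1))
          (M.tm.initialState, some b, f) (headerStacks M x (b :: T)) =
        ⟨some (.inr 2), (M.tm.initialState, some b, f && c), headerStacks M x (b :: T)⟩ := by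
      intro c; cases c <;> simp [headerProg]
    have hstep'' : ∀ c g : Bool, TM2.stepAux
        (if c then (.load (fun v => (v.1, v.2.1, v.2.2 && v.2.1 == some true))
          (.goto fun _ => .inr 0)) else headerProg M (.inr 2))
          (M.tm.initialState, some b, g) (headerStacks M x (b :: T)) =
        ⟨some (.inr 0), (M.tm.initialState, some b, g && b == c), headerStacks M x (b :: T)⟩ := by
      intro c g; cases c <;> simp [headerProg]
    have hr := fun g => ih (b :: T) (some b) g (by simpa using hB)
    refine ⟨?_, fun w a' => ?_⟩
    · rw [show 3 * (b :: x).length + 2 + (T.length + (b :: x).length + 1 + B) =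
        3 * x.length + 2 + ((b :: T).length + x.length + 1 + B) + 1 + 1 + 1 by simp; omega]
      rw [bounded_det rfl, hstep, bounded_guess rfl]
      intro c
      rw [hstep', bounded_guess rfl]
      intro c'
      rw [hstep'']
      exact (hr _).1
    · rw [outcome_det rfl, hstep, outcome_guess rfl]
      simp only [hstep']
      have h₂ : ∀ (g : Bool) (w : List Bool), Outcome (headerProg M) (headerAlt M) (headerAccepts M)
          ⟨some (.inr 2), (M.tm.initialState, some b, g), headerStacks M x (b :: T)⟩ w a' ↔ _ :=
        fun g w => outcome_guess rfl
      simp only [h₂, hstep'', hr]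
      constructor
      · rintro ⟨c, _, rfl, c', _, rfl, u, w', a, hu, rfl, ha, rfl⟩
        refine ⟨c :: c' :: u, w', a, by simp [hu]; ring, rfl, by simpa using ha, ?_⟩
        cases c <;> cases c' <;> cases b <;> simp [header_cons]
      · rintro ⟨u, w', a, hu, rfl, ha, rfl⟩
        obtain _ | ⟨c, _ | ⟨c', u⟩⟩ := u
        · simp at hu
        · simp at hu
        · refine ⟨c, _, rfl, c', _, rfl, u, w', a, by simp at hu; omega, rfl, by simpa using ha, ?_⟩
          cases c <;> cases c' <;> cases b <;> simp [header_cons]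

variable (M) in
/-- From `M` one gets a machine that guesses the header of its input in front of every path. -/
theorem exists_ntm_header (hM : M.IsPolyTime) :
    ∃ M' : NTM, M'.IsPolyTime ∧
      (∀ x w, w ∈ M'.paths x ↔ ∃ u y, u.length = 2 * x.length + 1 ∧ y ∈ M.paths x ∧ w = u ++ y) ∧
      ∀ x w, w ∈ M'.acc x ↔ ∃ y ∈ M.acc x, w = header x ++ y := by
  obtain ⟨q, hq⟩ := NTM.isPolyTime_iff.1 hM
  have key := fun x => outcome_read x [] none true (hq x)
  simp only [headerStacks_nil] at key
  obtain ⟨M', h₁, h₂, h₃⟩ := exists_ntm (.inl M.tm.k₀) (.inr 0) (M.tm.initialState, none, true)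
    (headerProg M) (headerAlt M) (headerAccepts M) M.inputAlphabet
    (3 * Polynomial.X + 2 + (Polynomial.X + 1 + q)) fun x => by simpa using (key x).1
  refine ⟨M', h₁, fun x w => ?_, fun x w => ?_⟩
  · rw [h₂]
    simp only [key]
    simp only [NTM.mem_paths]
    constructor
    · rintro ⟨-, u, y, a, hu, rfl, ha, -⟩
      exact ⟨u, y, hu, ⟨a, ha⟩, rfl⟩
    · rintro ⟨u, y, hu, ⟨a, ha⟩, rfl⟩
      exact ⟨_, u, y, a, hu, rfl, ha, rfl⟩
  · rw [h₃, (key x).2]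
    simp only [NTM.mem_acc]
    constructor
    · rintro ⟨u, y, a, hu, rfl, ha, h⟩
      simp only [Bool.true_and, eq_comm (a := true), Bool.and_eq_true, decide_eq_true_iff] at h
      obtain ⟨rfl, rfl⟩ := h
      exact ⟨y, ha, rfl⟩
    · rintro ⟨y, hy, rfl⟩
      exact ⟨header x, y, true, length_header x, rfl, hy, by simp⟩

end HeaderGuess

/-! ### `CLU#P ⊆ CL#P` -/

theorem finite_strings (n : ℕ) : (strings n).Finite := List.finite_length_eq Bool n

namespace NTM

theorem acc_subset_strings {M : NTM} {p : ℕ → ℕ} (hM : M.IsBalanced p) (x : List Bool) :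
    M.acc x ⊆ strings (p x.length) :=
  (M.acc_subset_paths x).trans (hM x).subset

theorem finite_acc {M : NTM} {p : ℕ → ℕ} (hM : M.IsBalanced p) (x : List Bool) :
    (M.acc x).Finite :=
  (finite_strings _).subset (acc_subset_strings hM x)

end NTM

/-! ### Orders given by a rank, and their clusters -/

section RankOrder

variable {r : List Bool → ℕ}

theorem isLinearOrder_of_injective (hr : Function.Injective r) :
    IsLinearOrder (List Bool) fun s t => r s ≤ r t where
  refl _ := le_rfl
  trans _ _ _ := le_trans
  antisymm _ _ h h' := hr (le_antisymm h h')
  total _ _ := le_total _ _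

theorem strictPart_rank_iff (hr : Function.Injective r) {s t : List Bool} :
    StrictPart (fun s t => r s ≤ r t) s t ↔ r s < r t := by
  rw [StrictPart, ← hr.ne_iff, lt_iff_le_and_ne]

theorem adj_rank_iff (hr : Function.Bijective r) {s t : List Bool} :
    Adj (fun s t => r s ≤ r t) s t ↔ r t = r s + 1 := by
  simp only [Adj, strictPart_rank_iff hr.1]
  constructor
  · rintro ⟨h, h'⟩
    obtain ⟨z, hz⟩ := hr.2 (r s + 1)
    by_contra hne
    exact h' ⟨z, by omega, by omega⟩
  · intro h
    exact ⟨by omega, by rintro ⟨z, h₁, h₂⟩; omega⟩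

/-- From `a` every accepting path is reached by raising the rank one unit at a time without leaving
the accepting interval. Conversely, acceptance is constant on the classes of the equivalence
closure. -/
theorem isCluster_of_rank (hr : Function.Bijective r) {M : NTM} {x a u : List Bool}
    (ha : a ∈ M.acc x) (h : ∀ w, w ∈ M.acc x ↔ r a ≤ r w ∧ r w ≤ r u) :
    IsCluster (fun s t => r s ≤ r t) M x (M.acc x) := by
  refine .inr ⟨⟨a, M.acc_subset_paths x ha⟩, ha, Set.Subset.antisymm ?_ ?_⟩
  · intro w hw
    obtain ⟨n, hn⟩ := Nat.exists_eq_add_of_le ((h w).1 hw).1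
    induction n generalizing w with
    | zero =>
      obtain rfl := hr.1 hn
      exact ⟨_, rfl, .refl _⟩
    | succ n ih =>
      obtain ⟨v, hv⟩ := hr.2 (r a + n)
      have hva : v ∈ M.acc x := (h v).2 ⟨by omega, by have := ((h w).1 hw).2; omega⟩
      obtain ⟨v', rfl, hv'⟩ := ih hva hv
      refine ⟨⟨w, M.acc_subset_paths x hw⟩, rfl, hv'.trans _ _ _ (.rel _ _ ⟨.inl ?_, ?_⟩)⟩
      · rw [adj_rank_iff hr]; dsimp only; omega
      · exact iff_of_true hva hw
  · rintro w ⟨z, rfl, hz⟩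
    have : ∀ y z : M.paths x, Relation.EqvGen (PathSim (fun s t => r s ≤ r t) M x) y z →
        ((y : List Bool) ∈ M.acc x ↔ (z : List Bool) ∈ M.acc x) := by
      intro y z hyz
      induction hyz with
      | rel _ _ h => exact h.2
      | refl => rfl
      | symm _ _ _ ih => exact ih.symm
      | trans _ _ _ _ _ ih₁ ih₂ => exact ih₁.trans ih₂
    exact (this _ _ hz).1 ha

end RankOrder

theorem isNatPoly_header {p : ℕ → ℕ} (hp : IsNatPoly p) : IsNatPoly fun n => 2 * n + 1 + p n := by
  obtain ⟨q, hq⟩ := hp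
  exact ⟨2 * Polynomial.X + 1 + q, fun n => by simp [hq]⟩

theorem cluSharpP_subset : CLUSharpP ⊆ CLSharpP := by
  rintro f ⟨p, hp, M, hM, hMp, b, top, hb, htop, prec, hprec, H⟩
  choose h hbij hlen hends hsucc hacc hf using H
  obtain ⟨M', hM', hpaths, hacc'⟩ := exists_ntm_header M hM
  have hrank : Function.Bijective fun s => rank (reorder p h s) :=
    Function.Bijective.comp (g := rank) ⟨rank_injective, rank_surjective⟩
      ⟨reorder_injective hbij, reorder_surjective hbij⟩
  refine ⟨fun n => 2 * n + 1 + p n, isNatPoly_header hp, M', hM', fun x => ?_,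
    fun s t => rank (reorder p h s) ≤ rank (reorder p h t), isLinearOrder_of_injective hrank.1,
    fun s t hst => ?_, ?_, fun x => ⟨?_, ?_⟩⟩
  · ext w
    rw [hpaths, hMp x]
    constructor
    · rintro ⟨u, y, hu, hy, rfl⟩
      change y.length = _ at hy
      change (u ++ y).length = _
      rw [List.length_append, hu, hy]
    · intro hw
      change w.length = _ at hw
      refine ⟨w.take (2 * x.length + 1), w.drop (2 * x.length + 1), ?_, ?_,
        (List.take_append_drop _ _).symm⟩
      · rw [List.length_take, hw]; dsimp only; omega
      · change (List.drop _ w).length = _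
        rw [List.length_drop, hw]; dsimp only; omega
  · rw [strictPart_rank_iff (r := fun s => rank (reorder p h s)) hrank.1]
    by_contra hlt
    have := length_le_of_rank_le (not_lt.1 hlt)
    rw [length_reorder hbij, length_reorder hbij] at this
    omega
  · have := polyTimePred_lexSucc_reorder hbij (fun x => (hlen x).1) (fun x => (hlen x).2)
      (fun x => (hends x).1) (fun x => (hends x).2) hb htop hprec hsucc
    refine PD.polyTimePred ((PolyTimePred.pd this).congr fun a => ?_)
    rw [adj_rank_iff (r := fun s => rank (reorder p h s)) hrank]
    exact lexSucc_iff
  · by_cases hfx : f x = 0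
    -- The interval condition is void here, but a finite set of cardinality zero is empty.
    -- Finiteness matters, since `ncard` is also zero on infinite sets.
    · rw [hf, NTM.numAcc, Set.ncard_eq_zero (NTM.finite_acc hMp x)] at hfx
      left
      ext w
      simp [hacc', hfx]
    · obtain ⟨l, hl, u, hu, hlu⟩ := hacc x hfx
      -- Some path is accepted because `f x ≠ 0`, so the interval is nonempty and contains its lower
      -- endpoint.
      have hla : l ∈ M.acc x := by
        obtain ⟨w, hw⟩ : (M.acc x).Nonempty := by
          rw [Set.nonempty_iff_ne_empty]
          intro h
          rw [hf, NTM.numAcc, h] at hfx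
          simp at hfx
        rw [hlu] at hw ⊢
        obtain ⟨-, h₁, h₂⟩ := hw
        rw [lexLE_iff] at h₁ h₂
        exact ⟨hl, lexLE_iff.2 le_rfl, lexLE_iff.2 (h₁.trans h₂)⟩
      have hmem : ∀ y, y ∈ M.acc x ↔
          y.length = p x.length ∧ rank (h x l) ≤ rank (h x y) ∧ rank (h x y) ≤ rank (h x u) := by
        intro y
        rw [hlu]
        simp only [lexLE_iff]
        rfl
      refine isCluster_of_rank (r := fun s => rank (reorder p h s)) hrank (a := header x ++ l)
        (u := header x ++ u) ((hacc' _ _).2 ⟨l, hla, rfl⟩) fun w => ?_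
      rw [hacc']
      change l.length = _ at hl
      change u.length = _ at hu
      rw [reorder_header hl, reorder_header hu]
      have hlen' : ∀ y : List Bool, y.length = p x.length → (h x y).length = p x.length :=
        fun y hy => (hbij x).mapsTo hy
      constructor
      · rintro ⟨y, hy, rfl⟩
        obtain ⟨hy, h₁, h₂⟩ := (hmem y).1 hy
        rw [reorder_header hy, rank_append, rank_append, rank_append, hlen' _ hl, hlen' _ hu,
          hlen' _ hy]
        omega
      · rintro ⟨h₁, h₂⟩
        -- Both endpoints lie in the block of `x`, which is an interval. So every string in between
        -- has the header of `x`, and no foreign string enters the cluster.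
        obtain ⟨t, ht, hwt⟩ := exists_append_of_rank (c := header x) (n := p x.length)
          (le_trans (by
            have := rank_replicate_false_le (hlen' _ hl)
            rw [rank_append, rank_append, List.length_replicate, hlen' _ hl]
            omega) h₁) (h₂.trans (by
            have := rank_le_replicate_true (hlen' _ hu)
            rw [rank_append, rank_append, List.length_replicate, hlen' _ hu]
            omega))
        obtain ⟨y, hy, rfl⟩ := (hbij x).surjOn ht
        rw [← reorder_header hy] at hwt
        obtain rfl := reorder_injective hbij hwt
        refine ⟨y, (hmem y).2 ⟨hy, ?_⟩, rfl⟩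
        rw [reorder_header hy, rank_append, rank_append, hlen' _ hl, ht] at h₁
        rw [reorder_header hy, rank_append, rank_append, hlen' _ hu, ht] at h₂
        omega
  · have : M'.acc x = (header x ++ ·) '' M.acc x := by
      ext w
      simp [hacc', eq_comm]
    rw [hf, NTM.numAcc, NTM.numAcc, this,
      Set.ncard_image_of_injective _ (List.append_right_injective _)]

/-! ### Padding the computation paths -/

/-- The padded version of a guess sequence: each bit is followed by `100`. -/
def padCode (y : List Bool) : List Bool := y.flatMap fun b => [b, true, false, false]

/-- The first bits of the blocks of length four. -/
def firsts : List Bool → List Bool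
  | a :: _ :: _ :: _ :: l => a :: firsts l
  | _ => []

theorem padCode_cons (b : Bool) (y : List Bool) :
    padCode (b :: y) = b :: true :: false :: false :: padCode y := rfl

theorem length_padCode (y : List Bool) : (padCode y).length = 4 * y.length := by
  induction y with
  | nil => rfl
  | cons b y ih => rw [padCode_cons]; simp [ih]; ring

theorem length_firsts (w : List Bool) : (firsts w).length = w.length / 4 := by
  fun_induction firsts w with
  | case1 a b c d l ih => simp [ih]; omega
  | case2 l h =>
    obtain _ | ⟨a, _ | ⟨b, _ | ⟨c, _ | ⟨d, l⟩⟩⟩⟩ := l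
    · simp
    · simp
    · simp
    · simp
    · exact absurd rfl (h a b c d l)

/-- At most three trailing zeros do not complete a block of four, so they contribute no bit. -/
theorem firsts_padCode_append (y : List Bool) {j : ℕ} (hj : j ≤ 3) :
    firsts (padCode y ++ List.replicate j false) = y := by
  induction y with
  | nil => interval_cases j <;> rfl
  | cons b y ih => rw [padCode_cons]; simp [firsts, ih]

section Pad

variable {K : Type} [DecidableEq K] {Γ : K → Type} {Λ σ : Type}

/-- When the host has the same stacks there is no frame, and `Extends` determines the whole
configuration. -/
theorem stepAux_embed_self {Λ' ρ : Type} (j : Λ → Λ') (ret : Option Λ') (q : TM2.Stmt Γ Λ σ) (v : σ)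
    (r : ρ) (S : ∀ k, List (Γ k)) :
    TM2.stepAux (embed (Γ' := Γ) (fun k => k) (Equiv.refl (σ × ρ)) j ret q) (v, r) S =
      ⟨((TM2.stepAux q v S).l.map j).or ret, ((TM2.stepAux q v S).var, r),
        (TM2.stepAux q v S).stk⟩ := by
  have h := extends_stepAux (ι := fun k : K => k) (E := Equiv.refl (σ × ρ)) (j := j) (ret := ret)
    (r := r) (F := S) (fun _ _ h => h) q v S S (fun _ => rfl) fun _ _ => rfl
  have h₁ := h.label
  have h₂ := h.var
  have h₃ := funext h.stk
  rcases hd : TM2.stepAux (embed (Γ' := Γ) (fun k => k) (Equiv.refl (σ × ρ)) j ret q) (v, r) S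
    with ⟨dl, dv, dS⟩
  change TM2.stepAux _ ((Equiv.refl (σ × ρ)).symm (v, r)) S = _ at hd
  rw [hd] at h₁ h₂ h₃
  dsimp only at h₁ h₂ h₃
  rw [h₁, h₂, h₃]
  rfl

variable (m : Λ → TM2.Stmt Γ Λ σ) (alt : Λ → Option (TM2.Stmt Γ Λ σ)) (accepts : σ → Bool)

/-- The labels of the padding machine: `inr (t, i)` stands for `i + 1` guesses to come, after which
the computation ends (if `t = none`) or the simulation goes on at `t`. -/
abbrev PadLabel (Λ : Type) : Type := Λ ⊕ (Option (Option Λ) × Fin 3)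

/-- The label at which the computation continues after three padding guesses. -/
def padDest : Option (Option Λ) → Option (PadLabel Λ)
  | none => none
  | some none => some (.inr (none, 2))
  | some (some l) => some (.inl l)

/-- The expected padding bits. -/
def padBit (t : Option (Option Λ)) : Bool := t.isSome

/-- One padding guess. -/
def padGuess (g : Bool) : Option (Option Λ) × Fin 3 → TM2.Stmt Γ (PadLabel Λ) (σ × Bool)
  | (t, 2) => .load (fun v => (v.1, v.2 && g == padBit t)) (.goto fun _ => .inr (t, 1))
  | (t, 1) => .load (fun v => (v.1, v.2 && !g)) (.goto fun _ => .inr (t, 0))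
  | (t, 0) => .load (fun v => (v.1, v.2 && !g)) (match padDest t with
    | none => .halt
    | some l => .goto fun _ => l)

/-- A guessing statement of the simulated machine. -/
def padEmbed (q : TM2.Stmt Γ Λ σ) : TM2.Stmt Γ (PadLabel Λ) (σ × Bool) :=
  embed (Γ' := Γ) (fun k => k) (Equiv.refl _) (fun l => .inr (some (some l), 2))
    (some (.inr (some none, 2))) q

/-- Simulate the given machine, with three additional guesses after each guess and at the end. -/
def padProg : PadLabel Λ → TM2.Stmt Γ (PadLabel Λ) (σ × Bool)
  | .inl l => match alt l with
    | none => embed (Γ' := Γ) (fun k => k) (Equiv.refl _) Sum.inl (some (.inr (none, 2))) (m l)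
    | some _ => padEmbed (m l)
  | .inr t => padGuess false t

/-- The statements of the padding machine for guess `1`. -/
def padAlt : PadLabel Λ → Option (TM2.Stmt Γ (PadLabel Λ) (σ × Bool))
  | .inl l => (alt l).map padEmbed
  | .inr t => some (padGuess true t)

/-- The verdict of the padding machine. -/
def padAccepts (v : σ × Bool) : Bool := v.2 && accepts v.1

variable {m alt accepts} {v : σ} {S : ∀ k, List (Γ k)} {B : ℕ}

theorem padGuess_ite (b : Bool) (t : Option (Option Λ) × Fin 3) :
    (if b then padGuess true t else padGuess false t :
      TM2.Stmt Γ (PadLabel Λ) (σ × Bool)) = padGuess b t := by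
  cases b <;> rfl

theorem stepAux_padGuess_zero (g : Bool) (t : Option (Option Λ)) (v : σ) (f : Bool)
    (S : ∀ k, List (Γ k)) :
    TM2.stepAux (padGuess g (t, 0)) (v, f) S = ⟨padDest t, (v, f && !g), S⟩ := by
  simp only [padGuess, TM2.stepAux]
  cases padDest t <;> rfl

theorem outcome_pad (t : Option (Option Λ)) (f : Bool) (w : List Bool) (a : Bool) :
    Outcome (padProg m alt) (padAlt alt) (padAccepts accepts) ⟨some (.inr (t, 2)), (v, f), S⟩ w a ↔
      ∃ b₁ b₂ b₃ w', w = b₁ :: b₂ :: b₃ :: w' ∧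
        Outcome (padProg m alt) (padAlt alt) (padAccepts accepts)
          ⟨padDest t, (v, f && decide ([b₁, b₂, b₃] = [padBit t, false, false])), S⟩ w' a := by
  have h₁ : ∀ (i : Fin 3) (f : Bool) (w : List Bool), Outcome (padProg m alt) (padAlt alt)
      (padAccepts accepts) ⟨some (.inr (t, i)), (v, f), S⟩ w a ↔ ∃ b w', w = b :: w' ∧
      Outcome (padProg m alt) (padAlt alt) (padAccepts accepts)
        (TM2.stepAux (padGuess b (t, i)) (v, f) S) w' a := by
    intro i f w
    rw [outcome_guess rfl]
    exact exists_congr fun b => exists_congr fun w' => and_congr_right fun _ => iff_of_eq <|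
      congrArg (fun q => Outcome _ _ _ (TM2.stepAux q (v, f) S) w' a) (padGuess_ite b (t, i))
  have h₂ : ∀ b₁ b₂ b₃ : Bool, decide ([b₁, b₂, b₃] = [padBit t, false, false]) =
      ((b₁ == padBit t) && (!b₂ && !b₃)) := by
    intro b₁ b₂ b₃
    cases b₁ <;> cases b₂ <;> cases b₃ <;> cases padBit t <;> rfl
  simp only [h₂, ← Bool.and_assoc]
  rw [h₁ 2]
  simp only [padGuess, TM2.stepAux]
  simp only [h₁ 1]
  simp only [padGuess, TM2.stepAux]
  simp only [h₁ 0, stepAux_padGuess_zero]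
  constructor
  · rintro ⟨b₁, _, rfl, b₂, _, rfl, b₃, w', rfl, h⟩
    exact ⟨b₁, b₂, b₃, w', rfl, h⟩
  · rintro ⟨b₁, b₂, b₃, w', rfl, h⟩
    exact ⟨b₁, _, rfl, b₂, _, rfl, b₃, w', rfl, h⟩

theorem bounded_pad (t : Option (Option Λ)) (f : Bool)
    (h : ∀ f', Bounded (padProg m alt) (padAlt alt) ⟨padDest t, (v, f'), S⟩ B) :
    Bounded (padProg m alt) (padAlt alt) ⟨some (.inr (t, 2)), (v, f), S⟩ (B + 3) := by
  have h₁ : ∀ (i : Fin 3) (f : Bool) (B : ℕ), (∀ b, Bounded (padProg m alt) (padAlt alt)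
      (TM2.stepAux (padGuess b (t, i)) (v, f) S) B) →
      Bounded (padProg m alt) (padAlt alt) ⟨some (.inr (t, i)), (v, f), S⟩ (B + 1) := by
    intro i f B h
    rw [bounded_guess rfl]
    intro b
    have := h b
    rw [← padGuess_ite] at this
    exact this
  refine h₁ 2 f (B + 2) fun b₁ => ?_
  simp only [padGuess, TM2.stepAux]
  refine h₁ 1 _ (B + 1) fun b₂ => ?_
  simp only [padGuess, TM2.stepAux]
  refine h₁ 0 _ B fun b₃ => ?_
  rw [stepAux_padGuess_zero]
  exact h _

theorem padDest_some (o : Option Λ) : padDest (some o) = (o.map Sum.inl).or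
    (some (.inr (none, 2))) := by
  cases o <;> rfl

/-- Every guess of the original machine is followed by three more, with `100` expected, and the end
by another three, with `000` expected. `firsts` recovers the simulated guesses from any guess
sequence, right or wrong; wrong padding only clears the flag. One step thus costs at most four, and
the end costs three. -/
theorem outcome_padProg {c : TM2.Cfg Γ Λ σ} (hB : Bounded m alt c B) (f : Bool) :
    Bounded (padProg m alt) (padAlt alt) ⟨padDest (some c.l), (c.var, f), c.stk⟩ (4 * B + 3) ∧
    ∀ w' a', Outcome (padProg m alt) (padAlt alt) (padAccepts accepts)
        ⟨padDest (some c.l), (c.var, f), c.stk⟩ w' a' ↔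
      ∃ w a, Outcome m alt accepts c w a ∧ w'.length = 4 * w.length + 3 ∧ firsts w' = w ∧
        a' = (f && a && decide (w' = padCode w ++ List.replicate 3 false)) := by
  induction B generalizing c f with
  | zero =>
    obtain ⟨_ | l, v, S⟩ := c
    · refine ⟨bounded_pad none f fun _ => bounded_halt, fun w' a' => ?_⟩
      refine (outcome_pad none f w' a').trans ?_
      simp only [padDest, outcome_halt, padAccepts]
      constructor
      · rintro ⟨b₁, b₂, b₃, _, rfl, rfl, rfl⟩
        refine ⟨[], _, ⟨rfl, rfl⟩, rfl, rfl, ?_⟩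
        simp [padBit, padCode, List.replicate, Bool.and_right_comm]
      · rintro ⟨_, _, ⟨rfl, rfl⟩, hl, -, rfl⟩
        obtain ⟨b₁, b₂, b₃, rfl⟩ := List.length_eq_three.1 hl
        refine ⟨b₁, b₂, b₃, [], rfl, rfl, ?_⟩
        simp [padBit, padCode, List.replicate, Bool.and_right_comm]
    · exact absurd hB not_bounded_zero
  | succ B ih =>
    obtain ⟨_ | l, v, S⟩ := c
    · obtain ⟨h₁, h₂⟩ := ih (c := ⟨none, v, S⟩) bounded_halt f
      exact ⟨h₁.mono (by omega), h₂⟩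
    · change Bounded (padProg m alt) (padAlt alt) ⟨some (.inl l), (v, f), S⟩ _ ∧ ∀ w' a',
        Outcome (padProg m alt) (padAlt alt) (padAccepts accepts) ⟨some (.inl l), (v, f), S⟩ w' a' ↔ _
      cases hl : alt l with
      | none =>
        have hl' : padAlt alt (.inl l) = none := by rw [padAlt, hl]; rfl
        have hm : padProg m alt (.inl l) = embed (Γ' := Γ) (fun k => k) (Equiv.refl _) Sum.inl
          (some (.inr (none, 2))) (m l) := by rw [padProg, hl]
        rw [bounded_det hl] at hB
        obtain ⟨h₁, h₂⟩ := ih hB f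
        rw [padDest_some] at h₁ h₂
        refine ⟨Bounded.mono ((bounded_det (B := 4 * B + 3) hl').2 ?_) (by omega), fun w a' => ?_⟩
        · rw [hm, stepAux_embed_self]
          exact h₁
        · refine (outcome_det hl').trans ?_
          simp only [outcome_det hl]
          rw [hm, stepAux_embed_self]
          exact h₂ w a'
      | some s =>
        have hl' : padAlt alt (.inl l) = some (padEmbed s) := by rw [padAlt, hl]; rfl
        have hm : ∀ b : Bool, (if b then padEmbed s else padProg m alt (.inl l)) =
            padEmbed (if b then s else m l) := by
          intro b; cases b
          · simp [padProg, hl]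
          · rfl
        have hstep : ∀ (b : Bool), TM2.stepAux
            (if b then padEmbed s else padProg m alt (.inl l)) (v, f) S =
            ⟨some (.inr (some (TM2.stepAux (if b then s else m l) v S).l, 2)),
              ((TM2.stepAux (if b then s else m l) v S).var, f),
              (TM2.stepAux (if b then s else m l) v S).stk⟩ := by
          intro b
          rw [hm, padEmbed, stepAux_embed_self]
          cases (TM2.stepAux (if b then s else m l) v S).l <;> rfl
        rw [bounded_guess hl] at hB
        have ih' := fun b f => ih (hB b) f
        refine ⟨Bounded.mono ((bounded_guess (B := 4 * B + 6) hl').2 fun b => ?_) (by omega),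
          fun w' a' => ?_⟩
        · rw [hstep]
          exact bounded_pad (B := 4 * B + 3) _ _ fun f' => (ih' b f').1
        · refine (outcome_guess hl').trans ?_
          simp only [outcome_guess hl, hstep, outcome_pad, (ih' _ _).2]
          constructor
          · rintro ⟨b, _, rfl, b₁, b₂, b₃, w', rfl, w, a, h, hlen, rfl, rfl⟩
            refine ⟨b :: firsts w', a, ⟨b, _, rfl, h⟩, by simp [hlen]; ring, rfl, ?_⟩
            rw [padCode_cons, Bool.eq_iff_iff]
            simp only [padBit, Option.isSome_some, Bool.and_eq_true, decide_eq_true_iff,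
              List.cons_append, List.cons.injEq, true_and, and_true]
            tauto
          · rintro ⟨_, a, ⟨b, w, rfl, h⟩, hlen, hw, rfl⟩
            obtain _ | ⟨b₀, _ | ⟨b₁, _ | ⟨b₂, _ | ⟨b₃, w'⟩⟩⟩⟩ := w'
            · simp at hlen
            · simp at hlen
            · simp at hlen
            · simp at hlen
            · obtain ⟨rfl, rfl⟩ : b₀ = b ∧ firsts w' = w := by simpa [firsts] using hw
              refine ⟨b₀, _, rfl, b₁, b₂, b₃, w', rfl, firsts w', a, h, ?_, rfl, ?_⟩
              · simp at hlen; omega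
              · rw [padCode_cons, Bool.eq_iff_iff]
                simp only [padBit, Option.isSome_some, Bool.and_eq_true, decide_eq_true_iff,
                  List.cons_append, List.cons.injEq, true_and, and_true]
                tauto

end Pad

/-- From `M` one gets a machine with padded computation paths. -/
theorem exists_ntm_pad {M : NTM} (hM : M.IsPolyTime) {p : ℕ → ℕ} (hp : M.IsBalanced p) :
    ∃ M' : NTM, M'.IsPolyTime ∧ M'.IsBalanced (fun n => 4 * p n + 3) ∧
      ∀ x w, w ∈ M'.acc x ↔ ∃ y ∈ M.acc x, w = padCode y ++ List.replicate 3 false := by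
  obtain ⟨q, hq⟩ := NTM.isPolyTime_iff.1 hM
  have key := fun x => outcome_padProg (accepts := M.accepts) (hq x) true
  obtain ⟨M', h₁, h₂, h₃⟩ := exists_ntm M.tm.k₀ (.inl M.tm.main) (M.tm.initialState, true)
    (padProg M.tm.m M.alt) (padAlt M.alt) (padAccepts M.accepts) M.inputAlphabet
    (4 * q + 3) fun x => by
      rw [show (4 * q + 3).eval x.length = 4 * q.eval x.length + 3 by simp]
      exact (key x).1
  refine ⟨M', h₁, fun x => ?_, fun x w => ?_⟩
  · ext w
    rw [h₂]
    refine (exists_congr fun a => (key x).2 w a).trans ?_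
    change _ ↔ w.length = _
    constructor
    · rintro ⟨_, y, a, hy, hlen, -⟩
      have : y ∈ strings (p x.length) := by rw [← hp x]; exact NTM.mem_paths.2 ⟨a, hy⟩
      rw [hlen, show y.length = _ from this]
    · intro hw
      -- A string of length `4 * p + 3` contains exactly `p` complete blocks, so its first bits form
      -- a path of `M`; this gives all strings of that length as paths.
      have : firsts w ∈ M.paths x := by
        rw [hp x]
        change (firsts w).length = _
        rw [length_firsts, hw]
        dsimp only; omega
      obtain ⟨a, ha⟩ := NTM.mem_paths.1 this
      exact ⟨_, _, a, ha, by rw [length_firsts, hw]; dsimp only; omega, rfl, rfl⟩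
  · rw [h₃]
    refine ((key x).2 w true).trans ?_
    simp only [NTM.mem_acc]
    constructor
    · rintro ⟨y, a, hy, hlen, -, h⟩
      simp only [Bool.true_and, eq_comm (a := true), Bool.and_eq_true, decide_eq_true_iff] at h
      obtain ⟨rfl, rfl⟩ := h
      exact ⟨y, hy, rfl⟩
    · rintro ⟨y, hy, rfl⟩
      exact ⟨y, true, hy, by simp [length_padCode], firsts_padCode_append y le_rfl, by simp⟩

/-! ### Computing the number of guesses -/

section Clock

variable (M : NTM)

/-- Pop a symbol from each of the given stacks, and set the flag if there was one. -/
def popAll {K Λ σ : Type} {Γ : K → Type} (q : TM2.Stmt Γ Λ (σ × Bool)) :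
    List K → TM2.Stmt Γ Λ (σ × Bool)
  | [] => q
  | k :: l => .pop k (fun v o => (v.1, v.2 || o.isSome)) (popAll q l)

/-- Since no stack is listed twice, each pop sees the original content of its stack, and the flag
reports whether any of them was nonempty. -/
theorem stepAux_popAll {K Λ σ : Type} [DecidableEq K] {Γ : K → Type} (q : TM2.Stmt Γ Λ (σ × Bool))
    {L : List K} (hL : L.Nodup) (v : σ) (f : Bool) (S : ∀ k, List (Γ k)) :
    TM2.stepAux (popAll q L) (v, f) S =
      TM2.stepAux q (v, f || L.any fun k => !(S k).isEmpty)
        fun k => if k ∈ L then (S k).tail else S k := by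
  induction L generalizing f S with
  | nil => simp [popAll]
  | cons k L ih =>
    obtain ⟨hk, hL⟩ := List.nodup_cons.1 hL
    rw [popAll, TM2.stepAux, ih hL]
    have h₁ : ∀ k' ∈ L, Function.update S k (S k).tail k' = S k' := fun k' hk' =>
      Function.update_of_ne (by rintro rfl; exact hk hk') _ _
    congr 2
    · rw [List.any_cons, ← Bool.or_assoc]
      congr 1
      · cases S k <;> rfl
      · rw [Bool.eq_iff_iff, List.any_eq_true, List.any_eq_true]
        exact exists_congr fun k' => and_congr_right fun hk' => by rw [h₁ k' hk']
    · funext k'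
      by_cases hk' : k' = k
      · subst hk'; simp [hk]
      · simp [hk']

/-- Simulate `M` with all guesses `0`, count the guesses, and clean up. -/
noncomputable def clockProg : M.tm.Λ ⊕ Unit →
    TM2.Stmt (sumFam M.tm.Γ (fun _ : Unit => Bool)) (M.tm.Λ ⊕ Unit) (M.tm.σ × Bool)
  | .inl l => match M.alt l with
    | none => embed (Γ' := sumFam M.tm.Γ (fun _ : Unit => Bool)) Sum.inl (Equiv.refl _) Sum.inl
        (some (.inr ())) (M.tm.m l)
    | some _ => .push (.inr ()) (fun _ => false) <|
        embed (Γ' := sumFam M.tm.Γ (fun _ : Unit => Bool)) Sum.inl (Equiv.refl _) Sum.inl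
          (some (.inr ())) (M.tm.m l)
  | .inr () => popAll (.branch (fun v => v.2) (.load (fun v => (v.1, false)) (.goto fun _ => .inr ()))
      (.load (fun _ => (M.tm.initialState, false)) .halt)) ((Finset.univ : Finset M.tm.K).toList.map Sum.inl)

variable {M}

/-- The statement `tm.m l` is the one for guess `0`, so the run follows a single path of `M`. The
counter lies in the frame of the embedding, which is why `F` and `n` vary in the induction. -/
theorem clockProg_simulate {c : TM2.Cfg M.tm.Γ M.tm.Λ M.tm.σ} {B n : ℕ}
    {F : ∀ k, List (sumFam M.tm.Γ (fun _ : Unit => Bool) k)}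
    {d : TM2.Cfg (sumFam M.tm.Γ (fun _ : Unit => Bool)) (M.tm.Λ ⊕ Unit) (M.tm.σ × Bool)}
    (hB : Bounded M.tm.m M.alt c B)
    (hd : Extends (Γ' := sumFam M.tm.Γ (fun _ : Unit => Bool)) Sum.inl (Equiv.refl _) Sum.inl
      (some (.inr ())) false F c d) (hF : F (.inr ()) = List.replicate n false) :
    ∃ t ≤ B, ∃ w a, Outcome M.tm.m M.alt M.accepts c w a ∧ ∃ (v : M.tm.σ)
      (S : ∀ k, List (sumFam M.tm.Γ (fun _ : Unit => Bool) k)),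
      Reach (clockProg M) d t ⟨some (.inr ()), (v, false), S⟩ ∧
      S (.inr ()) = List.replicate (w.length + n) false := by
  induction B generalizing c d n F with
  | zero =>
    obtain ⟨_ | l, v, S⟩ := c
    · obtain ⟨dl, dv, dS⟩ := d
      obtain ⟨hl, hv, -, hf⟩ := hd
      dsimp at hl hv hf
      subst hl hv
      refine ⟨0, le_rfl, [], _, outcome_halt.2 ⟨rfl, rfl⟩, _, dS, .refl _, ?_⟩
      rw [hf _ (by simp), hF]; simp
    · exact absurd hB not_bounded_zero
  | succ B ih =>
    obtain ⟨_ | l, v, S⟩ := c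
    · obtain ⟨t, ht, h⟩ := ih (c := ⟨none, v, S⟩) bounded_halt hd hF
      exact ⟨t, ht.trans (Nat.le_succ B), h⟩
    · rw [hd.eq_mk]
      cases hl : M.alt l with
      | none =>
        rw [bounded_det hl] at hB
        have hstep := extends_stepAux (ι := Sum.inl) (E := Equiv.refl (M.tm.σ × Bool))
          (j := Sum.inl) (ret := some (.inr ())) (r := false) (F := F)
          Sum.inl_injective (M.tm.m l) v S d.stk hd.stk hd.frame
        obtain ⟨t, ht, w, a, hw, v', S', h₁, h₂⟩ := ih hB hstep hF
        refine ⟨t + 1, by omega, w, a, (outcome_det hl).2 hw, v', S', .step ?_, h₂⟩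
        have hm : clockProg M (.inl l) = embed (Γ' := sumFam M.tm.Γ (fun _ : Unit => Bool)) Sum.inl
          (Equiv.refl _) Sum.inl (some (.inr ())) (M.tm.m l) := by rw [clockProg, hl]
        rw [hm]
        exact h₁
      | some s =>
        rw [bounded_guess hl] at hB
        have hstep := extends_stepAux (ι := Sum.inl) (E := Equiv.refl (M.tm.σ × Bool))
          (j := Sum.inl) (ret := some (.inr ())) (r := false)
          (F := Function.update F (.inr ()) (false :: F (.inr ())))
          Sum.inl_injective (M.tm.m l) v S (Function.update d.stk (.inr ()) (false :: d.stk (.inr ())))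
          (fun k => by rw [Function.update_of_ne (by simp)]; exact hd.stk k)
          (fun k hk => by
            rcases k with k | k
            · exact absurd ⟨k, rfl⟩ hk
            · rw [Function.update_self, Function.update_self, hd.frame _ hk])
        obtain ⟨t, ht, w, a, hw, v', S', h₁, h₂⟩ := ih (n := n + 1) (hB false) hstep (by
          rw [Function.update_self, hF]; rfl)
        refine ⟨t + 1, by omega, false :: w, a, (outcome_guess hl).2 ⟨false, w, rfl, hw⟩, v', S',
          .step ?_, by rw [h₂, List.length_cons, Nat.add_right_comm, Nat.add_assoc]⟩
        have hm : clockProg M (.inl l) = .push (.inr ()) (fun _ => false)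
          (embed (Γ' := sumFam M.tm.Γ (fun _ : Unit => Bool)) Sum.inl
            (Equiv.refl _) Sum.inl (some (.inr ())) (M.tm.m l)) := by rw [clockProg, hl]
        rw [hm]
        exact h₁

/-- Remove the top symbols of all stacks of `M`. -/
def popStacks (S : ∀ k, List (sumFam M.tm.Γ (fun _ : Unit => Bool) k)) :
    ∀ k, List (sumFam M.tm.Γ (fun _ : Unit => Bool) k)
  | .inl k => (S (.inl k)).tail
  | .inr k => S (.inr k)

/-- The flag refers to the stacks before the pops, so one more round on empty stacks is needed to
notice the end; that round also restores the initial state. -/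
theorem stepAux_clean (v : M.tm.σ) (S : ∀ k, List (sumFam M.tm.Γ (fun _ : Unit => Bool) k)) :
    TM2.stepAux (clockProg M (.inr ())) (v, false) S =
      if ∀ k, S (.inl k) = [] then
        ⟨none, (M.tm.initialState, false), single (.inr ()) (S (.inr ()))⟩
      else ⟨some (.inr ()), (v, false), popStacks S⟩ := by
  have hnodup : ((Finset.univ : Finset M.tm.K).toList.map
      (Sum.inl : M.tm.K → M.tm.K ⊕ Unit)).Nodup :=
    (Finset.nodup_toList _).map Sum.inl_injective
  rw [clockProg, stepAux_popAll _ hnodup]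
  have h : ((Finset.univ : Finset M.tm.K).toList.map (Sum.inl : M.tm.K → M.tm.K ⊕ Unit)).any
      (fun k => !(S k).isEmpty) = true ↔ ¬ ∀ k, S (.inl k) = [] := by
    simp
  -- The membership test comes with a decidability instance fixed elsewhere, so the equation is
  -- stated for every instance.
  have hS : ∀ D : DecidablePred fun k => k ∈ (Finset.univ : Finset M.tm.K).toList.map
      (Sum.inl : M.tm.K → M.tm.K ⊕ Unit), (fun k => @ite _ _ (D k) (S k).tail (S k)) =
        popStacks S := by
    intro D
    funext k
    rcases k with k | k <;> simp [popStacks]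
  rw [hS]
  split_ifs with h'
  · rw [Bool.eq_false_iff.2 fun h'' => h.1 h'' h']
    simp only [TM2.stepAux, Bool.false_or, cond_false]
    congr 1
    refine eq_single rfl ?_
    rintro (k | k) hk
    · exact (congrArg List.tail (h' k)).trans rfl
    · exact absurd rfl hk
  · rw [h.2 h']
    rfl

theorem clockProg_clean (n : ℕ) (v : M.tm.σ)
    (S : ∀ k, List (sumFam M.tm.Γ (fun _ : Unit => Bool) k))
    (hS : ∀ k, (S (.inl k)).length ≤ n) :
    ∃ t ≤ n + 1, Reach (clockProg M) ⟨some (.inr ()), (v, false), S⟩ t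
      ⟨none, (M.tm.initialState, false), single (.inr ()) (S (.inr ()))⟩ := by
  induction n generalizing S with
  | zero =>
    refine ⟨1, le_rfl, .step ?_⟩
    rw [stepAux_clean, if_pos fun k => List.length_eq_zero_iff.1 (Nat.le_zero.1 (hS k))]
    exact .refl _
  | succ n ih =>
    by_cases h : ∀ k, S (.inl k) = []
    · refine ⟨1, by omega, .step ?_⟩
      rw [stepAux_clean, if_pos h]
      exact .refl _
    · obtain ⟨t, ht, hr⟩ := ih (popStacks S) fun k => by
          have := hS k
          simp only [popStacks, List.length_tail]
          omega
      refine ⟨t + 1, by omega, .step ?_⟩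
      rw [stepAux_clean, if_neg h]
      exact hr

end Clock

/-- Nothing is known about the coefficients of `p`, but each path of the balanced machine has
exactly `p(|x|)` guesses. Following the path of zeros and counting guesses writes this number in
unary. -/
theorem pt_replicate_of_isBalanced {M : NTM} (hM : M.IsPolyTime) {p : ℕ → ℕ}
    (hp : M.IsBalanced p) :
    PT (fun x : List Bool => x) fun x => List.replicate (p x.length) false := by
  obtain ⟨q, hq⟩ := NTM.isPolyTime_iff.1 hM
  have : Fintype (sumFam M.tm.Γ (fun _ : Unit => Bool) (.inl M.tm.k₀)) :=
    Fintype.ofEquiv _ M.inputAlphabet.symm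
  set C := ∑ l, pushes (clockProg M l)
  refine PT.intro (.inl M.tm.k₀) (.inr ()) (.inl M.tm.main) (M.tm.initialState, false)
    (clockProg M) M.inputAlphabet (Equiv.refl Bool)
    -- The simulation takes at most `q` steps. Afterwards no stack is higher than the input length
    -- plus `q * C`, and cleaning takes that many rounds and one more.
    (q + (Polynomial.X + q * Polynomial.C C + 1)) fun x => ?_
  obtain ⟨t, ht, w, a, hw, v, S, hr, hS⟩ := clockProg_simulate (n := 0) (F := fun _ => []) (hq x)
    (d := ⟨some (.inl M.tm.main), (M.tm.initialState, false),
      single (.inl M.tm.k₀) (x.map M.inputAlphabet.symm)⟩)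
    ⟨rfl, rfl, fun k => by
      by_cases hk : k = M.tm.k₀
      · subst hk
        exact (single_same _ _).trans (single_same M.tm.k₀ (x.map M.inputAlphabet.symm)).symm
      · exact (single_of_ne (by simpa using hk) _).trans
          (single_of_ne hk (x.map M.inputAlphabet.symm)).symm, fun k hk => by
      rcases k with k | k
      · exact absurd ⟨k, rfl⟩ hk
      · exact single_of_ne (k := Sum.inl M.tm.k₀) (k' := Sum.inr k) (by simp)
          (x.map M.inputAlphabet.symm)⟩ rfl
  have hlen : w.length = p x.length := by
    have : w ∈ strings (p x.length) := by rw [← hp x]; exact NTM.mem_paths.2 ⟨a, hw⟩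
    exact this
  obtain ⟨t', ht', hr'⟩ := clockProg_clean (x.length + q.eval x.length * C) v S fun k => by
    have h₁ := hr.length_le (.inl k)
    refine h₁.trans (Nat.add_le_add ?_ (Nat.mul_le_mul_right _ ht))
    by_cases hk : k = M.tm.k₀
    · subst hk
      simp [single_same]
    · exact le_of_eq_of_le (congrArg List.length (single_of_ne (by simpa using hk) _))
        (Nat.zero_le _)
  refine ⟨t + t', ?_, ?_⟩
  · simp only [Polynomial.eval_add, Polynomial.eval_X, Polynomial.eval_mul, Polynomial.eval_C,
      Polynomial.eval_one]
    exact Nat.add_le_add ht ht'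
  · have := hr.trans hr'
    rw [hS, hlen, Nat.add_zero] at this
    rw [show (List.replicate (p x.length) false).map (Equiv.refl Bool).symm =
      List.replicate (p x.length) false by simp]
    exact this

/-! ### Length-respecting orders have order type `ℕ` -/

section OrderRank

variable {A : List Bool → List Bool → Prop}

theorem StrictPart.trans (hA : IsLinearOrder (List Bool) A) {s t u : List Bool}
    (h₁ : StrictPart A s t) (h₂ : StrictPart A t u) : StrictPart A s u := by
  refine ⟨hA.trans _ _ _ h₁.1 h₂.1, ?_⟩
  rintro rfl
  exact h₁.2 (hA.antisymm _ _ h₁.1 h₂.1)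

theorem strictPart_of_not (hA : IsLinearOrder (List Bool) A) {s t : List Bool} (h : ¬ A s t) :
    StrictPart A t s := by
  refine ⟨(hA.total s t).resolve_left h, ?_⟩
  rintro rfl
  exact h (hA.refl _)

theorem not_of_strictPart (hA : IsLinearOrder (List Bool) A) {s t : List Bool}
    (h : StrictPart A s t) : ¬ A t s :=
  fun h' => h.2 (hA.antisymm _ _ h.1 h')

theorem finite_strictPart (hA : IsLinearOrder (List Bool) A) (hl : LengthRespecting A)
    (v : List Bool) : {w | StrictPart A w v}.Finite := by
  refine (List.finite_length_le Bool v.length).subset fun w hw => ?_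
  by_contra h
  exact not_of_strictPart hA hw (hl v w (not_le.1 h)).1

/-- The rank counts the strict predecessors, which are finite in number because none is longer than
the given string. It takes all values: passing to the least string above `v` adds exactly `v` to the
set of predecessors. -/
theorem exists_rank (hA : IsLinearOrder (List Bool) A) (hl : LengthRespecting A) :
    ∃ r : List Bool → ℕ, Function.Bijective r ∧ A = fun s t => r s ≤ r t := by
  set r : List Bool → ℕ := fun v => {w | StrictPart A w v}.ncard with hr
  have hlt : ∀ {s t}, StrictPart A s t → r s < r t := by
    intro s t h
    refine Set.ncard_lt_ncard ⟨fun w hw => StrictPart.trans hA hw h, fun h' => ?_⟩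
      (finite_strictPart hA hl t)
    exact (h' h).2 rfl
  have hle : ∀ s t, A s t ↔ r s ≤ r t := by
    intro s t
    constructor
    · intro h
      by_cases hst : s = t
      · rw [hst]
      · exact (hlt ⟨h, hst⟩).le
    · intro h
      by_contra h'
      exact absurd (hlt (strictPart_of_not hA h')) h.not_gt
  refine ⟨r, ⟨fun s t h => hA.antisymm _ _ ((hle _ _).2 h.le) ((hle _ _).2 h.ge), fun n => ?_⟩,
    funext fun s => funext fun t => propext (hle s t)⟩
  induction n with
  | zero =>
    -- The empty string is the least element, since any other string is longer.
    refine ⟨[], (Set.ncard_eq_zero (finite_strictPart hA hl _)).2 ?_⟩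
    ext w
    refine iff_of_false (fun h => ?_) id
    exact not_of_strictPart hA h (hl [] w (List.length_pos_iff.2 h.2)).1
  | succ n ih =>
    obtain ⟨v, hv⟩ := ih
    have hne : {w | StrictPart A v w}.Nonempty :=
      ⟨List.replicate (v.length + 1) false, hl _ _ (by simp)⟩
    obtain ⟨w, hw, hmin⟩ := WellFounded.has_min (measure r).wf _ hne
    refine ⟨w, ?_⟩
    have : {u | StrictPart A u w} = insert v {u | StrictPart A u v} := by
      ext u
      constructor
      · intro hu
        by_contra h
        have hvu : StrictPart A v u := by
          refine ⟨(hA.total u v).resolve_left fun h' => h ?_, fun h' => h (.inl h'.symm)⟩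
          by_cases huv : u = v
          · exact .inl huv
          · exact .inr ⟨h', huv⟩
        exact hmin u hvu (hlt hu)
      · rintro (rfl | h)
        · exact hw
        · exact StrictPart.trans hA h hw
    change {u | StrictPart A u w}.ncard = _
    rw [this, Set.ncard_insert_of_notMem (fun h => h.2 rfl) (finite_strictPart hA hl v)]
    exact congrArg (· + 1) hv

end OrderRank

/-! ### Labelled strings -/

/-- Each bit is followed by `0`. -/
def spread (y : List Bool) : List Bool := y.flatMap fun b => [b, false]

/-- The bits at the even positions. -/
def unspread (s : List Bool) : List Bool :=
  transduce (fun q _ => !q) (fun q b => if q then [b] else []) (fun _ => []) true s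

/-- The string that is padded in the given string. -/
def padPart (s : List Bool) : List Bool :=
  transduce (fun (q : Fin 4 × Bool) b => (q.1 + 1, b)) (fun q b => if q.1 = 1 ∧ b then [q.2] else [])
    (fun _ => []) (0, false) s

theorem length_spread (y : List Bool) : (spread y).length = 2 * y.length := by
  simp [spread, mul_comm]

theorem unspread_spread (y : List Bool) : unspread (spread y) = y := by
  induction y with
  | nil => rfl
  | cons b y ih => exact congrArg (b :: ·) ih

/-- The state holds the position modulo four and the last bit read. A marker `1` at position one
releases the stored bit; the final zeros contain no marker. -/
theorem padPart_padCode_append (y : List Bool) (j : ℕ) :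
    padPart (padCode y ++ List.replicate j false) = y := by
  have h : ∀ q, transduce (fun (q : Fin 4 × Bool) b => (q.1 + 1, b))
      (fun q b => if q.1 = 1 ∧ b then [q.2] else []) (fun _ => []) q (List.replicate j false) =
      [] := by
    induction j with
    | zero => intro q; rfl
    | succ j ih => intro q; simpa [transduce, List.replicate_succ] using ih _
  have h' : ∀ b, transduce (fun (q : Fin 4 × Bool) b => (q.1 + 1, b))
      (fun q b => if q.1 = 1 ∧ b then [q.2] else []) (fun _ => []) (0, b)
      (padCode y ++ List.replicate j false) = y := by
    induction y with
    | nil => intro b; exact h _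
    | cons c y ih =>
      intro b
      rw [padCode_cons]
      simp only [List.cons_append, transduce]
      simpa using ih _
  exact h' false

/-- A padded string, followed by zeros. -/
def IsPadded (s : List Bool) : Prop := ∃ j, s = padCode (padPart s) ++ List.replicate j false

/-- The encoding of a pair related by `J`, whose lengths differ by one. -/
def IsPair (J : List Bool → List Bool → Prop) (s : List Bool) : Prop :=
  (headerPart s).length = (true :: unspread (tailPart s)).length ∧
    J (unspread (tailPart s)) (headerPart s) ∧
    s = header (headerPart s) ++ spread (unspread (tailPart s))

open Classical in
/-- The label of a string. -/
noncomputable def label (s : List Bool) : List Bool := if IsPadded s then padPart s else headerPart s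

/-- A string which is labelled. -/
def Labelled (J : List Bool → List Bool → Prop) (s : List Bool) : Prop := IsPadded s ∨ IsPair J s

theorem isPadded_iff {s : List Bool} :
    IsPadded s ↔ ∃ y j, s = padCode y ++ List.replicate j false :=
  ⟨fun ⟨j, h⟩ => ⟨_, j, h⟩, by rintro ⟨y, j, rfl⟩; exact ⟨j, by rw [padPart_padCode_append]⟩⟩

theorem isPair_iff {J : List Bool → List Bool → Prop} {s : List Bool} :
    IsPair J s ↔ ∃ y z, z.length = y.length + 1 ∧ J y z ∧ s = header z ++ spread y := by
  constructor
  · rintro ⟨h₁, h₂, h₃⟩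
    exact ⟨_, _, h₁, h₂, h₃⟩
  · rintro ⟨y, z, h₁, h₂, rfl⟩
    simp only [IsPair, headerPart_header, tailPart_header, unspread_spread]
    exact ⟨h₁, h₂, trivial⟩

/-- The successor relation of the strings of a fixed length in which the labelled strings come
first, ordered by their labels. -/
def LabelSucc (J : List Bool → List Bool → Prop) (s t : List Bool) : Prop :=
  (Labelled J s ∧ Labelled J t ∧ J (label s) (label t)) ∨
  (IsPair J s ∧ t = lexNext (s.map fun _ => false)) ∨
  (¬ Labelled J s ∧ ¬ Labelled J t ∧
    (t = lexNext s ∨ (Labelled J (lexNext s) ∧ t = lexNext (lexNext s))))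

/-! ### Labels and their successor relation in polynomial time -/

section PolyTime

variable {I α : Type} [Fintype α] [Inhabited α] {e : I → List α} {f g : I → List Bool}
  {J : List Bool → List Bool → Prop}

theorem PD.isPadded (hf : PT e f) : PD e fun i => IsPadded (f i) :=
  PT.padded hf ((hf.transduce _ _ _ _).flatMap _) false

theorem PD.isPair (hJ : PolyTimePred₂ J) (hf : PT e f) : PD e fun i => IsPair J (f i) := by
  have hu : PT e fun i => unspread (tailPart (f i)) := hf.tailPart.transduce _ _ _ _
  exact (hf.headerPart.length_eq ((PT.const e [true]).append hu)).and
    ((hJ.pd hu hf.headerPart).and (hf.eq (hf.headerPart.header.append (hu.flatMap _))))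

theorem PD.labelled (hJ : PolyTimePred₂ J) (hf : PT e f) : PD e fun i => Labelled J (f i) :=
  (PD.isPadded hf).or (PD.isPair hJ hf)

theorem PT.label (hf : PT e f) : PT e fun i => label (f i) :=
  PT.ite (PD.isPadded hf) (hf.transduce _ _ _ _) hf.headerPart

theorem PD.labelSucc (hJ : PolyTimePred₂ J) (hf : PT e f) (hg : PT e g) :
    PD e fun i => LabelSucc J (f i) (g i) :=
  ((PD.labelled hJ hf).and ((PD.labelled hJ hg).and (hJ.pd hf.label hg.label))).or
    (((PD.isPair hJ hf).and (hg.eq (hf.map fun _ => false).lexNext)).or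
      ((PD.labelled hJ hf).not.and ((PD.labelled hJ hg).not.and
        ((hg.eq hf.lexNext).or
          ((PD.labelled hJ hf.lexNext).and (hg.eq hf.lexNext.lexNext))))))

end PolyTime

/-! ### Reordering the strings of a fixed length -/

/-- The images of `strings n` under the injective functions `key` and `rank` are finite sets of
naturals of equal size, so an order isomorphism connects them; it is transported back to strings. -/
theorem exists_reordering {n : ℕ} {key : List Bool → ℕ} (hkey : Set.InjOn key (strings n)) :
    ∃ h : List Bool → List Bool, Set.BijOn h (strings n) (strings n) ∧
      ∀ s ∈ strings n, ∀ t ∈ strings n, (rank (h s) ≤ rank (h t) ↔ key s ≤ key t) := by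
  classical
  set S := (finite_strings n).toFinset with hS
  have hmem : ∀ s, s ∈ S ↔ s ∈ strings n := fun s => (finite_strings n).mem_toFinset
  have h₁ : (S.image key).card = S.card :=
    Finset.card_image_of_injOn fun s hs t ht => hkey ((hmem s).1 hs) ((hmem t).1 ht)
  have h₂ : (S.image rank).card = S.card := Finset.card_image_of_injective _ rank_injective
  let e : S.image key ≃o S.image rank :=
    ((S.image key).orderIsoOfFin h₁).symm.trans ((S.image rank).orderIsoOfFin h₂)
  have hex : ∀ s, ∃ t, ∀ hs : s ∈ strings n, t ∈ strings n ∧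
      rank t = e ⟨key s, Finset.mem_image_of_mem _ ((hmem s).2 hs)⟩ := by
    intro s
    by_cases hs : s ∈ strings n
    · obtain ⟨t, ht, heq⟩ := Finset.mem_image.1
        (e ⟨key s, Finset.mem_image_of_mem _ ((hmem s).2 hs)⟩).2
      exact ⟨t, fun _ => ⟨(hmem t).1 ht, heq⟩⟩
    · exact ⟨s, fun hs' => absurd hs' hs⟩
  choose h hh using hex
  have hle : ∀ s ∈ strings n, ∀ t ∈ strings n, (rank (h s) ≤ rank (h t) ↔ key s ≤ key t) := by
    intro s hs t ht
    rw [(hh s hs).2, (hh t ht).2, Subtype.coe_le_coe, e.le_iff_le, ← Subtype.coe_le_coe]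
  refine ⟨h, ⟨fun s hs => (hh s hs).1, fun s hs t ht heq => hkey hs ht ?_, fun t ht => ?_⟩, hle⟩
  · exact le_antisymm ((hle s hs t ht).1 (by rw [heq])) ((hle t ht s hs).1 (by rw [heq]))
  · obtain ⟨s, hs, heq⟩ := Finset.mem_image.1
      (e.symm ⟨rank t, Finset.mem_image_of_mem _ ((hmem t).2 ht)⟩).2
    have hs' := (hmem s).1 hs
    refine ⟨s, hs', rank_injective ?_⟩
    rw [(hh s hs').2]
    simp only [heq, Subtype.coe_eta, OrderIso.apply_symm_apply]

/-! ### Successors and endpoints after reordering -/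

section Reordering

variable {n : ℕ} {key : List Bool → ℕ} {h : List Bool → List Bool}

theorem lexSucc_reordering (hbij : Set.BijOn h (strings n) (strings n))
    (hle : ∀ s ∈ strings n, ∀ t ∈ strings n, (rank (h s) ≤ rank (h t) ↔ key s ≤ key t))
    {s t : List Bool} (hs : s ∈ strings n) (ht : t ∈ strings n) :
    LexSucc (h s) (h t) ↔
      key s < key t ∧ ∀ v ∈ strings n, ¬ (key s < key v ∧ key v < key t) := by
  have hlt : ∀ s ∈ strings n, ∀ t ∈ strings n, (rank (h s) < rank (h t) ↔ key s < key t) :=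
    fun s hs t ht => by rw [← not_le, ← not_le, hle t ht s hs]
  rw [lexSucc_iff, ← hlt s hs t ht]
  constructor
  · intro heq
    refine ⟨by omega, fun v hv => ?_⟩
    rw [← hlt s hs v hv, ← hlt v hv t ht]
    omega
  · rintro ⟨h₁, h₂⟩
    by_contra hne
    -- The string `lexNext (h s)` lies between two strings of length `n`, so it has this length and
    -- is a value of `h`; its preimage violates adjacency of the keys.
    have hw : lexNext (h s) ∈ strings n := by
      have h₃ := length_le_of_rank_le (a := h s) (b := lexNext (h s)) (by rw [rank_lexNext]; omega)
      have h₄ := length_le_of_rank_le (a := lexNext (h s)) (b := h t) (by rw [rank_lexNext]; omega)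
      have h₅ : (h s).length = n := hbij.mapsTo hs
      have h₆ : (h t).length = n := hbij.mapsTo ht
      change (lexNext (h s)).length = n
      omega
    obtain ⟨v, hv, hvw⟩ := hbij.surjOn hw
    refine h₂ v hv ?_
    rw [← hlt s hs v hv, ← hlt v hv t ht, hvw, rank_lexNext]
    omega

theorem reordering_eq_replicate_false (hbij : Set.BijOn h (strings n) (strings n))
    (hle : ∀ s ∈ strings n, ∀ t ∈ strings n, (rank (h s) ≤ rank (h t) ↔ key s ≤ key t))
    {s : List Bool} (hs : s ∈ strings n) (hmin : ∀ t ∈ strings n, key s ≤ key t) :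
    h s = List.replicate n false := by
  obtain ⟨t, ht, heq⟩ := hbij.surjOn (show List.replicate n false ∈ strings n from by simp [strings])
  refine rank_injective (le_antisymm ?_ (rank_replicate_false_le (hbij.mapsTo hs)))
  rw [← heq, hle s hs t ht]
  exact hmin t ht

theorem reordering_eq_replicate_true (hbij : Set.BijOn h (strings n) (strings n))
    (hle : ∀ s ∈ strings n, ∀ t ∈ strings n, (rank (h s) ≤ rank (h t) ↔ key s ≤ key t))
    {s : List Bool} (hs : s ∈ strings n) (hmax : ∀ t ∈ strings n, key t ≤ key s) :
    h s = List.replicate n true := by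
  obtain ⟨t, ht, heq⟩ := hbij.surjOn (show List.replicate n true ∈ strings n from by simp [strings])
  refine rank_injective (le_antisymm (rank_le_replicate_true (hbij.mapsTo hs)) ?_)
  rw [← heq, hle t ht s hs]
  exact hmax t ht

end Reordering

/-! ### The labelled strings of length `4m + 3` -/

theorem label_padCode_append (y : List Bool) (j : ℕ) :
    label (padCode y ++ List.replicate j false) = y := by
  rw [label, if_pos (isPadded_iff.2 ⟨y, j, rfl⟩), padPart_padCode_append]

/-- A header starts with `1`, so the padded string would be nonempty and start with a block `b100`.
The third bit of the header of a string of length at least two is `1`, whereas for length one the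
total length is three, too short for a block. -/
theorem not_isPadded_header {y z : List Bool} {m : ℕ} (hy : y.length = m) (hz : z.length = m + 1) :
    ¬ IsPadded (header z ++ spread y) := by
  rw [isPadded_iff]
  rintro ⟨v, j, h⟩
  have hlen := congrArg List.length h
  simp only [List.length_append, length_header, length_spread, length_padCode,
    List.length_replicate, hy, hz] at hlen
  obtain _ | ⟨a, z⟩ := z
  · simp at hz
  rw [header_cons] at h
  obtain _ | ⟨b, v⟩ := v
  · obtain _ | j := j
    · simp [padCode] at h
    · simp [padCode, List.replicate_succ] at h
  · rw [padCode_cons] at h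
    obtain _ | ⟨c, z⟩ := z
    · simp at hlen hz; omega
    · rw [header_cons] at h
      simp at h

/-- `r` is a bijection to the natural numbers that enumerates the strings by increasing length, and
`z` is the first string of length `m + 1`. -/
structure RankCut (r : List Bool → ℕ) (m : ℕ) (z : List Bool) : Prop where
  bijective : Function.Bijective r
  lt_of_length_lt : ∀ s t : List Bool, s.length < t.length → r s < r t
  length_eq : z.length = m + 1
  le_of_length_eq : ∀ w : List Bool, w.length = m + 1 → r z ≤ r w

theorem exists_rankCut {r : List Bool → ℕ} (hr : Function.Bijective r)
    (hlr : ∀ s t : List Bool, s.length < t.length → r s < r t) (m : ℕ) : ∃ z, RankCut r m z := by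
  obtain ⟨z, hz, hmin⟩ := WellFounded.has_min (measure r).wf (strings (m + 1))
    ⟨List.replicate (m + 1) false, by simp [strings]⟩
  exact ⟨z, hr, hlr, hz, fun w hw => not_lt.1 (hmin w hw)⟩

/-- The successor relation of the order given by `r`. -/
def RankSucc (r : List Bool → ℕ) (y z : List Bool) : Prop := r z = r y + 1

namespace RankCut

variable {r : List Bool → ℕ} {m : ℕ} {z : List Bool}

theorem le_iff (H : RankCut r m z) {v : List Bool} : r v ≤ r z ↔ v.length ≤ m ∨ v = z := by
  have hz := H.length_eq
  constructor
  · intro h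
    by_contra! hne
    rcases lt_or_eq_of_le (Nat.succ_le_of_lt hne.1) with h' | h'
    · exact absurd (H.lt_of_length_lt z v (by omega)) h.not_gt
    · exact hne.2 (H.bijective.1 (h.antisymm (H.le_of_length_eq v h'.symm)))
  · rintro (h | rfl)
    · exact (H.lt_of_length_lt v z (by omega)).le
    · exact le_rfl

/-- If the predecessor of `z` were shorter than `m`, the string `0…0` of length `m` would lie
strictly between them. -/
theorem exists_pred (H : RankCut r m z) : ∃ y : List Bool, y.length = m ∧ r z = r y + 1 := by
  have hz := H.length_eq
  have hpos : r [] < r z := H.lt_of_length_lt _ _ (by simp [hz])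
  obtain ⟨y, hy⟩ := H.bijective.2 (r z - 1)
  refine ⟨y, ?_, by omega⟩
  have h₁ : y.length ≤ m := by
    refine (H.le_iff.1 (by omega : r y ≤ r z)).resolve_right ?_
    rintro rfl
    omega
  by_contra hne
  have h₂ := H.lt_of_length_lt y (List.replicate m false) (by simp; omega)
  have h₃ := H.lt_of_length_lt (List.replicate m false) z (by simp [hz])
  omega

/-- The total length `4m + 3` forces the lengths `m` and `m + 1`. The order crosses from the first
length to the second only once, so exactly one pair exists; deciding `IsPair` thus recognizes the
end of the segment without knowing `m` or `z`. -/
theorem exists_isPair_iff (H : RankCut r m z) : ∃ y : List Bool, y.length = m ∧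
    ∀ s : List Bool, s.length = 4 * m + 3 →
      (IsPair (RankSucc r) s ↔ s = header z ++ spread y) := by
  obtain ⟨y, hy, hyz⟩ := H.exists_pred
  have hz := H.length_eq
  refine ⟨y, hy, fun s hs => ?_⟩
  rw [isPair_iff]
  constructor
  · rintro ⟨y', z', hlen, hsucc, rfl⟩
    simp only [List.length_append, length_header, length_spread] at hs
    have h₁ : r z ≤ r z' := H.le_of_length_eq _ (by omega)
    have h₂ : r y' < r z := H.lt_of_length_lt _ _ (by omega)
    unfold RankSucc at hsucc
    obtain rfl := H.bijective.1 (by omega : r z' = r z)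
    obtain rfl := H.bijective.1 (by omega : r y' = r y)
    rfl
  · rintro rfl
    exact ⟨y, z, by omega, hyz, rfl⟩

theorem label_of_isPair (H : RankCut r m z) {s : List Bool} (hs : s.length = 4 * m + 3)
    (h : IsPair (RankSucc r) s) : label s = z := by
  obtain ⟨y, hy, hiff⟩ := H.exists_isPair_iff
  rw [hiff s hs] at h
  rw [h, label, if_neg (not_isPadded_header hy H.length_eq), headerPart_header]

theorem length_label_of_isPadded {s : List Bool} (hs : s.length = 4 * m + 3) (h : IsPadded s) :
    (label s).length ≤ m ∧
      s = padCode (label s) ++ List.replicate (4 * m + 3 - 4 * (label s).length) false := by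
  obtain ⟨y, j, rfl⟩ := isPadded_iff.1 h
  simp only [List.length_append, length_padCode, List.length_replicate] at hs
  rw [label_padCode_append]
  exact ⟨by omega, by rw [show 4 * m + 3 - 4 * y.length = j by omega]⟩

theorem label_le (H : RankCut r m z) {s : List Bool} (hs : s.length = 4 * m + 3)
    (h : Labelled (RankSucc r) s) : r (label s) ≤ r z := by
  rw [H.le_iff]
  rcases h with h | h
  · exact .inl (length_label_of_isPadded hs h).1
  · exact .inr (H.label_of_isPair hs h)

theorem isPair_of_label (H : RankCut r m z) {s : List Bool} (hs : s.length = 4 * m + 3)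
    (h : Labelled (RankSucc r) s) (hl : label s = z) : IsPair (RankSucc r) s := by
  refine h.resolve_left fun h' => ?_
  have := (length_label_of_isPadded hs h').1
  rw [hl, H.length_eq] at this
  omega

theorem exists_label (H : RankCut r m z) {v : List Bool} (hv : r v ≤ r z) :
    ∃ s : List Bool, s.length = 4 * m + 3 ∧ Labelled (RankSucc r) s ∧ label s = v := by
  rcases H.le_iff.1 hv with h | rfl
  · refine ⟨padCode v ++ List.replicate (4 * m + 3 - 4 * v.length) false, ?_,
      .inl (isPadded_iff.2 ⟨_, _, rfl⟩), label_padCode_append _ _⟩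
    simp [length_padCode]
    omega
  · obtain ⟨y, hy, hiff⟩ := H.exists_isPair_iff
    have hs : (header v ++ spread y).length = 4 * m + 3 := by
      simp [length_spread, hy, H.length_eq]
      ring
    have hp := (hiff _ hs).2 rfl
    exact ⟨_, hs, .inr hp, H.label_of_isPair hs hp⟩

/-- The label `z` has only its pair code. Any other label is a padded string, and the total length
fixes the number of final zeros. -/
theorem label_injective (H : RankCut r m z) {s t : List Bool} (hs : s.length = 4 * m + 3)
    (ht : t.length = 4 * m + 3) (hls : Labelled (RankSucc r) s) (hlt : Labelled (RankSucc r) t)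
    (h : label s = label t) : s = t := by
  by_cases hz : label s = z
  · obtain ⟨y, hy, hiff⟩ := H.exists_isPair_iff
    rw [(hiff s hs).1 (H.isPair_of_label hs hls hz),
      (hiff t ht).1 (H.isPair_of_label ht hlt (h ▸ hz))]
  · have hs' := hls.resolve_right fun h' => hz (H.label_of_isPair hs h')
    have ht' := hlt.resolve_right fun h' => hz (h.trans (H.label_of_isPair ht h'))
    rw [(length_label_of_isPadded hs hs').2, (length_label_of_isPadded ht ht').2, h]

/-- Labelled strings end in `0`: padding leaves at least three final zeros, and the pair code ends
with a separator of `spread` or, if `y` is empty, with the end of the header. So two labelled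
strings are never lexicographic neighbours. -/
theorem rank_odd (H : RankCut r m z) {s : List Bool} (hs : s.length = 4 * m + 3)
    (h : Labelled (RankSucc r) s) : rank s % 2 = 1 := by
  suffices h' : ∃ c : List Bool, s = c ++ [false] by
    obtain ⟨c, rfl⟩ := h'
    rw [rank_append_singleton]
    simp
  rcases h with h | h
  · obtain ⟨h₁, h₂⟩ := length_label_of_isPadded hs h
    obtain ⟨j, hj⟩ := Nat.exists_eq_succ_of_ne_zero
      (by omega : 4 * m + 3 - 4 * (label s).length ≠ 0)
    rw [hj, List.replicate_succ', ← List.append_assoc] at h₂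
    exact ⟨_, h₂⟩
  · obtain ⟨y, hy, hiff⟩ := H.exists_isPair_iff
    obtain rfl | ⟨y, b, rfl⟩ := List.eq_nil_or_concat' y
    · exact ⟨z.flatMap (fun b => [true, b]), by rw [(hiff s hs).1 h]; simp [header, spread]⟩
    · exact ⟨header z ++ (spread y ++ [b]), by rw [(hiff s hs).1 h]; simp [spread]⟩

theorem not_labelled_lexNext (H : RankCut r m z) {s : List Bool} (hs : s.length = 4 * m + 3)
    (ht : (lexNext s).length = 4 * m + 3) (h : Labelled (RankSucc r) s) :
    ¬ Labelled (RankSucc r) (lexNext s) := by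
  intro h'
  have h₁ := H.rank_odd hs h
  have h₂ := H.rank_odd ht h'
  rw [rank_lexNext] at h₂
  omega

end RankCut

theorem length_lexNext_of_rank_lt {n : ℕ} {s t : List Bool} (hs : s.length = n) (ht : t.length = n)
    (h : rank s < rank t) : (lexNext s).length = n := by
  have h₁ := length_le_of_rank_le (a := s) (b := lexNext s) (by rw [rank_lexNext]; omega)
  have h₂ := length_le_of_rank_le (a := lexNext s) (b := t) (by rw [rank_lexNext]; omega)
  omega

open Classical in
/-- The sort key of a string of length `4m + 3`: the labelled strings come first. -/
noncomputable def sortKey (r : List Bool → ℕ) (z s : List Bool) : ℕ :=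
  if Labelled (RankSucc r) s then r (label s) else r z + 1 + rank s

theorem sortKey_of_labelled {r : List Bool → ℕ} {z s : List Bool} (h : Labelled (RankSucc r) s) :
    sortKey r z s = r (label s) :=
  if_pos h

theorem sortKey_of_not_labelled {r : List Bool → ℕ} {z s : List Bool}
    (h : ¬ Labelled (RankSucc r) s) : sortKey r z s = r z + 1 + rank s :=
  if_neg h

/-! ### The sort key realizes the successor relation -/

namespace RankCut

variable {r : List Bool → ℕ} {m : ℕ} {z : List Bool}

theorem labelled_of_sortKey_le (H : RankCut r m z) {s t : List Bool} (ht : t.length = 4 * m + 3)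
    (h : sortKey r z s ≤ sortKey r z t) (hl : Labelled (RankSucc r) t) :
    Labelled (RankSucc r) s := by
  by_contra hs
  rw [sortKey_of_not_labelled hs, sortKey_of_labelled hl] at h
  have := H.label_le ht hl
  omega

theorem sortKey_injOn (H : RankCut r m z) : Set.InjOn (sortKey r z) (strings (4 * m + 3)) := by
  intro s hs t ht h
  by_cases hl : Labelled (RankSucc r) t
  · have hl' := H.labelled_of_sortKey_le ht h.le hl
    rw [sortKey_of_labelled hl, sortKey_of_labelled hl'] at h
    exact H.label_injective hs ht hl' hl (H.bijective.1 h)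
  · have hl' : ¬ Labelled (RankSucc r) s := fun h' => hl (H.labelled_of_sortKey_le hs h.ge h')
    rw [sortKey_of_not_labelled hl, sortKey_of_not_labelled hl'] at h
    exact rank_injective (by omega)

theorem labelled_replicate_false (n : ℕ) :
    Labelled (RankSucc r) (List.replicate n false) ∧ label (List.replicate n false) = [] :=
  ⟨.inl (isPadded_iff.2 ⟨[], n, rfl⟩), label_padCode_append [] n⟩

theorem not_labelled_replicate_true (H : RankCut r m z) :
    ¬ Labelled (RankSucc r) (List.replicate (4 * m + 3) true) := by
  intro h
  have h₁ := H.rank_odd (by simp) h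
  have h₂ := rank_replicate_true (4 * m + 3)
  rw [pow_succ] at h₂
  omega

/-- `LabelSucc` is the successor relation of the sort keys. -/
theorem labelSucc_iff (H : RankCut r m z) {s t : List Bool} (hs : s ∈ strings (4 * m + 3))
    (ht : t ∈ strings (4 * m + 3)) : LabelSucc (RankSucc r) s t ↔ sortKey r z s < sortKey r z t ∧
      ∀ v ∈ strings (4 * m + 3), ¬ (sortKey r z s < sortKey r z v ∧
        sortKey r z v < sortKey r z t) := by
  have hz0 := labelled_replicate_false (r := r) (4 * m + 3)
  have hs' : s.length = 4 * m + 3 := hs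
  have ht' : t.length = 4 * m + 3 := ht
  have hmap : s.map (fun _ => false) = List.replicate (4 * m + 3) false := by
    rw [List.map_const', hs']
  have hFlen : (lexNext (List.replicate (4 * m + 3) false)).length = 4 * m + 3 := by
    refine length_lexNext_of_rank_lt (t := List.replicate (4 * m + 3) true) (by simp) (by simp) ?_
    have h₁ := rank_replicate_true (4 * m + 3)
    have h₂ := rank_replicate_false (4 * m + 3)
    have h₃ := Nat.one_lt_two_pow (n := 4 * m + 3) (by omega)
    rw [pow_succ] at h₁
    omega
  have hF := H.not_labelled_lexNext (by simp) hFlen hz0.1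
  rw [LabelSucc, hmap]
  by_cases hls : Labelled (RankSucc r) s <;> by_cases hlt : Labelled (RankSucc r) t
  · have hne : t ≠ lexNext (List.replicate (4 * m + 3) false) := by
      rintro rfl; exact hF hlt
    simp only [hls, hlt, hne, true_and, not_true_eq_false, false_and, and_false, or_false]
    rw [sortKey_of_labelled hls, sortKey_of_labelled hlt, RankSucc]
    constructor
    · intro h
      exact ⟨by omega, fun v _ => by omega⟩
    · rintro ⟨h₁, h₂⟩
      by_contra hne
      have hle := H.label_le ht' hlt
      -- The labels exhaust the initial segment up to `z`, so a gap between two labels would be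
      -- filled by another labelled string.
      obtain ⟨v, hv⟩ := H.bijective.2 (r (label s) + 1)
      obtain ⟨u, hu, hlu, rfl⟩ := H.exists_label (v := v) (by omega)
      refine h₂ u hu ?_
      rw [sortKey_of_labelled hlu]
      omega
  -- The passage out of the labelled part: it starts at the pair code of `z` and leads to the first
  -- unlabelled string, which is `0…01`, because `0…0` carries the label `[]`.
  · simp only [hls, hlt, not_true_eq_false, false_and, and_false, or_false, false_or]
    have hle := H.label_le hs' hls
    rw [sortKey_of_labelled hls, sortKey_of_not_labelled hlt]
    constructor
    · rintro ⟨hp, rfl⟩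
      rw [H.label_of_isPair hs' hp]
      refine ⟨by omega, fun v hv => ?_⟩
      by_cases hlv : Labelled (RankSucc r) v
      · have := H.label_le hv hlv
        rw [sortKey_of_labelled hlv]
        omega
      · rw [sortKey_of_not_labelled hlv, rank_lexNext]
        rintro ⟨-, h⟩
        have := rank_replicate_false_le (show v.length = 4 * m + 3 from hv)
        refine hlv ?_
        rw [rank_injective (by omega : rank v = rank (List.replicate (4 * m + 3) false))]
        exact hz0.1
    · rintro ⟨-, h⟩
      constructor
      · by_contra hp
        obtain ⟨u, hu, hlu, hzu⟩ := H.exists_label (v := z) le_rfl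
        have hne : r (label s) ≠ r z := fun h' =>
          hp (H.isPair_of_label hs' hls (H.bijective.1 h'))
        refine h u hu ?_
        rw [sortKey_of_labelled hlu, hzu]
        omega
      · by_contra hne
        have h₁ := rank_replicate_false_le ht'
        have h₂ : rank t ≠ rank (List.replicate (4 * m + 3) false) := fun h' =>
          hlt (by rw [rank_injective h']; exact hz0.1)
        have h₃ : rank t ≠ rank (lexNext (List.replicate (4 * m + 3) false)) := fun h' =>
          hne (rank_injective h')
        rw [rank_lexNext] at h₃
        refine h _ hFlen ?_
        rw [sortKey_of_not_labelled hF, rank_lexNext]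
        omega
  · have hp : ¬ IsPair (RankSucc r) s := fun h => hls (.inr h)
    simp only [hls, hlt, hp, false_and, not_true_eq_false, and_false, or_false, false_iff]
    rintro ⟨h, -⟩
    exact hls (H.labelled_of_sortKey_le ht' h.le hlt)
  · have hp : ¬ IsPair (RankSucc r) s := fun h => hls (.inr h)
    simp only [hls, hlt, hp, false_and, not_false_eq_true, true_and, false_or]
    rw [sortKey_of_not_labelled hls, sortKey_of_not_labelled hlt]
    constructor
    · rintro (rfl | ⟨h, rfl⟩)
      · rw [rank_lexNext]
        refine ⟨by omega, fun v hv => ?_⟩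
        omega
      · rw [rank_lexNext, rank_lexNext]
        refine ⟨by omega, fun v hv => ?_⟩
        by_cases hlv : Labelled (RankSucc r) v
        · have := H.label_le hv hlv
          rw [sortKey_of_labelled hlv]
          omega
        · rw [sortKey_of_not_labelled hlv]
          intro h'
          have := rank_lexNext s
          exact hlv (rank_injective (by omega : rank v = rank (lexNext s)) ▸ h)
    · rintro ⟨h₁, h₂⟩
      by_cases hts : t = lexNext s
      · exact .inl hts
      right
      have hr₁ := rank_lexNext s
      have hne : rank t ≠ rank (lexNext s) := fun h' => hts (rank_injective h')
      have hlen := length_lexNext_of_rank_lt hs' ht' (by omega)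
      -- Since `t` is beyond `lexNext s`, that string can be skipped only if it is labelled; its own
      -- successor is then unlabelled and must be `t`.
      have hl : Labelled (RankSucc r) (lexNext s) := by
        by_contra hl
        refine h₂ _ hlen ?_
        rw [sortKey_of_not_labelled hl]
        omega
      refine ⟨hl, ?_⟩
      by_contra hne'
      have hr₂ := rank_lexNext (lexNext s)
      have hne'' : rank t ≠ rank (lexNext (lexNext s)) := fun h' => hne' (rank_injective h')
      have hlen' := length_lexNext_of_rank_lt hlen ht' (by omega)
      have hl' := H.not_labelled_lexNext hlen hlen' hl
      refine h₂ _ hlen' ?_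
      rw [sortKey_of_not_labelled hl']
      omega

theorem sortKey_replicate_false_le (H : RankCut r m z) {t : List Bool} :
    sortKey r z (List.replicate (4 * m + 3) false) ≤ sortKey r z t := by
  have h := labelled_replicate_false (r := r) (4 * m + 3)
  rw [sortKey_of_labelled h.1, h.2]
  have hz : r [] ≤ r z := (H.lt_of_length_lt _ _ (by simp [H.length_eq])).le
  by_cases hl : Labelled (RankSucc r) t
  · rw [sortKey_of_labelled hl]
    by_cases ht : label t = []
    · rw [ht]
    · exact (H.lt_of_length_lt [] (label t) (List.length_pos_iff.2 ht)).le
  · rw [sortKey_of_not_labelled hl]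
    omega

theorem sortKey_le_replicate_true (H : RankCut r m z) {t : List Bool} (ht : t ∈ strings (4 * m + 3)) :
    sortKey r z t ≤ sortKey r z (List.replicate (4 * m + 3) true) := by
  rw [sortKey_of_not_labelled H.not_labelled_replicate_true]
  by_cases hl : Labelled (RankSucc r) t
  · rw [sortKey_of_labelled hl]
    have := H.label_le ht hl
    omega
  · rw [sortKey_of_not_labelled hl]
    have := rank_le_replicate_true (show t.length = 4 * m + 3 from ht)
    omega

end RankCut

/-! ### `CL#P ⊆ CLU#P` -/

/-- A discrete intermediate value property: consecutive ranks in a chain differ by one, so none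
between the ends is skipped. The hypothesis on `n` is symmetric because chains may run in either
direction. -/
theorem exists_eqvGen_of_rank {r : List Bool → ℕ} (hr : Function.Bijective r) {M : NTM}
    {x : List Bool} {y z : M.paths x}
    (h : Relation.EqvGen (PathSim (fun s t => r s ≤ r t) M x) y z) {n : ℕ}
    (hn : (r y ≤ n ∧ n ≤ r z) ∨ (r z ≤ n ∧ n ≤ r y)) :
    ∃ v : M.paths x, Relation.EqvGen (PathSim (fun s t => r s ≤ r t) M x) y v ∧ r v = n := by
  induction h generalizing n with
  | rel y z h =>
    have hadj := h.1
    rw [adj_rank_iff hr, adj_rank_iff hr] at hadj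
    by_cases hy : r y = n
    · exact ⟨y, .refl _, hy⟩
    · exact ⟨z, .rel _ _ h, by omega⟩
  | refl y => exact ⟨y, .refl _, by omega⟩
  | symm y z h ih =>
    obtain ⟨v, hv, rfl⟩ := ih hn.symm
    exact ⟨v, (h.symm _ _).trans _ _ _ hv, rfl⟩
  | trans y w z h₁ h₂ ih₁ ih₂ =>
    -- A value between the ranks of `y` and `z` lies between those of `y` and `w` or between those
    -- of `w` and `z`.
    by_cases hw : (r y ≤ n ∧ n ≤ r w) ∨ (r w ≤ n ∧ n ≤ r y)
    · exact ih₁ hw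
    · obtain ⟨v, hv, rfl⟩ := ih₂ (n := n) (by omega)
      exact ⟨v, h₁.trans _ _ _ hv, rfl⟩

/-- Convexity of clusters: a string whose rank lies between two members is visited by the chain that
joins them. -/
theorem IsCluster.mem_of_rank {r : List Bool → ℕ} (hr : Function.Bijective r) {M : NTM}
    {x : List Bool} {C : Set (List Bool)} (hC : IsCluster (fun s t => r s ≤ r t) M x C)
    {a u v : List Bool} (ha : a ∈ C) (hu : u ∈ C) (hav : r a ≤ r v) (hvu : r v ≤ r u) : v ∈ C := by
  rcases hC with rfl | ⟨y, -, rfl⟩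
  · exact ha
  · obtain ⟨a, rfl, ha⟩ := ha
    obtain ⟨u, rfl, hu⟩ := hu
    obtain ⟨w, hw, hwv⟩ :=
      exists_eqvGen_of_rank hr ((ha.symm _ _).trans _ _ _ hu) (.inl ⟨hav, hvu⟩)
    exact ⟨w, hr.1 hwv, ha.trans _ _ _ hw⟩

theorem isNatPoly_pad {p : ℕ → ℕ} (hp : IsNatPoly p) : IsNatPoly fun n => 4 * p n + 3 := by
  obtain ⟨q, hq⟩ := hp
  exact ⟨4 * q + 3, fun n => by simp [hq]⟩

theorem fpt_replicate {p : ℕ → ℕ}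
    (h : PT (fun x : List Bool => x) fun x => List.replicate (p x.length) false) (b : Bool) :
    FPt fun x => List.replicate (4 * p x.length + 3) b :=
  fpt_of_pt (((h.flatMap fun _ => List.replicate 4 b).append
    (PT.const _ (List.replicate 3 b))).congr (fun _ => rfl) fun x => by
      rw [List.eq_replicate_iff]
      refine ⟨by simp [mul_comm], fun c hc => ?_⟩
      simp only [List.mem_append, List.mem_flatMap, List.mem_replicate] at hc
      rcases hc with ⟨-, -, -, h⟩ | ⟨-, h⟩ <;> exact h)

theorem clSharpP_subset : CLSharpP ⊆ CLUSharpP := by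
  rintro f ⟨p, hp, M, hM, hMp, A, hA, hl, hJ, hacc⟩
  obtain ⟨r, hr, rfl⟩ := exists_rank hA hl
  have hlr : ∀ s t : List Bool, s.length < t.length → r s < r t :=
    fun s t h => (strictPart_rank_iff hr.1).1 (hl s t h)
  have hJ' : PolyTimePred₂ (RankSucc r) := by
    have : Adj (fun s t => r s ≤ r t) = RankSucc r :=
      funext fun s => funext fun t => propext (adj_rank_iff hr)
    rwa [this] at hJ
  have hclock := pt_replicate_of_isBalanced hM hMp
  obtain ⟨M', hM', hM'p, hacc'⟩ := exists_ntm_pad hM hMp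
  -- The predicate ignores the input: two strings of length `4m + 3` already determine what is
  -- needed of the cut at `m`.
  refine ⟨fun n => 4 * p n + 3, isNatPoly_pad hp, M', hM', hM'p, _, _, fpt_replicate hclock false,
    fpt_replicate hclock true, fun _ => LabelSucc (RankSucc r),
    PD.polyTimePred (PD.labelSucc hJ' pt_triple_snd pt_triple_thd), fun x => ?_⟩
  obtain ⟨z, H⟩ := exists_rankCut hr hlr (p x.length)
  obtain ⟨h, hbij, hle⟩ := exists_reordering H.sortKey_injOn
  have hcode : ∀ y : List Bool, y.length = p x.length →
      padCode y ++ List.replicate 3 false ∈ strings (4 * p x.length + 3) ∧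
      sortKey r z (padCode y ++ List.replicate 3 false) = r y := by
    intro y hy
    refine ⟨by simp [strings, length_padCode, hy], ?_⟩
    rw [sortKey_of_labelled (.inl (isPadded_iff.2 ⟨y, 3, rfl⟩)), label_padCode_append]
  have hmem : ∀ y ∈ M.acc x, y.length = p x.length := NTM.acc_subset_strings hMp x
  have himage : M'.acc x = (fun y => padCode y ++ List.replicate 3 false) '' M.acc x := by
    ext w
    simp only [hacc', Set.mem_image, eq_comm]
  refine ⟨h, hbij, ⟨by simp, by simp⟩, ⟨?_, ?_⟩, fun s hs t ht => ?_, fun hfx => ?_, ?_⟩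
  · exact reordering_eq_replicate_false hbij hle (by simp [strings])
      fun t _ => H.sortKey_replicate_false_le
  · exact reordering_eq_replicate_true hbij hle (by simp [strings])
      fun t ht => H.sortKey_le_replicate_true ht
  · exact (H.labelSucc_iff hs ht).trans (lexSucc_reordering hbij hle hs ht).symm
  · have hne : (M.acc x).Nonempty := by
      rw [Set.nonempty_iff_ne_empty]
      intro h'
      rw [(hacc x).2, NTM.numAcc, h'] at hfx
      simp at hfx
    -- The interval of the new paths runs between the codes of the accepting paths of least and of
    -- greatest rank.
    obtain ⟨a, ha, hamin⟩ := Set.exists_min_image _ r (NTM.finite_acc hMp x) hne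
    obtain ⟨u, hu, humax⟩ := Set.exists_max_image _ r (NTM.finite_acc hMp x) hne
    obtain ⟨ha₁, ha₂⟩ := hcode a (hmem a ha)
    obtain ⟨hu₁, hu₂⟩ := hcode u (hmem u hu)
    refine ⟨_, ha₁, _, hu₁, ?_⟩
    rw [himage]
    ext w
    simp only [lexLE_iff]
    constructor
    · rintro ⟨y, hy, rfl⟩
      obtain ⟨hy₁, hy₂⟩ := hcode y (hmem y hy)
      refine ⟨hy₁, ?_, ?_⟩
      · rw [hle _ ha₁ _ hy₁, ha₂, hy₂]
        exact hamin y hy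
      · rw [hle _ hy₁ _ hu₁, hu₂, hy₂]
        exact humax y hy
    · rintro ⟨hw, h₁, h₂⟩
      rw [hle _ ha₁ _ hw] at h₁
      rw [hle _ hw _ hu₁] at h₂
      -- Everything below a labelled key is labelled. The label of `w` lies between `a` and `u`, so
      -- it is accepting by convexity, and `w` is its code by injectivity of labels.
      have hlw : Labelled (RankSucc r) w :=
        H.labelled_of_sortKey_le hu₁ h₂ (.inl (isPadded_iff.2 ⟨u, 3, rfl⟩))
      rw [ha₂, sortKey_of_labelled hlw] at h₁
      rw [hu₂, sortKey_of_labelled hlw] at h₂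
      have hv : label w ∈ M.acc x := (hacc x).1.mem_of_rank hr ha hu h₁ h₂
      obtain ⟨hv₁, hv₂⟩ := hcode _ (hmem _ hv)
      exact ⟨_, hv, H.label_injective hv₁ hw (.inl (isPadded_iff.2 ⟨_, 3, rfl⟩)) hlw
        (label_padCode_append _ 3)⟩
  · rw [(hacc x).2, NTM.numAcc, NTM.numAcc, himage, Set.ncard_image_of_injective]
    intro y y' heq
    have := congrArg padPart heq
    rwa [padPart_padCode_append, padPart_padCode_append] at this

end ClusterComputing

theorem theorem3p1 : ClusterComputing.CLUSharpP = ClusterComputing.CLSharpP :=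
  Set.Subset.antisymm ClusterComputing.cluSharpP_subset ClusterComputing.clSharpP_subset
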